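/- Let $m>1$, $0<p<1$ and let $N>0$ be a real number. Consider nonnegative continuous solutions $w=w(y,\tau)$, in the sense of distributions on $\mathbb{R}\times\mathbb{R}$, of the reaction-convection-diffusion equation $$w_\tau=(w^m)_{yy}+\frac{N(m-1)+2(m+1)}{m-1}(w^m)_y+\frac{2m(N(m-1)+2)}{(m-1)^2}w^m+w^p. \qquad (*)$$ A \emph{traveling wave} with speed $c\in\mathbb{R}$ is a solution of $(*)$ of the form $w(y,\tau)=f(y-c\tau)$ with $f\not\equiv0$; $f$ is its profile. It is called \emph{good} if $F(\xi)=\xi^{2/(m-1)}f(\ln\xi)$, $\xi>0$, satisfies $F(\xi)\to A$ for some $A>0$, $F'(\xi)\to0$ and $\xi^{N-1}F'(\xi)\to0$ as $\xi\to0^+$ (the last condition follows from the second if $N\ge1$). (i) If $m+p\ge2$, there exists a unique $c^*>0$ with the following properties. A good traveling wave with speed $c\in\mathbb{R}$ exists if and only if $c\ge c^*$, and its profile is then unique up to translations. All these waves are compactly supported to the right: there is $y_0\in\mathbb{R}$ with $f>0$ on $(-\infty,y_0)$ and $f=0$ on $[y_0,\infty)$. If moreover $m+p>2$, then the good traveling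 wave with minimal speed $c=c^*$ has an interface of Type I, that is, for some $C>0$, $$f(y)\sim C(y_0-y)_+^{1/(m-1)}\quad\text{as } y\to y_0,\ y<y_0,$$ while all the good traveling waves with speed $c>c^*$ have an interface of Type II, that is, for some $C>0$, $$f(y)\sim C(y_0-y)_+^{1/(1-p)}\quad\text{as } y\to y_0,\ y<y_0.$$ (ii) If $m+p<2$, then $(*)$ has no traveling waves, good or not, of any speed $c\in\mathbb{R}$. -/

import Mathlib

open Filter Topology MeasureTheory
open scoped ContDiff

noncomputable section

/-- Convection coefficient `(N(m-1) + 2(m+1)) / (m-1)`. -/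
def convCoeff (m N : ℝ) : ℝ := (N * (m - 1) + 2 * (m + 1)) / (m - 1)

/-- Coefficient `2m(N(m-1) + 2) / (m-1)^2` of the zero-order term `w^m`. -/
def reactCoeff (m N : ℝ) : ℝ := 2 * m * (N * (m - 1) + 2) / (m - 1) ^ 2

/-- `w = w(y, τ)` is a continuous nonnegative (eternal) solution, in the sense of distributions on
`ℝ × ℝ`, of
`w_τ = (w^m)_yy + convCoeff m N * (w^m)_y + reactCoeff m N * w^m + w^p`.
All derivatives are moved to the test function `φ`, a smooth compactly supported function
of `(y, τ)`. -/
structure IsSolution (m p N : ℝ) (w : ℝ → ℝ → ℝ) : Prop where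
  continuous : Continuous fun z : ℝ × ℝ => w z.1 z.2
  nonneg : ∀ y τ, 0 ≤ w y τ
  weak : ∀ φ : ℝ × ℝ → ℝ, ContDiff ℝ ∞ φ → HasCompactSupport φ →
    ∫ z : ℝ × ℝ,
      (w z.1 z.2 * deriv (fun τ => φ (z.1, τ)) z.2
        + w z.1 z.2 ^ m * iteratedDeriv 2 (fun y => φ (y, z.2)) z.1
        - convCoeff m N * w z.1 z.2 ^ m * deriv (fun y => φ (y, z.2)) z.1
        + reactCoeff m N * w z.1 z.2 ^ m * φ z
        + w z.1 z.2 ^ p * φ z) = 0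

/-- `f` is the profile of a (nontrivial, nonnegative) traveling wave advancing to the right with
speed `c`, that is, `w(y, τ) = f(y - cτ)` is a solution. -/
structure IsTravelingWave (m p N c : ℝ) (f : ℝ → ℝ) : Prop where
  solution : IsSolution m p N fun y τ => f (y - c * τ)
  ne_zero : f ≠ 0

/-- The profile of `u(r, t) = r^(2/(m-1)) w(log r, t)` when `w` has profile `f`. -/
def radialProfile (m : ℝ) (f : ℝ → ℝ) (ξ : ℝ) : ℝ := ξ ^ (2 / (m - 1)) * f (Real.log ξ)

/-- The profile `F` in the radial variable satisfies `F(0) = A > 0` and `F'(0) = 0`, with no flux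
through the origin, `ξ^(N-1) F'(ξ) → 0`. The flux condition follows from `F'(0) = 0` if `N ≥ 1`;
it is the natural form of `F'(0) = 0` if the real parameter `N` is less than `1`. -/
def RegularAtOrigin (m N : ℝ) (f : ℝ → ℝ) : Prop :=
  (∃ A : ℝ, 0 < A ∧ Tendsto (radialProfile m f) (𝓝[>] 0) (𝓝 A)) ∧
  Tendsto (deriv (radialProfile m f)) (𝓝[>] 0) (𝓝 0) ∧
  Tendsto (fun ξ => ξ ^ (N - 1) * deriv (radialProfile m f) ξ) (𝓝[>] 0) (𝓝 0)

/-- A traveling wave whose radial profile is good at the origin. -/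
def IsGoodTravelingWave (m p N c : ℝ) (f : ℝ → ℝ) : Prop :=
  IsTravelingWave m p N c f ∧ RegularAtOrigin m N f

/-- `f` is compactly supported to the right, with its interface at `y₀`. -/
def HasInterfaceAt (f : ℝ → ℝ) (y₀ : ℝ) : Prop :=
  (∀ y, y < y₀ → 0 < f y) ∧ ∀ y, y₀ ≤ y → f y = 0

/-- `f(y) ~ C (y₀ - y)^κ` as `y → y₀` from the left, for some `C > 0`. -/
def InterfaceBehavior (f : ℝ → ℝ) (y₀ κ : ℝ) : Prop :=
  ∃ C : ℝ, 0 < C ∧ Tendsto (fun y => f y / (y₀ - y) ^ κ) (𝓝[<] y₀) (𝓝 C)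

/-- Interface of Type I: `f(y) ~ C (y₀ - y)_+^{1/(m-1)}`. -/
def HasTypeI (m : ℝ) (f : ℝ → ℝ) : Prop :=
  ∃ y₀, HasInterfaceAt f y₀ ∧ InterfaceBehavior f y₀ (1 / (m - 1))

/-- Interface of Type II: `f(y) ~ C (y₀ - y)_+^{1/(1-p)}`. -/
def HasTypeII (p : ℝ) (f : ℝ → ℝ) : Prop :=
  ∃ y₀, HasInterfaceAt f y₀ ∧ InterfaceBehavior f y₀ (1 / (1 - p))

end

noncomputable section

/-! ### Test functions in one variable -/

/-! Write a = k + l and b = kl, with k = `rootK m` and l = `rootL m N`: -k and -l are the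
characteristic roots of the part of the equation in w^m, and N > 0 amounts to k < ml. A
distributional wave is a classical solution of a first-order system for f^m and the flux Φ = (f^m)'
+ a f^m + c f, where Φ' = -(b f^m + f^p) (`isTravelingWave_iff`). The flux is monotone and vanishes
where f does, and since p < 1 the term f^p exhausts it in finite distance. Hence every wave has c >
0 and vanishes exactly on a right half-line (`IsProfile.exists_hasInterfaceAt`). Near the interface
κ f^(m+p-1) ≤ Φ ≤ C f, which is impossible if m + p < 2 (`IsProfile.two_le_add`).

A good wave is strictly decreasing up to its interface, so P = -(f^m)' is a function of s = f and
solves a scalar first-order equation. Regularity at the origin becomes P = k s^m + O(s) as s → ∞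
(`IsProfile.exists_orbit`). A positive difference of two such solutions would behave like s^(ml/k),
which is not O(s) as k < ml; so the good orbit is unique for each speed, and it decreases with the
speed (`le_of_good`). It exists for every c > 0, between explicit barriers (`exists_good_orbit`). It
comes from a wave exactly when P(0+) = 0, and integrating f' = -P(f)/(m f^(m-1)) recovers the wave
up to a translation (`IsTravelTime`). The speeds with P(0+) = 0 form a half-line [c*, ∞) with c* > 0
(`exists_critical_speed`).

If m + p > 2, an orbit that reaches the origin satisfies P ~ c s or P ~ (m/c) s^(m+p-1) there, and
these integrate to Types I and II. For c > c* the orbit lies below the critical one, so P ≤ (k+l)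
s^m + c* s and the first case is excluded. At c = c* the second case is excluded: falling below a
line ηs near the origin is stable under a small decrease of the speed and forces P(0+) = 0, against
the minimality of c*. -/

theorem integrable_mul_of_hasCompactSupport {u θ : ℝ → ℝ} (hu : Continuous u) (hθ : Continuous θ)
    (hs : HasCompactSupport θ) : Integrable fun x => u x * θ x :=
  (hu.mul hθ).integrable_of_hasCompactSupport hs.mul_left

/-- The primitive that starts to the left of the support vanishes again to the right of it exactly
because the integral is zero. -/
theorem HasCompactSupport.exists_antideriv {θ : ℝ → ℝ} (hθ : ContDiff ℝ ∞ θ)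
    (hs : HasCompactSupport θ) (h0 : ∫ x, θ x = 0) :
    ∃ ψ : ℝ → ℝ, ContDiff ℝ ∞ ψ ∧ HasCompactSupport ψ ∧ deriv ψ = θ := by
  obtain ⟨R, hR⟩ := hs.isCompact.isBounded.subset_closedBall 0
  have hzero : ∀ x, x ∉ Set.Icc (-R) R → θ x = 0 := by
    intro x hx
    by_contra h
    have := hR (subset_tsupport _ h)
    rw [Real.closedBall_eq_Icc] at this
    simp at this hx
    linarith [hx this.1]
  have hd : ∀ x, HasDerivAt (fun x => ∫ t in (-R)..x, θ t) (θ x) x := fun x =>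
    (hθ.continuous.integral_hasStrictDerivAt _ _).hasDerivAt
  have hder : deriv (fun x => ∫ t in (-R)..x, θ t) = θ := funext fun x => (hd x).deriv
  refine ⟨fun x => ∫ t in (-R)..x, θ t, ?_, ?_, hder⟩
  · rw [contDiff_infty_iff_deriv]
    exact ⟨fun x => (hd x).differentiableAt, by rwa [hder]⟩
  · refine HasCompactSupport.intro (isCompact_Icc (a := -R) (b := R)) fun x hx => ?_
    rw [Set.mem_Icc, not_and_or, not_le, not_le] at hx
    rcases hx with hx | hx
    · rw [intervalIntegral.integral_symm, neg_eq_zero]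
      rw [intervalIntegral.integral_of_le hx.le, integral_Ioc_eq_integral_Ioo]
      refine setIntegral_eq_zero_of_forall_eq_zero fun t ht => hzero t fun h => ?_
      exact absurd ht.2 (not_lt.2 h.1)
    · by_cases hR0 : -R ≤ x
      · rw [intervalIntegral.integral_of_le hR0, ← integral_Icc_eq_integral_Ioc]
        rw [← h0]
        refine setIntegral_eq_integral_of_forall_compl_eq_zero fun t ht => hzero t fun h => ht ?_
        exact ⟨h.1, h.2.trans hx.le⟩
      · have : θ = 0 := funext fun t => hzero t fun h => by linarith [h.1, h.2]
        simp [this]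

theorem exists_contDiff_integral_eq_one :
    ∃ η : ℝ → ℝ, ContDiff ℝ ∞ η ∧ HasCompactSupport η ∧ ∫ x, η x = 1 := by
  let b : ContDiffBump (0 : ℝ) := ⟨1, 2, one_pos, one_lt_two⟩
  exact ⟨b.normed volume, b.contDiff_normed, b.hasCompactSupport_normed, b.integral_normed⟩

theorem integral_deriv_eq_zero_of_hasCompactSupport {u u' : ℝ → ℝ} (hd : ∀ x, HasDerivAt u (u' x) x)
    (hc : Continuous u') (hs : HasCompactSupport u) : ∫ x, u' x = 0 := by
  have hs' : HasCompactSupport u' := by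
    have := hs.deriv
    rwa [show deriv u = u' from funext fun x => (hd x).deriv] at this
  have hu : Continuous u := continuous_iff_continuousAt.2 fun x => (hd x).continuousAt
  exact integral_eq_zero_of_hasDerivAt_of_integrable hd (hc.integrable_of_hasCompactSupport hs')
    (hu.integrable_of_hasCompactSupport hs)

theorem integral_mul_deriv_of_hasCompactSupport {u u' ψ : ℝ → ℝ}
    (hu : ∀ x, HasDerivAt u (u' x) x) (hc : Continuous u') (hψ : ContDiff ℝ 1 ψ)
    (hs : HasCompactSupport ψ) :
    ∫ x, u x * deriv ψ x = - ∫ x, u' x * ψ x := by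
  have huc : Continuous u := continuous_iff_continuousAt.2 fun x => (hu x).continuousAt
  have hψ' : Continuous (deriv ψ) := hψ.continuous_deriv le_rfl
  have hψd : ∀ x, HasDerivAt ψ (deriv ψ x) x := fun x =>
    (hψ.differentiable one_ne_zero x).hasDerivAt
  refine integral_mul_deriv_eq_deriv_mul_of_integrable (fun x _ => hu x) (fun x _ => hψd x) ?_ ?_ ?_
  · exact (huc.mul hψ').integrable_of_hasCompactSupport hs.deriv.mul_left
  · exact (hc.mul hψ.continuous).integrable_of_hasCompactSupport hs.mul_left
  · exact (huc.mul hψ.continuous).integrable_of_hasCompactSupport hs.mul_left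

/-- A linear functional of test functions that vanishes on derivatives is a multiple of the
integral. -/
theorem functional_eq_const_mul_integral {T : (ℝ → ℝ) → ℝ}
    (hlin : ∀ (θ η : ℝ → ℝ) (r : ℝ), ContDiff ℝ ∞ θ → HasCompactSupport θ → ContDiff ℝ ∞ η →
      HasCompactSupport η → T (fun x => θ x - r * η x) = T θ - r * T η)
    (h : ∀ ψ, ContDiff ℝ ∞ ψ → HasCompactSupport ψ → T (deriv ψ) = 0) :
    ∃ C : ℝ, ∀ θ, ContDiff ℝ ∞ θ → HasCompactSupport θ → T θ = C * ∫ x, θ x := by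
  obtain ⟨η, hη, hηs, hη1⟩ := exists_contDiff_integral_eq_one
  -- The function θ - (∫ θ) η has integral zero, hence is the derivative of a test function, and `T`
  -- kills it.
  refine ⟨T η, fun θ hθ hθs => ?_⟩
  have hint : ∫ x, (θ x - (∫ x, θ x) * η x) = 0 := by
    rw [integral_sub (hθ.continuous.integrable_of_hasCompactSupport hθs)
      ((hη.continuous.integrable_of_hasCompactSupport hηs).const_mul _), integral_const_mul, hη1]
    ring
  obtain ⟨ψ, hψ, hψs, hψ'⟩ := HasCompactSupport.exists_antideriv
    (θ := fun x => θ x - (∫ x, θ x) * η x) (hθ.sub (contDiff_const.mul hη))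
    (hθs.sub (hηs.mul_left)) hint
  have := h ψ hψ hψs
  rw [hψ', hlin θ η _ hθ hθs hη hηs] at this
  linarith

theorem eq_const_of_integral_mul_eq {u : ℝ → ℝ} (hu : Continuous u) {C : ℝ}
    (h : ∀ θ : ℝ → ℝ, ContDiff ℝ ∞ θ → HasCompactSupport θ →
      ∫ x, u x * θ x = C * ∫ x, θ x) : ∀ x, u x = C := by
  have hae : ∀ᵐ x, u x - C = 0 := by
    refine ae_eq_zero_of_integral_contDiff_smul_eq_zero
      (hu.sub continuous_const).locallyIntegrable fun θ hθ hs => ?_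
    have h1 := h θ hθ hs
    simp only [smul_eq_mul, mul_comm (θ _), sub_mul]
    rw [integral_sub (integrable_mul_of_hasCompactSupport hu hθ.continuous hs)
      ((hθ.continuous.integrable_of_hasCompactSupport hs).const_mul _), integral_const_mul, h1,
      sub_self]
  have := (Continuous.ae_eq_iff_eq volume (hu.sub continuous_const)
    (continuous_const (y := (0 : ℝ)))).1 hae
  intro x
  have := congrFun this x
  simp at this
  linarith

theorem integral_mul_sub_const_mul {u θ η : ℝ → ℝ} (hu : Continuous u) (r : ℝ)
    (hθ : Continuous θ) (hθs : HasCompactSupport θ) (hη : Continuous η)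
    (hηs : HasCompactSupport η) :
    ∫ x, u x * (θ x - r * η x) = (∫ x, u x * θ x) - r * ∫ x, u x * η x := by
  simp only [mul_sub]
  rw [integral_sub (integrable_mul_of_hasCompactSupport hu hθ hθs), ← integral_const_mul]
  · congr 2; ext x; ring
  · exact integrable_mul_of_hasCompactSupport hu (continuous_const.mul hη)
      (hηs.mul_left (f := fun _ => r))

theorem eq_const_of_integral_mul_deriv_eq_zero {u : ℝ → ℝ} (hu : Continuous u)
    (h : ∀ ψ : ℝ → ℝ, ContDiff ℝ ∞ ψ → HasCompactSupport ψ → ∫ x, u x * deriv ψ x = 0) :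
    ∃ C, ∀ x, u x = C := by
  obtain ⟨C, hC⟩ := functional_eq_const_mul_integral (T := fun θ => ∫ x, u x * θ x)
    (fun θ η r hθ hθs hη hηs =>
      integral_mul_sub_const_mul hu r hθ.continuous hθs hη.continuous hηs) h
  exact ⟨C, eq_const_of_integral_mul_eq hu hC⟩

/-- Du Bois-Reymond's lemma, twice: θ ↦ ∫ u θ' kills derivatives, so it equals C ∫ θ, and then u + C
x is orthogonal to all derivatives. -/
theorem eq_affine_of_integral_mul_deriv_deriv_eq_zero {u : ℝ → ℝ} (hu : Continuous u)
    (h : ∀ ψ : ℝ → ℝ, ContDiff ℝ ∞ ψ → HasCompactSupport ψ →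
      ∫ x, u x * deriv (deriv ψ) x = 0) :
    ∃ C D, ∀ x, u x = C * x + D := by
  have hd : ∀ {θ : ℝ → ℝ}, ContDiff ℝ ∞ θ → Continuous (deriv θ) := fun hθ =>
    (contDiff_infty_iff_deriv.1 hθ).2.continuous
  obtain ⟨C, hC⟩ := functional_eq_const_mul_integral (T := fun θ => ∫ x, u x * deriv θ x)
    (fun θ η r hθ hθs hη hηs => by
      have : ∀ x, deriv (fun x => θ x - r * η x) x = deriv θ x - r * deriv η x := fun x => by
        have h1 : DifferentiableAt ℝ θ x := hθ.differentiable (by simp) x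
        have h2 : DifferentiableAt ℝ η x := hη.differentiable (by simp) x
        exact (h1.hasDerivAt.sub (h2.hasDerivAt.const_mul r)).deriv
      simp only [this]
      exact integral_mul_sub_const_mul hu r (hd hθ) hθs.deriv (hd hη) hηs.deriv) h
  obtain ⟨D, hD⟩ := eq_const_of_integral_mul_deriv_eq_zero (u := fun x => u x + C * x)
    (by fun_prop) (fun ψ hψ hs => by
      have h1 := hC ψ hψ hs
      have h2 := integral_mul_deriv_of_hasCompactSupport (u := fun x => C * x) (u' := fun _ => C)
        (fun x => by simpa using (hasDerivAt_id x).const_mul C) continuous_const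
        (hψ.of_le (by exact_mod_cast le_top)) hs
      simp only [add_mul]
      rw [integral_add (integrable_mul_of_hasCompactSupport hu (hd hψ) hs.deriv)
        (integrable_mul_of_hasCompactSupport (by fun_prop) (hd hψ) hs.deriv), h1, h2,
        integral_const_mul, add_neg_cancel])
  exact ⟨-C, D, fun x => by linarith [hD x]⟩

/-! ### From distributional to classical solutions -/

/-- The profile equation `(f^m)'' + a (f^m)' + b f^m + c f' + f^p = 0` in first-order form, with the
flux `Φ = (f^m)' + a f^m + c f`. -/
structure IsProfile (m p a b c : ℝ) (f Φ : ℝ → ℝ) : Prop where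
  cont : Continuous f
  nonneg : ∀ y, 0 ≤ f y
  hasDerivAt_pow : ∀ y, HasDerivAt (fun y => f y ^ m) (Φ y - a * f y ^ m - c * f y) y
  hasDerivAt_flux : ∀ y, HasDerivAt Φ (-(b * f y ^ m + f y ^ p)) y

/-- The profile equation tested against `ψ`. -/
def weakProfile (m p a b c : ℝ) (f ψ : ℝ → ℝ) : ℝ :=
  ∫ x, (f x ^ m * deriv (deriv ψ) x - (c * f x + a * f x ^ m) * deriv ψ x
    + (b * f x ^ m + f x ^ p) * ψ x)

theorem IsProfile.weakProfile_eq_zero {m p a b c : ℝ} {f Φ : ℝ → ℝ} (h : IsProfile m p a b c f Φ)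
    (hm : 0 ≤ m) (hp : 0 ≤ p)
    {ψ : ℝ → ℝ} (hψ : ContDiff ℝ ∞ ψ) (hs : HasCompactSupport ψ) :
    weakProfile m p a b c f ψ = 0 := by
  have hψ' := (contDiff_infty_iff_deriv.1 hψ).2
  have hψ'' := (contDiff_infty_iff_deriv.1 hψ').2
  have hfm : Continuous fun x => f x ^ m := h.cont.rpow_const fun _ => Or.inr hm
  have hfp : Continuous fun x => f x ^ p := h.cont.rpow_const fun _ => Or.inr hp
  have hf := h.cont
  have hΦ : Continuous Φ :=
    continuous_iff_continuousAt.2 fun y => (h.hasDerivAt_flux y).continuousAt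
  have hψc := hψ.continuous
  have hψc' := hψ'.continuous
  have hψc'' := hψ''.continuous
  have d1 : ∀ x, HasDerivAt ψ (deriv ψ x) x := fun x =>
    (hψ.differentiable (by simp) x).hasDerivAt
  have d2 : ∀ x, HasDerivAt (deriv ψ) (deriv (deriv ψ) x) x := fun x =>
    (hψ'.differentiable (by simp) x).hasDerivAt
  refine integral_deriv_eq_zero_of_hasCompactSupport
    (u := fun x => f x ^ m * deriv ψ x - Φ x * ψ x) (fun x => ?_) (by fun_prop)
    ((hs.deriv.mul_left).sub hs.mul_left)
  refine (((h.hasDerivAt_pow x).mul (d2 x)).sub ((h.hasDerivAt_flux x).mul (d1 x))).congr_deriv ?_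
  ring

/-- The lower-order terms are integrated: twice for those with no derivative, once for those with
one. Their total `K₁` makes f^m + K₁ have zero second distributional derivative, hence affine. This
gives the regularity of f^m, and the slope of the affine function minus `K₀` is the flux. -/
theorem exists_isProfile {m p a b c : ℝ} {f : ℝ → ℝ} (hf : Continuous f) (hn : ∀ y, 0 ≤ f y)
    (hm : 0 ≤ m) (hp : 0 ≤ p)
    (h : ∀ ψ, ContDiff ℝ ∞ ψ → HasCompactSupport ψ → weakProfile m p a b c f ψ = 0) :
    ∃ Φ, IsProfile m p a b c f Φ := by
  have hfm : Continuous fun x => f x ^ m := hf.rpow_const fun _ => Or.inr hm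
  have hfp : Continuous fun x => f x ^ p := hf.rpow_const fun _ => Or.inr hp
  let K₀ : ℝ → ℝ := fun x => ∫ t in (0 : ℝ)..x, (b * f t ^ m + f t ^ p)
  have hK₀ : ∀ x, HasDerivAt K₀ (b * f x ^ m + f x ^ p) x := fun x =>
    (Continuous.integral_hasStrictDerivAt (by fun_prop) _ _).hasDerivAt
  have cK₀ : Continuous K₀ := continuous_iff_continuousAt.2 fun y => (hK₀ y).continuousAt
  let K₁ : ℝ → ℝ := fun x => ∫ t in (0 : ℝ)..x, (c * f t + a * f t ^ m + K₀ t)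
  have hK₁ : ∀ x, HasDerivAt K₁ (c * f x + a * f x ^ m + K₀ x) x := fun x =>
    (Continuous.integral_hasStrictDerivAt (by fun_prop) _ _).hasDerivAt
  have cK₁ : Continuous K₁ := continuous_iff_continuousAt.2 fun y => (hK₁ y).continuousAt
  obtain ⟨C, D, hCD⟩ := eq_affine_of_integral_mul_deriv_deriv_eq_zero
    (u := fun x => f x ^ m + K₁ x) (by fun_prop) fun ψ hψ hs => by
      have hψ' := (contDiff_infty_iff_deriv.1 hψ).2
      have hψ'' := (contDiff_infty_iff_deriv.1 hψ').2
      have hψc := hψ.continuous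
      have hψc' := hψ'.continuous
      have hψc'' := hψ''.continuous
      have d1 : ∀ x, HasDerivAt ψ (deriv ψ x) x := fun x =>
        (hψ.differentiable (by simp) x).hasDerivAt
      have d2 : ∀ x, HasDerivAt (deriv ψ) (deriv (deriv ψ) x) x := fun x =>
        (hψ'.differentiable (by simp) x).hasDerivAt
      have hz := integral_deriv_eq_zero_of_hasCompactSupport
        (u := fun x => K₁ x * deriv ψ x - K₀ x * ψ x)
        (u' := fun x => (c * f x + a * f x ^ m) * deriv ψ x - (b * f x ^ m + f x ^ p) * ψ x
          + K₁ x * deriv (deriv ψ) x) (fun x =>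
          (((hK₁ x).mul (d2 x)).sub ((hK₀ x).mul (d1 x))).congr_deriv (by ring))
        (by fun_prop) ((hs.deriv.mul_left).sub hs.mul_left)
      have hw := h ψ hψ hs
      rw [weakProfile] at hw
      have i1 : Integrable fun x => f x ^ m * deriv (deriv ψ) x
          - (c * f x + a * f x ^ m) * deriv ψ x + (b * f x ^ m + f x ^ p) * ψ x := by
        refine Integrable.add (Integrable.sub ?_ ?_) ?_
        · exact integrable_mul_of_hasCompactSupport hfm hψc'' hs.deriv.deriv
        · exact integrable_mul_of_hasCompactSupport (by fun_prop) hψc' hs.deriv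
        · exact integrable_mul_of_hasCompactSupport (by fun_prop) hψc hs
      have i2 : Integrable fun x => (c * f x + a * f x ^ m) * deriv ψ x
          - (b * f x ^ m + f x ^ p) * ψ x + K₁ x * deriv (deriv ψ) x := by
        refine Integrable.add (Integrable.sub ?_ ?_) ?_
        · exact integrable_mul_of_hasCompactSupport (by fun_prop) hψc' hs.deriv
        · exact integrable_mul_of_hasCompactSupport (by fun_prop) hψc hs
        · exact integrable_mul_of_hasCompactSupport (by fun_prop) hψc'' hs.deriv.deriv
      have := integral_add i1 i2
      rw [hw, hz, add_zero] at this
      rw [← this]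
      congr 1; ext x; ring
  refine ⟨fun x => C - K₀ x, hf, hn, fun y => ?_, fun y => ?_⟩
  · have h1 : (fun x => f x ^ m) = fun x => C * x + D - K₁ x :=
      funext fun x => by linarith [hCD x]
    have h2 : HasDerivAt (fun x => C * x + D - K₁ x) (C - (c * f y + a * f y ^ m + K₀ y)) y := by
      exact ((((hasDerivAt_id y).const_mul C).add_const D).sub (hK₁ y)).congr_deriv (by simp)
    rw [h1]
    exact h2.congr_deriv (by ring)
  · exact (hK₀ y).const_sub C

/-- Partial derivatives of a function of two real variables. -/
def partialFst (φ : ℝ × ℝ → ℝ) (z : ℝ × ℝ) : ℝ := fderiv ℝ φ z (1, 0)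

/-- See `partialFst`. -/
def partialSnd (φ : ℝ × ℝ → ℝ) (z : ℝ × ℝ) : ℝ := fderiv ℝ φ z (0, 1)

/-! ### Partial derivatives and slices of test functions in two variables -/

section partials

variable {φ : ℝ × ℝ → ℝ}

theorem ContDiff.partialFst (h : ContDiff ℝ ∞ φ) : ContDiff ℝ ∞ (partialFst φ) :=
  (h.fderiv_right (m := ∞) (by simp)).clm_apply contDiff_const

theorem ContDiff.partialSnd (h : ContDiff ℝ ∞ φ) : ContDiff ℝ ∞ (partialSnd φ) :=
  (h.fderiv_right (m := ∞) (by simp)).clm_apply contDiff_const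

theorem HasCompactSupport.partialFst (h : HasCompactSupport φ) :
    HasCompactSupport (partialFst φ) :=
  (h.fderiv (𝕜 := ℝ)).comp_left (g := fun L : ℝ × ℝ →L[ℝ] ℝ => L (1, 0)) (by simp)

theorem HasCompactSupport.partialSnd (h : HasCompactSupport φ) :
    HasCompactSupport (partialSnd φ) :=
  (h.fderiv (𝕜 := ℝ)).comp_left (g := fun L : ℝ × ℝ →L[ℝ] ℝ => L (0, 1)) (by simp)

theorem hasDerivAt_slice_fst (h : ContDiff ℝ ∞ φ) (y τ : ℝ) :
    HasDerivAt (fun y => φ (y, τ)) (partialFst φ (y, τ)) y :=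
  (h.differentiable (by simp) (y, τ)).hasFDerivAt.comp_hasDerivAt y
    ((hasDerivAt_id y).prodMk (hasDerivAt_const y τ))

theorem hasDerivAt_slice_snd (h : ContDiff ℝ ∞ φ) (y τ : ℝ) :
    HasDerivAt (fun τ => φ (y, τ)) (partialSnd φ (y, τ)) τ :=
  (h.differentiable (by simp) (y, τ)).hasFDerivAt.comp_hasDerivAt τ
    ((hasDerivAt_const τ y).prodMk (hasDerivAt_id τ))

theorem iteratedDeriv_two_slice (h : ContDiff ℝ ∞ φ) (y τ : ℝ) :
    iteratedDeriv 2 (fun y => φ (y, τ)) y = partialFst (partialFst φ) (y, τ) := by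
  rw [iteratedDeriv_succ, iteratedDeriv_one]
  have : deriv (fun y => φ (y, τ)) = fun y => partialFst φ (y, τ) :=
    funext fun y => (hasDerivAt_slice_fst h y τ).deriv
  rw [this]
  exact (hasDerivAt_slice_fst h.partialFst y τ).deriv

theorem HasCompactSupport.slice_fst (h : HasCompactSupport φ) (τ : ℝ) :
    HasCompactSupport fun y => φ (y, τ) := by
  refine HasCompactSupport.intro (h.isCompact.image continuous_fst) fun y hy => ?_
  by_contra hne
  exact hy ⟨(y, τ), subset_tsupport _ hne, rfl⟩

theorem HasCompactSupport.slice_snd (h : HasCompactSupport φ) (y : ℝ) :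
    HasCompactSupport fun τ => φ (y, τ) := by
  refine HasCompactSupport.intro (h.isCompact.image continuous_snd) fun τ hτ => ?_
  by_contra hne
  exact hτ ⟨(y, τ), subset_tsupport _ hne, rfl⟩

end partials

/-- The shear `(x, τ) ↦ (x + c τ, τ)` from the moving frame to the rest frame. -/
def shear (c : ℝ) : (ℝ × ℝ) ≃ₜ (ℝ × ℝ) where
  toFun z := (z.1 + c * z.2, z.2)
  invFun z := (z.1 - c * z.2, z.2)
  left_inv z := by simp
  right_inv z := by simp
  continuous_toFun := by fun_prop
  continuous_invFun := by fun_prop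

theorem integral_shear {A : ℝ × ℝ → ℝ} (hA : Continuous A) (hs : HasCompactSupport A) (c : ℝ) :
    ∫ z, A z = ∫ z, A (shear c z) := by
  have h1 : Integrable A := hA.integrable_of_hasCompactSupport hs
  have h2 : Integrable fun z => A (shear c z) :=
    (hA.comp (shear c).continuous).integrable_of_hasCompactSupport
      (hs.comp_homeomorph (shear c))
  rw [Measure.volume_eq_prod] at h1 h2 ⊢
  rw [integral_prod_symm _ h1, integral_prod_symm _ h2]
  congr 1; ext τ
  exact (integral_add_right_eq_self (fun x => A (x, τ)) (c * τ)).symm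

theorem shear_apply (c : ℝ) (z : ℝ × ℝ) : shear c z = (z.1 + c * z.2, z.2) := rfl

theorem contDiff_shear (c : ℝ) : ContDiff ℝ ∞ (shear c) :=
  (contDiff_fst.add (contDiff_const.mul contDiff_snd)).prodMk contDiff_snd

/-- Testing the equation for `f (y - c τ)` amounts to testing the profile equation for `f` on each
time slice in the moving frame. -/
theorem integral_travelingWave {m p a b c : ℝ} {f : ℝ → ℝ} (hf : Continuous f)
    (hm : 0 ≤ m) (hp : 0 ≤ p) {φ : ℝ × ℝ → ℝ} (hφ : ContDiff ℝ ∞ φ) (hs : HasCompactSupport φ) :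
    ∫ z : ℝ × ℝ,
      (f (z.1 - c * z.2) * deriv (fun τ => φ (z.1, τ)) z.2
        + f (z.1 - c * z.2) ^ m * iteratedDeriv 2 (fun y => φ (y, z.2)) z.1
        - a * f (z.1 - c * z.2) ^ m * deriv (fun y => φ (y, z.2)) z.1
        + b * f (z.1 - c * z.2) ^ m * φ z
        + f (z.1 - c * z.2) ^ p * φ z)
      = ∫ τ, weakProfile m p a b c f (fun x => φ (shear c (x, τ))) := by
  have hfm : Continuous fun x => f x ^ m := hf.rpow_const fun _ => Or.inr hm
  have hfp : Continuous fun x => f x ^ p := hf.rpow_const fun _ => Or.inr hp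
  have cφ := hφ.continuous
  have cφ1 := hφ.partialFst.continuous
  have cφ2 := hφ.partialFst.partialFst.continuous
  have cφt := hφ.partialSnd.continuous
  simp only [(hasDerivAt_slice_snd hφ _ _).deriv, (hasDerivAt_slice_fst hφ _ _).deriv,
    iteratedDeriv_two_slice hφ]
  have hsub : Continuous fun z : ℝ × ℝ => z.1 - c * z.2 := by fun_prop
  have cA : Continuous fun z : ℝ × ℝ => (f (z.1 - c * z.2) * partialSnd φ (z.1, z.2)
        + f (z.1 - c * z.2) ^ m * partialFst (partialFst φ) (z.1, z.2)
        - a * f (z.1 - c * z.2) ^ m * partialFst φ (z.1, z.2)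
        + b * f (z.1 - c * z.2) ^ m * φ z
        + f (z.1 - c * z.2) ^ p * φ z) := by
    have h1 := hf.comp hsub
    have h2 := hfm.comp hsub
    have h3 := hfp.comp hsub
    simp only [Function.comp_def] at h1 h2 h3
    fun_prop
  have sA : HasCompactSupport fun z : ℝ × ℝ => (f (z.1 - c * z.2) * partialSnd φ (z.1, z.2)
        + f (z.1 - c * z.2) ^ m * partialFst (partialFst φ) (z.1, z.2)
        - a * f (z.1 - c * z.2) ^ m * partialFst φ (z.1, z.2)
        + b * f (z.1 - c * z.2) ^ m * φ z
        + f (z.1 - c * z.2) ^ p * φ z) :=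
    ((((hs.partialSnd.mul_left).add hs.partialFst.partialFst.mul_left).sub
      hs.partialFst.mul_left).add hs.mul_left).add hs.mul_left
  rw [integral_shear cA sA c]
  set χ : ℝ × ℝ → ℝ := fun z => φ (shear c z) with hχ
  have Hχ : ContDiff ℝ ∞ χ := hφ.comp (contDiff_shear c)
  have Sχ : HasCompactSupport χ := hs.comp_homeomorph (shear c)
  have c1 := Hχ.partialFst.continuous
  have c2 := Hχ.partialFst.partialFst.continuous
  have ct := Hχ.partialSnd.continuous
  have c0 := Hχ.continuous
  have hx : ∀ z, partialFst χ z = partialFst φ (shear c z) := fun z => by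
    have h1 := hasDerivAt_slice_fst Hχ z.1 z.2
    have h2 := (hasDerivAt_slice_fst hφ (z.1 + c * z.2) z.2).comp_add_const z.1 (c * z.2)
    exact h1.unique h2
  have hxx : ∀ z, partialFst (partialFst χ) z = partialFst (partialFst φ) (shear c z) := fun z => by
    have h1 := hasDerivAt_slice_fst Hχ.partialFst z.1 z.2
    have h2 := (hasDerivAt_slice_fst hφ.partialFst (z.1 + c * z.2) z.2).comp_add_const z.1 (c * z.2)
    simp only [hx] at h1
    exact h1.unique h2
  -- The extra term c ∂φ/∂y is what turns into c f' in the profile equation.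
  have ht : ∀ z, partialSnd χ z = partialSnd φ (shear c z) + c * partialFst φ (shear c z) :=
    fun z => by
    have h1 := hasDerivAt_slice_snd Hχ z.1 z.2
    have h2 : HasDerivAt (fun τ => χ (z.1, τ)) (fderiv ℝ φ (z.1 + c * z.2, z.2) (c, 1)) z.2 :=
      HasFDerivAt.comp_hasDerivAt (f := fun τ => (z.1 + c * τ, τ)) z.2
        (hφ.differentiable (by simp) (z.1 + c * z.2, z.2)).hasFDerivAt
        ((show HasDerivAt (fun τ => z.1 + c * τ) c z.2 by
          simpa using ((hasDerivAt_id z.2).const_mul c).const_add z.1).prodMk (hasDerivAt_id z.2))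
    rw [h1.unique h2, show ((c, 1) : ℝ × ℝ) = (0, 1) + c • (1, 0) by simp, map_add, map_smul]
    rfl
  have i1 : Integrable fun z : ℝ × ℝ => f z.1 * partialSnd χ z :=
    ((hf.comp continuous_fst).mul ct).integrable_of_hasCompactSupport Sχ.partialSnd.mul_left
  have i2 : Integrable fun z : ℝ × ℝ => f z.1 ^ m * partialFst (partialFst χ) z
      - (c * f z.1 + a * f z.1 ^ m) * partialFst χ z + (b * f z.1 ^ m + f z.1 ^ p) * χ z := by
    refine Continuous.integrable_of_hasCompactSupport ?_ (((Sχ.partialFst.partialFst.mul_left).sub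
      Sχ.partialFst.mul_left).add Sχ.mul_left)
    have h1 := hf.comp (continuous_fst (X := ℝ) (Y := ℝ))
    have h2 := hfm.comp (continuous_fst (X := ℝ) (Y := ℝ))
    have h3 := hfp.comp (continuous_fst (X := ℝ) (Y := ℝ))
    simp only [Function.comp_def] at h1 h2 h3
    fun_prop
  -- In the moving frame f does not depend on τ, so the time derivative of the test function
  -- integrates to zero.
  have e1 : ∫ z : ℝ × ℝ, f z.1 * partialSnd χ z = 0 := by
    rw [Measure.volume_eq_prod] at i1 ⊢
    rw [integral_prod _ i1]
    simp only [integral_const_mul]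
    have : ∀ x, ∫ τ, partialSnd χ (x, τ) = 0 := fun x =>
      integral_deriv_eq_zero_of_hasCompactSupport (u := fun τ => χ (x, τ))
        (fun τ => hasDerivAt_slice_snd Hχ x τ) (by fun_prop) (Sχ.slice_snd x)
    simp [this]
  have e2 : ∫ z : ℝ × ℝ, (f z.1 ^ m * partialFst (partialFst χ) z
      - (c * f z.1 + a * f z.1 ^ m) * partialFst χ z + (b * f z.1 ^ m + f z.1 ^ p) * χ z)
      = ∫ τ, weakProfile m p a b c f (fun x => χ (x, τ)) := by
    rw [Measure.volume_eq_prod] at i2 ⊢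
    rw [integral_prod_symm _ i2]
    congr 1; ext τ
    rw [weakProfile]
    have h1 : deriv (fun x => χ (x, τ)) = fun x => partialFst χ (x, τ) :=
      funext fun x => (hasDerivAt_slice_fst Hχ x τ).deriv
    have h2 : deriv (fun x => partialFst χ (x, τ)) = fun x => partialFst (partialFst χ) (x, τ) :=
      funext fun x => (hasDerivAt_slice_fst Hχ.partialFst x τ).deriv
    rw [h1, h2]
  have e3 := integral_add i1 i2
  rw [e1, e2, zero_add] at e3
  rw [← e3]
  congr 1; ext z
  rw [ht, hx, hxx]
  simp only [χ, shear_apply, add_sub_cancel_right]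
  ring

/-- One direction tests with products ψ(x) η(τ) in the moving frame, where ∫ η = 1 isolates the
profile equation; the other applies the profile equation on every time slice. -/
theorem isTravelingWave_iff {m p N c : ℝ} (hm : 0 < m) (hp : 0 < p) {f : ℝ → ℝ} :
    IsTravelingWave m p N c f ↔
      f ≠ 0 ∧ ∃ Φ, IsProfile m p (convCoeff m N) (reactCoeff m N) c f Φ := by
  constructor
  · rintro ⟨⟨hc, hn, hw⟩, h0⟩
    have hf : Continuous f := by
      have := hc.comp (Continuous.prodMk_left (0 : ℝ) : Continuous fun y : ℝ => (y, (0 : ℝ)))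
      simpa [Function.comp_def] using this
    refine ⟨h0, exists_isProfile hf (fun y => by simpa using hn y 0) hm.le hp.le
      fun ψ hψ hs => ?_⟩
    obtain ⟨η, hη, hηs, hη1⟩ := exists_contDiff_integral_eq_one
    let χ : ℝ × ℝ → ℝ := fun z => ψ z.1 * η z.2
    have Hχ : ContDiff ℝ ∞ χ := (hψ.comp contDiff_fst).mul (hη.comp contDiff_snd)
    have Sχ : HasCompactSupport χ := by
      refine HasCompactSupport.intro (hs.isCompact.prod hηs.isCompact) fun z hz => ?_
      rw [Set.mem_prod, not_and_or] at hz
      rcases hz with hz | hz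
      · simp [χ, image_eq_zero_of_notMem_tsupport hz]
      · simp [χ, image_eq_zero_of_notMem_tsupport hz]
    have hinv : ContDiff ℝ ∞ (shear c).symm :=
      (contDiff_fst.sub (contDiff_const.mul contDiff_snd)).prodMk contDiff_snd
    have key := hw (fun z => χ ((shear c).symm z)) (Hχ.comp hinv)
      (Sχ.comp_homeomorph (shear c).symm)
    rw [integral_travelingWave (φ := fun z => χ ((shear c).symm z)) hf hm.le hp.le (Hχ.comp hinv)
      (Sχ.comp_homeomorph (shear c).symm)] at key
    have : ∀ τ, weakProfile m p (convCoeff m N) (reactCoeff m N) c f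
        (fun x => χ ((shear c).symm (shear c (x, τ))))
        = weakProfile m p (convCoeff m N) (reactCoeff m N) c f ψ * η τ := fun τ => by
      simp only [Homeomorph.symm_apply_apply, χ, weakProfile]
      rw [← integral_mul_const]
      have h1 : deriv (fun x => ψ x * η τ) = fun x => deriv ψ x * η τ :=
        funext fun x => deriv_mul_const_field _
      have h2 : deriv (fun x => deriv ψ x * η τ) = fun x => deriv (deriv ψ) x * η τ :=
        funext fun x => deriv_mul_const_field _
      rw [h1, h2]
      congr 1; ext x; ring
    simp only [this] at key
    rwa [integral_const_mul, hη1, mul_one] at key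
  · rintro ⟨h0, Φ, hΦ⟩
    refine ⟨⟨hΦ.cont.comp (by fun_prop), fun y τ => hΦ.nonneg _, fun φ hφ hs => ?_⟩, h0⟩
    rw [integral_travelingWave hΦ.cont hm.le hp.le hφ hs]
    have : ∀ τ, weakProfile m p (convCoeff m N) (reactCoeff m N) c f
        (fun x => φ (shear c (x, τ))) = 0 := fun τ => by
      refine hΦ.weakProfile_eq_zero hm.le hp.le ?_ ?_
      · exact (hφ.comp (contDiff_shear c)).comp (contDiff_id.prodMk contDiff_const)
      · exact (hs.comp_homeomorph (shear c)).slice_fst τ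
    simp [this]

/-! ### Monotonicity from derivatives -/

theorem le_of_hasDerivAt_nonneg {u u' : ℝ → ℝ} {x y : ℝ} (hxy : x ≤ y)
    (hc : ContinuousOn u (Set.Icc x y)) (hd : ∀ t ∈ Set.Ioo x y, HasDerivAt u (u' t) t)
    (h : ∀ t ∈ Set.Ioo x y, 0 ≤ u' t) : u x ≤ u y := by
  refine monotoneOn_of_hasDerivWithinAt_nonneg (f' := u') (convex_Icc x y) hc ?_ ?_
    (Set.left_mem_Icc.2 hxy) (Set.right_mem_Icc.2 hxy) hxy
  · intro t ht
    rw [interior_Icc] at ht ⊢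
    exact (hd t ht).hasDerivWithinAt
  · intro t ht
    rw [interior_Icc] at ht
    exact h t ht

theorem sub_le_mul_of_hasDerivAt_le {u u' : ℝ → ℝ} {x y C : ℝ} (hxy : x ≤ y)
    (hc : ContinuousOn u (Set.Icc x y)) (hd : ∀ t ∈ Set.Ioo x y, HasDerivAt u (u' t) t)
    (h : ∀ t ∈ Set.Ioo x y, u' t ≤ C) : u y - u x ≤ C * (y - x) := by
  have := le_of_hasDerivAt_nonneg (u := fun t => C * t - u t) (u' := fun t => C - u' t) hxy
    (by fun_prop) (fun t ht => by
      simpa using! ((hasDerivAt_id t).const_mul C).sub (hd t ht))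
    (fun t ht => sub_nonneg.2 (h t ht))
  linarith

theorem lt_of_hasDerivAt_neg {u u' : ℝ → ℝ} {x y : ℝ} (hxy : x < y)
    (hc : ContinuousOn u (Set.Icc x y)) (hd : ∀ t ∈ Set.Ioo x y, HasDerivAt u (u' t) t)
    (h : ∀ t ∈ Set.Ioo x y, u' t < 0) : u y < u x := by
  obtain ⟨t, ht, he⟩ := exists_hasDerivAt_eq_slope u u' hxy hc hd
  have h1 := h t ht
  rw [he, div_neg_iff] at h1
  rcases h1 with h1 | h1
  · linarith [h1.2]
  · linarith [h1.1]

/-- Zero can only be crossed downwards. -/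
theorem nonpos_of_hasDerivAt_neg_at_zero {u u' : ℝ → ℝ} {x y : ℝ} (hxy : x ≤ y)
    (hd : ∀ t ∈ Set.Icc x y, HasDerivAt u (u' t) t) (hx : u x ≤ 0)
    (h : ∀ t ∈ Set.Ico x y, u t = 0 → u' t < 0) : u y ≤ 0 :=
  image_le_of_deriv_right_lt_deriv_boundary (B := fun _ => 0) (B' := fun _ => 0)
    (fun t ht => (hd t ht).continuousAt.continuousWithinAt)
    (fun t ht => (hd t (Set.Ico_subset_Icc_self ht)).hasDerivWithinAt) hx
    (fun _ => hasDerivAt_const _ _) h (Set.right_mem_Icc.2 hxy)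

/-- A function that does not decrease where it is positive stays above a positive initial value. -/
theorem le_of_hasDerivAt_nonneg_of_pos {u u' : ℝ → ℝ} {x y : ℝ} (hxy : x ≤ y)
    (hd : ∀ t ∈ Set.Icc x y, HasDerivAt u (u' t) t) (hx : 0 < u x)
    (h : ∀ t ∈ Set.Ico x y, 0 < u t → 0 ≤ u' t) : u x ≤ u y := by
  by_contra hlt
  push Not at hlt
  have hxy' : x < y := lt_of_le_of_ne hxy (fun e => by simp [e] at hlt)
  -- The boundary lemma wants strict inequalities, so the constant u x is replaced by a line of
  -- slope -ε. The first bound on ε keeps that line positive up to y, the second keeps it above u y.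
  obtain ⟨ε, hε, hε1, hε2⟩ : ∃ ε > 0, ε * (y - x) < u x ∧ ε * (y - x) < u x - u y := by
    refine ⟨min (u x) (u x - u y) / (2 * (y - x)), ?_, ?_⟩
    · have := lt_min hx (sub_pos.2 hlt)
      have := sub_pos.2 hxy'
      positivity
    · have h1 := sub_pos.2 hxy'
      have h2 : min (u x) (u x - u y) / (2 * (y - x)) * (y - x) = min (u x) (u x - u y) / 2 := by
        field_simp
      rw [h2]
      constructor
      · have := min_le_left (u x) (u x - u y)
        have := lt_min hx (sub_pos.2 hlt)
        linarith
      · have := min_le_right (u x) (u x - u y)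
        have := lt_min hx (sub_pos.2 hlt)
        linarith
  have := image_le_of_deriv_right_lt_deriv_boundary (f := fun t => - u t) (f' := fun t => - u' t)
    (B := fun t => - u x + ε * (t - x)) (B' := fun _ => ε) (a := x) (b := y)
    (fun t ht => (hd t ht).continuousAt.continuousWithinAt.neg)
    (fun t ht => (hd t (Set.Ico_subset_Icc_self ht)).neg.hasDerivWithinAt) (by simp)
    (fun t => by simpa using (((hasDerivAt_id t).sub_const x).const_mul ε).const_add (-u x))
    (fun t ht he => by
      have h1 : ε * (t - x) ≤ ε * (y - x) := by
        have := ht.2.le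
        gcongr
      have := h t ht (by linarith)
      linarith) (Set.right_mem_Icc.2 hxy)
  linarith

theorem exists_forall_lt_of_hasDerivAt_le_neg {u u' : ℝ → ℝ} {Y δ : ℝ} (hδ : 0 < δ)
    (hd : ∀ t, Y ≤ t → HasDerivAt u (u' t) t) (h : ∀ t, Y ≤ t → u' t ≤ -δ) (M : ℝ) :
    ∃ y, Y ≤ y ∧ ∀ z, y ≤ z → u z < M := by
  refine ⟨Y + (|u Y - M| + 1) / δ, ?_, fun z hz => ?_⟩
  · have : 0 ≤ (|u Y - M| + 1) / δ := by positivity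
    linarith
  · have h0 : 0 ≤ (|u Y - M| + 1) / δ := by positivity
    have hYz : Y ≤ z := by linarith
    have h1 := sub_le_mul_of_hasDerivAt_le hYz
      (fun t ht => (hd t ht.1).continuousAt.continuousWithinAt) (fun t ht => hd t ht.1.le)
      (fun t ht => h t ht.1.le)
    have h2 : (|u Y - M| + 1) ≤ δ * (z - Y) := by
      rw [← div_le_iff₀' hδ]; linarith
    have := le_abs_self (u Y - M)
    linarith

/-! ### Structure of profiles -/

namespace IsProfile

variable {m p a b c : ℝ} {f Φ : ℝ → ℝ}

theorem reaction_nonneg (h : IsProfile m p a b c f Φ) (hb : 0 < b) (y : ℝ) :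
    0 ≤ b * f y ^ m + f y ^ p := by
  have := h.nonneg y
  positivity

theorem reaction_pos (hb : 0 < b) {y : ℝ} (hy : 0 < f y) : 0 < b * f y ^ m + f y ^ p := by
  positivity

theorem continuous_flux (h : IsProfile m p a b c f Φ) : Continuous Φ :=
  continuous_iff_continuousAt.2 fun y => (h.hasDerivAt_flux y).continuousAt

theorem continuous_pow (h : IsProfile m p a b c f Φ) : Continuous fun y => f y ^ m :=
  continuous_iff_continuousAt.2 fun y => (h.hasDerivAt_pow y).continuousAt

theorem antitone_flux (h : IsProfile m p a b c f Φ) (hb : 0 < b) : Antitone Φ :=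
  antitone_of_hasDerivAt_nonpos h.hasDerivAt_flux
    fun y => neg_nonpos.2 (h.reaction_nonneg hb y)

/-- f^m has a minimum at a zero of f, so its derivative vanishes there, and that derivative is Φ. -/
theorem flux_eq_zero (h : IsProfile m p a b c f Φ) (hm : 0 < m) {y : ℝ} (hy : f y = 0) :
    Φ y = 0 := by
  have hmin : IsLocalMin (fun y => f y ^ m) y :=
    Filter.Eventually.of_forall fun z => by
      simp only [hy, Real.zero_rpow hm.ne']
      exact Real.rpow_nonneg (h.nonneg z) m
  have := hmin.hasDerivAt_eq_zero (h.hasDerivAt_pow y)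
  simpa [hy, Real.zero_rpow hm.ne'] using this

theorem eq_zero_of_pow_nonpos (h : IsProfile m p a b c f Φ) {y : ℝ} (hy : f y ^ m ≤ 0) :
    f y = 0 := by
  by_contra hne
  have : 0 < f y := lt_of_le_of_ne (h.nonneg y) (Ne.symm hne)
  exact absurd hy (not_le.2 (by positivity))

/-- To the right of a zero Φ ≤ 0; with a > 0 and c ≥ 0 this makes f^m nonincreasing. -/
theorem eq_zero_right (h : IsProfile m p a b c f Φ) (hm : 0 < m) (ha : 0 < a) (hb : 0 < b)
    (hc : 0 ≤ c) {y z : ℝ} (hy : f y = 0) (hyz : y ≤ z) : f z = 0 := by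
  apply h.eq_zero_of_pow_nonpos
  have := le_of_hasDerivAt_nonneg (u := fun y => - f y ^ m) hyz h.continuous_pow.neg.continuousOn
    (fun t _ => (h.hasDerivAt_pow t).neg) (fun t ht => by
      have h1 : Φ t ≤ 0 := (h.flux_eq_zero hm hy) ▸ h.antitone_flux hb ht.1.le
      have h2 := h.nonneg t
      have h3 : 0 ≤ a * f t ^ m := by positivity
      have h4 : 0 ≤ c * f t := by positivity
      linarith)
  simp only [hy, Real.zero_rpow hm.ne'] at this
  linarith

/-- To the left of a zero Φ ≥ 0; with c ≤ 0 this makes e^(ay) f^m nondecreasing towards the value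
zero. -/
theorem eq_zero_left (h : IsProfile m p a b c f Φ) (hm : 0 < m) (hb : 0 < b)
    (hc : c ≤ 0) {y z : ℝ} (hy : f y = 0) (hyz : z ≤ y) : f z = 0 := by
  apply h.eq_zero_of_pow_nonpos
  have hcont := h.continuous_pow
  have := le_of_hasDerivAt_nonneg (u := fun y => Real.exp (a * y) * f y ^ m) hyz
    (by fun_prop)
    (fun t _ => (((hasDerivAt_id t).const_mul a).exp).mul (h.hasDerivAt_pow t)) (fun t ht => by
      have h1 : 0 ≤ Φ t := (h.flux_eq_zero hm hy) ▸ h.antitone_flux hb ht.2.le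
      have h2 := h.nonneg t
      have h4 : c * f t ≤ 0 := mul_nonpos_of_nonpos_of_nonneg hc h2
      simp only [id]
      have : Real.exp (a * t) * (a * 1) * f t ^ m + Real.exp (a * t)
          * (Φ t - a * f t ^ m - c * f t) = Real.exp (a * t) * (Φ t - c * f t) := by ring
      rw [this]
      have : 0 ≤ Φ t - c * f t := by linarith
      positivity)
  simp only [hy, Real.zero_rpow hm.ne', mul_zero] at this
  exact nonpos_of_mul_nonpos_right this (Real.exp_pos _)

theorem hasDerivAt (h : IsProfile m p a b c f Φ) (hm : 0 < m) {y : ℝ} (hy : 0 < f y) :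
    HasDerivAt f ((Φ y - a * f y ^ m - c * f y) / (m * f y ^ (m - 1))) y := by
  have h1 := (h.hasDerivAt_pow y).rpow_const (p := 1 / m) (Or.inl (by positivity))
  have h2 : (fun y => (f y ^ m) ^ (1 / m)) = f := funext fun y => by
    rw [← Real.rpow_mul (h.nonneg y), mul_one_div_cancel hm.ne', Real.rpow_one]
  rw [h2] at h1
  refine h1.congr_deriv ?_
  rw [← Real.rpow_mul hy.le, show m * (1 / m - 1) = -(m - 1) by field_simp; ring,
    Real.rpow_neg hy.le]
  field_simp

theorem hasDerivAt_slope (h : IsProfile m p a b c f Φ) (hm : 0 < m) {y : ℝ} (hy : 0 < f y) :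
    HasDerivAt (fun y => Φ y - a * f y ^ m - c * f y)
      (-(b * f y ^ m + f y ^ p) - a * (Φ y - a * f y ^ m - c * f y)
        - c * ((Φ y - a * f y ^ m - c * f y) / (m * f y ^ (m - 1)))) y :=
  ((h.hasDerivAt_flux y).sub ((h.hasDerivAt_pow y).const_mul a)).sub
    ((h.hasDerivAt hm hy).const_mul c)

/-- At a critical point of f^m with f > 0, the second derivative is -(b f^m + f^p) < 0. So a wave
that has stopped increasing never increases again. -/
theorem slope_nonpos_of_le (h : IsProfile m p a b c f Φ) (hm : 0 < m) (hb : 0 < b) {y z : ℝ}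
    (hyz : y ≤ z) (hpos : ∀ t ∈ Set.Icc y z, 0 < f t)
    (hy : Φ y - a * f y ^ m - c * f y ≤ 0) : Φ z - a * f z ^ m - c * f z ≤ 0 := by
  refine nonpos_of_hasDerivAt_neg_at_zero (u := fun y => Φ y - a * f y ^ m - c * f y) hyz
    (fun t ht => h.hasDerivAt_slope hm (hpos t ht)) hy
    fun t ht h0 => ?_
  have := reaction_pos (m := m) (p := p) hb (hpos t (Set.Ico_subset_Icc_self ht))
  simp only [h0]
  simp
  linarith

/-- If the slope vanished at z, then being nonpositive before z it would have a nonnegative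
derivative there, while the equation makes that derivative negative. -/
theorem slope_neg_of_lt (h : IsProfile m p a b c f Φ) (hm : 0 < m) (hb : 0 < b) {y z : ℝ}
    (hyz : y < z) (hpos : ∀ t ∈ Set.Icc y z, 0 < f t)
    (hy : Φ y - a * f y ^ m - c * f y ≤ 0) : Φ z - a * f z ^ m - c * f z < 0 := by
  refine lt_of_le_of_ne (h.slope_nonpos_of_le hm hb hyz.le hpos hy) fun h0 => ?_
  have hz : 0 < f z := hpos z (Set.right_mem_Icc.2 hyz.le)
  have hd := h.hasDerivAt_slope hm hz
  have hr := reaction_pos (m := m) (p := p) hb hz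
  have hmax : ∀ t ∈ Set.Icc y z, Φ t - a * f t ^ m - c * f t ≤ 0 := fun t ht =>
    h.slope_nonpos_of_le hm hb ht.1 (fun x hx => hpos x ⟨hx.1, hx.2.trans ht.2⟩) hy
  rw [h0] at hd
  simp only [mul_zero, sub_zero, zero_div] at hd
  have hlim := (hasDerivAt_iff_tendsto_slope.1 hd).mono_left
    (nhdsWithin_mono z (show Set.Iio z ⊆ {z}ᶜ from fun x hx => ne_of_lt hx))
  have : 0 ≤ -(b * f z ^ m + f z ^ p) := by
    refine ge_of_tendsto hlim ?_
    filter_upwards [Ioo_mem_nhdsLT hyz] with t ht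
    rw [slope_def_field, h0]
    have h1 := hmax t ⟨ht.1.le, ht.2.le⟩
    exact div_nonneg_of_nonpos (by linarith) (by linarith [ht.2])
  linarith

theorem linear_le_pow (hm : 1 < m) (ha : 0 < a) (c : ℝ) :
    ∃ C, ∀ s : ℝ, 0 ≤ s → -a * s ^ m - c * s ≤ C := by
  have hm1 : 0 < m - 1 := by linarith
  set s₀ : ℝ := (|c| / a) ^ (1 / (m - 1)) with hs₀
  have hs₀' : 0 ≤ s₀ := by positivity
  refine ⟨|c| * s₀, fun s hs => ?_⟩
  have hc := neg_abs_le c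
  rcases le_total s s₀ with h | h
  · have h1 : 0 ≤ a * s ^ m := by positivity
    have h2 : |c| * s ≤ |c| * s₀ := by gcongr
    nlinarith
  · have h1 : |c| / a ≤ s ^ (m - 1) := by
      have : s₀ ^ (m - 1) = |c| / a := by
        rw [hs₀, ← Real.rpow_mul (by positivity), one_div_mul_cancel hm1.ne', Real.rpow_one]
      rw [← this]
      gcongr
    have h2 : |c| ≤ a * s ^ (m - 1) := by
      rwa [div_le_iff₀' ha] at h1
    have h3 : s ^ m = s ^ (m - 1) * s := by
      rcases hs.eq_or_lt with rfl | hs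
      · rw [Real.zero_rpow (by linarith), mul_zero]
      · rw [← Real.rpow_add_one hs.ne']; ring_nf
    have h4 : |c| * s ≤ a * s ^ m := by
      rw [h3, ← mul_assoc]; gcongr
    have h5 : 0 ≤ |c| * s₀ := by positivity
    nlinarith

/-- If f ≥ ε, the reaction drives Φ to -∞ at a linear rate. As -a s^m - c s is bounded above, (f^m)'
≤ -1 eventually, and f^m becomes negative. -/
theorem not_forall_le (h : IsProfile m p a b c f Φ) (hm : 1 < m) (ha : 0 < a) (hb : 0 < b)
    {Y ε : ℝ} (hε : 0 < ε) : ¬ ∀ y, Y ≤ y → ε ≤ f y := by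
  intro hf
  obtain ⟨C, hC⟩ := linear_le_pow hm ha c
  obtain ⟨Y₁, hY₁, hΦ⟩ := exists_forall_lt_of_hasDerivAt_le_neg (δ := b * ε ^ m) (by positivity)
    (fun t _ => h.hasDerivAt_flux t) (fun t ht => by
      have h1 : ε ^ m ≤ f t ^ m := by
        have := hf t ht
        gcongr
      have h2 : 0 ≤ f t ^ p := Real.rpow_nonneg (h.nonneg t) p
      have : b * ε ^ m ≤ b * f t ^ m := by gcongr
      linarith) (-C - 1) (Y := Y)
  obtain ⟨Y₂, -, hg⟩ := exists_forall_lt_of_hasDerivAt_le_neg (δ := 1) one_pos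
    (fun t _ => h.hasDerivAt_pow t) (fun t ht => by
      have := hC (f t) (h.nonneg t)
      have := hΦ t ht
      linarith) 0 (Y := Y₁)
  have := hg Y₂ le_rfl
  exact absurd this (not_lt.2 (Real.rpow_nonneg (h.nonneg _) m))

/-- Extinction in finite distance. If f never stops increasing, it stays above a positive constant.
Otherwise f decreases to 0 with 0 < Φ ≤ (a + |c|) f eventually, so Φ' ≤ -const Φ^p, and p < 1 makes
Φ vanish at a finite point. -/
theorem not_forall_pos (h : IsProfile m p a b c f Φ) (hm : 1 < m) (hp0 : 0 < p) (hp1 : p < 1)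
    (ha : 0 < a) (hb : 0 < b) (Y : ℝ) : ¬ ∀ y, Y ≤ y → 0 < f y := by
  intro hf
  have hm0 : 0 < m := by linarith
  by_cases hinc : ∃ y₂, Y ≤ y₂ ∧ Φ y₂ - a * f y₂ ^ m - c * f y₂ ≤ 0
  · obtain ⟨y₂, hy₂, hs⟩ := hinc
    have hS : ∀ y, y₂ ≤ y → Φ y - a * f y ^ m - c * f y ≤ 0 := fun y hy =>
      h.slope_nonpos_of_le hm0 hb hy (fun t ht => hf t (hy₂.trans ht.1)) hs
    have hanti : ∀ y z, y₂ ≤ y → y ≤ z → f z ≤ f y := fun y z hy hyz => by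
      have := le_of_hasDerivAt_nonneg (u := fun y => - f y ^ m) hyz
        h.continuous_pow.neg.continuousOn (fun t _ => (h.hasDerivAt_pow t).neg)
        (fun t ht => by have := hS t (hy.trans ht.1.le); linarith)
      have h2 : f z ^ m ≤ f y ^ m := by simpa using this
      exact (Real.rpow_le_rpow_iff (h.nonneg z) (h.nonneg y) hm0).1 h2
    have hsmall : ∀ ε > 0, ∃ y, y₂ ≤ y ∧ ∀ z, y ≤ z → f z < ε := fun ε hε => by
      have := h.not_forall_le hm ha hb (Y := y₂) hε
      push Not at this
      obtain ⟨y, hy, hlt⟩ := this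
      exact ⟨y, hy, fun z hz => (hanti y z hy hz).trans_lt hlt⟩
    -- A negative flux stays below a negative constant while c f → 0, so (f^m)' would be bounded
    -- away from zero and f^m would become negative.
    have hΦ0 : ∀ y, y₂ ≤ y → 0 ≤ Φ y := fun y hy => by
      by_contra hneg
      push Not at hneg
      obtain ⟨z, hz, hzs⟩ := hsmall (-Φ y / (2 * (|c| + 1)))
        (div_pos (by linarith) (by positivity))
      obtain ⟨Y₂, -, hg⟩ := exists_forall_lt_of_hasDerivAt_le_neg (δ := -Φ y / 2) (by linarith)
        (fun t _ => h.hasDerivAt_pow t) (fun t ht => by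
          have h1 : Φ t ≤ Φ y := h.antitone_flux hb ((le_max_left y z).trans ht)
          have h2 := hzs t ((le_max_right y z).trans ht)
          have h3 := h.nonneg t
          have h4 : 0 ≤ a * f t ^ m := by positivity
          rw [lt_div_iff₀ (by positivity)] at h2
          have h5 := neg_abs_le c
          nlinarith) 0 (Y := max y z)
      exact absurd (hg Y₂ le_rfl) (not_lt.2 (Real.rpow_nonneg (h.nonneg _) m))
    have hΦpos : ∀ y, y₂ ≤ y → 0 < Φ y := fun y hy => by
      have h1 := hΦ0 (y + 1) (by linarith)
      have h2 := lt_of_hasDerivAt_neg (show y < y + 1 by linarith) h.continuous_flux.continuousOn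
        (fun t _ => h.hasDerivAt_flux t) (fun t ht => by
          have := reaction_pos (m := m) (p := p) hb (hf t (by linarith [ht.1]))
          linarith)
      linarith
    obtain ⟨Y₁, hY₁, hle⟩ := hsmall 1 one_pos
    have hC : 0 < a + |c| := by positivity
    have hbd : ∀ y, Y₁ ≤ y → Φ y ≤ (a + |c|) * f y := fun y hy => by
      have h1 := hS y (hY₁.trans hy)
      have h2 := h.nonneg y
      have h3 : f y ^ m ≤ f y := by
        have := Real.rpow_le_rpow_of_exponent_ge (hf y (by linarith)) (hle y hy).le hm.le
        simpa using this
      have h4 := le_abs_self c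
      nlinarith
    -- Φ^(1-p) decreases at least at the rate (1-p)(a + |c|)^(-p).
    obtain ⟨Y₂, hY₂, hg⟩ := exists_forall_lt_of_hasDerivAt_le_neg
      (δ := (1 - p) * ((a + |c|) ^ p)⁻¹) (mul_pos (by linarith) (by positivity))
      (u := fun y => Φ y ^ (1 - p))
      (fun t ht => (h.hasDerivAt_flux t).rpow_const (p := 1 - p)
        (Or.inl (hΦpos t (hY₁.trans ht)).ne')) (fun t ht => by
        have hpos := hΦpos t (hY₁.trans ht)
        have h1 : Φ t ^ p ≤ (a + |c|) ^ p * f t ^ p := by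
          rw [← Real.mul_rpow hC.le (h.nonneg t)]
          have := hbd t ht
          gcongr
        have h2 : Φ t ^ p * ((a + |c|) ^ p)⁻¹ ≤ f t ^ p := by
          rw [← div_eq_mul_inv, div_le_iff₀' (by positivity)]; exact h1
        have h3 : 0 ≤ b * f t ^ m := by
          have := h.nonneg t
          positivity
        have h4 : Φ t ^ (1 - p - 1) * Φ t ^ p = 1 := by
          rw [← Real.rpow_add hpos]; simp
        have h5 : 0 < Φ t ^ (1 - p - 1) := by positivity
        have h6 : (1 - p) * ((a + |c|) ^ p)⁻¹ = (1 - p) * Φ t ^ (1 - p - 1)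
            * (Φ t ^ p * ((a + |c|) ^ p)⁻¹) := by
          rw [show (1 - p) * Φ t ^ (1 - p - 1) * (Φ t ^ p * ((a + |c|) ^ p)⁻¹)
            = (1 - p) * ((a + |c|) ^ p)⁻¹ * (Φ t ^ (1 - p - 1) * Φ t ^ p) by ring, h4, mul_one]
        have h7 : 0 ≤ (1 - p) * Φ t ^ (1 - p - 1) := mul_nonneg (by linarith) h5.le
        have h8 : (1 - p) * Φ t ^ (1 - p - 1) * (Φ t ^ p * ((a + |c|) ^ p)⁻¹)
            ≤ (1 - p) * Φ t ^ (1 - p - 1) * (b * f t ^ m + f t ^ p) :=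
          mul_le_mul_of_nonneg_left (by linarith) h7
        linarith) 0 (Y := Y₁)
    exact absurd (hg Y₂ le_rfl) (not_lt.2 (Real.rpow_nonneg (hΦ0 _ (hY₁.trans hY₂)) _))
  · push Not at hinc
    refine h.not_forall_le hm ha hb (hf Y le_rfl) (Y := Y) fun y hy => ?_
    have := le_of_hasDerivAt_nonneg (u := fun y => f y ^ m) hy
      h.continuous_pow.continuousOn (fun t _ => h.hasDerivAt_pow t)
      (fun t ht => (hinc t ht.1.le).le)
    exact (Real.rpow_le_rpow_iff (h.nonneg _) (h.nonneg _) hm0).1 this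

/-- Every wave moves to the right and vanishes exactly on a right half-line. -/
theorem exists_hasInterfaceAt (h : IsProfile m p a b c f Φ) (hm : 1 < m) (hp0 : 0 < p)
    (hp1 : p < 1) (ha : 0 < a) (hb : 0 < b) (hf : f ≠ 0) :
    0 < c ∧ ∃ y₀, HasInterfaceAt f y₀ := by
  have hm0 : 0 < m := by linarith
  obtain ⟨y₁, hy₁⟩ := Function.ne_iff.1 hf
  have hnot := h.not_forall_pos hm hp0 hp1 ha hb y₁
  push Not at hnot
  obtain ⟨y₂, hy₂, hle⟩ := hnot
  have hz : f y₂ = 0 := le_antisymm hle (h.nonneg y₂)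
  have hc : 0 < c := by
    by_contra hc
    exact hy₁ (h.eq_zero_left hm0 hb (not_lt.1 hc) hz hy₂)
  refine ⟨hc, ?_⟩
  have hup : ∀ y z, f y = 0 → y ≤ z → f z = 0 := fun y z hy hyz =>
    h.eq_zero_right hm0 ha hb hc.le hy hyz
  set Z : Set ℝ := {y | f y = 0} with hZ
  have hne : Z.Nonempty := ⟨y₂, hz⟩
  have hbdd : BddBelow Z := ⟨y₁, fun y hy => by
    by_contra hlt
    exact hy₁ (hup y y₁ hy (not_le.1 hlt).le)⟩
  have hclosed : IsClosed Z := isClosed_eq h.cont continuous_const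
  have hmem : sInf Z ∈ Z := hclosed.csInf_mem hne hbdd
  refine ⟨sInf Z, fun y hy => ?_, fun y hy => hup _ y hmem hy⟩
  refine lt_of_le_of_ne (h.nonneg y) fun h0 => ?_
  exact absurd (csInf_le hbdd (show y ∈ Z from h0.symm)) (not_le.2 hy)

theorem flux_pos (h : IsProfile m p a b c f Φ) (hm : 0 < m) (hb : 0 < b) {y₀ : ℝ}
    (hI : HasInterfaceAt f y₀) {y : ℝ} (hy : y < y₀) : 0 < Φ y := by
  have h1 := lt_of_hasDerivAt_neg hy h.continuous_flux.continuousOn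
    (fun t _ => h.hasDerivAt_flux t) (fun t ht => by
      have := reaction_pos (m := m) (p := p) hb (hI.1 t ht.2)
      linarith)
  rwa [h.flux_eq_zero hm (hI.2 y₀ le_rfl)] at h1

/-- Close to the interface f decreases, so Φ ≤ C f. Conversely Φ > 0 bounds the speed of the
decrease: (f^m)' ≥ -C f. Hence f needs some distance to vanish, along which f^p builds up the flux,
and Φ ≥ κ f^(m+p-1). As f → 0 the two bounds clash unless m + p - 1 ≥ 1. -/
theorem two_le_add (h : IsProfile m p a b c f Φ) (hm : 1 < m) (hp0 : 0 < p)
    (hp1 : p < 1) (ha : 0 < a) (hb : 0 < b) (hf : f ≠ 0) : 2 ≤ m + p := by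
  by_contra hlt
  push Not at hlt
  have hm0 : 0 < m := by linarith
  obtain ⟨hc, y₀, hI⟩ := h.exists_hasInterfaceAt hm hp0 hp1 ha hb hf
  have h0 : f y₀ = 0 := hI.2 y₀ le_rfl
  have hev : ∀ ε > 0, ∃ x, x < y₀ ∧ ∀ y, x < y → y < y₀ → f y < ε := fun ε hε => by
    have : ∀ᶠ y in 𝓝 y₀, f y < ε := h.cont.continuousAt.eventually_lt continuousAt_const
      (by simpa [h0] using hε)
    obtain ⟨l, u, ⟨hl, hu⟩, hlu⟩ := mem_nhds_iff_exists_Ioo_subset.1 this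
    exact ⟨l, hl, fun y hy hy' => hlu ⟨hy, hy'.trans hu⟩⟩
  obtain ⟨x₁, hx₁, hx₁'⟩ := hev 1 one_pos
  obtain ⟨y₃, ⟨hy₃, hy₃'⟩, hs₃⟩ : ∃ y ∈ Set.Ioo x₁ y₀, Φ y - a * f y ^ m - c * f y ≤ 0 := by
    by_contra hcon
    push Not at hcon
    set x₂ := (x₁ + y₀) / 2
    have hx₂ : x₁ < x₂ := by simp only [x₂]; linarith
    have hx₂' : x₂ < y₀ := by simp only [x₂]; linarith
    have := le_of_hasDerivAt_nonneg (u := fun y => f y ^ m) hx₂'.le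
      h.continuous_pow.continuousOn (fun t _ => h.hasDerivAt_pow t)
      (fun t ht => (hcon t ⟨hx₂.trans ht.1, ht.2⟩).le)
    simp only [h0, Real.zero_rpow hm0.ne'] at this
    exact absurd this (not_le.2 (Real.rpow_pos_of_pos (hI.1 _ hx₂') m))
  have hS : ∀ y, y₃ ≤ y → y < y₀ → Φ y - a * f y ^ m - c * f y ≤ 0 := fun y hy hy' =>
    h.slope_nonpos_of_le hm0 hb hy (fun t ht => hI.1 t (ht.2.trans_lt hy')) hs₃
  have hfm : ∀ y, y₃ ≤ y → y < y₀ → f y ^ m ≤ f y := fun y hy hy' => by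
    have := Real.rpow_le_rpow_of_exponent_ge (hI.1 y hy') (hx₁' y (hy₃.trans_le hy) hy').le hm.le
    simpa using this
  set C := a + c with hC
  have hC0 : 0 < C := by positivity
  -- With this constant, f' = -C f^(2-m)/m would give (κ f^(m+p-1))' = -f^p exactly.
  set κ := m / ((m + p - 1) * C) with hκ
  have hmp : 0 < m + p - 1 := by linarith
  have hκ0 : 0 < κ := by positivity
  have key : ∀ y, y₃ ≤ y → y < y₀ → κ * f y ^ (m + p - 1) ≤ Φ y := fun y hy hy' => by
    have hcont : Continuous fun y => f y ^ (m + p - 1) :=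
      h.cont.rpow_const fun _ => Or.inr hmp.le
    have hΦc := h.continuous_flux
    have := le_of_hasDerivAt_nonneg (u := fun y => κ * f y ^ (m + p - 1) - Φ y) hy'.le
      (by fun_prop)
      (fun t ht => (((h.hasDerivAt hm0 (hI.1 t ht.2)).rpow_const (p := m + p - 1)
        (Or.inl (hI.1 t ht.2).ne')).const_mul κ).sub (h.hasDerivAt_flux t)) (fun t ht => by
        have ht3 := hy.trans ht.1.le
        have hft := hI.1 t ht.2
        have e1 : -(C * f t) ≤ Φ t - a * f t ^ m - c * f t := by
          have h1 := hfm t ht3 ht.2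
          have h2 := h.flux_pos hm0 hb hI ht.2
          nlinarith
        have e2 : κ * ((-(C * f t)) / (m * f t ^ (m - 1)) * (m + p - 1)
            * f t ^ (m + p - 1 - 1)) = - f t ^ p := by
          have h1 : f t ^ (m + p - 1 - 1) * f t = f t ^ p * f t ^ (m - 1) := by
            rw [← Real.rpow_add_one hft.ne', ← Real.rpow_add hft]; ring_nf
          rw [hκ]
          field_simp
          linear_combination (-1) * h1
        have e3 : κ * ((-(C * f t)) / (m * f t ^ (m - 1)) * (m + p - 1)
            * f t ^ (m + p - 1 - 1)) ≤ κ * ((Φ t - a * f t ^ m - c * f t) / (m * f t ^ (m - 1))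
            * (m + p - 1) * f t ^ (m + p - 1 - 1)) := by gcongr
        have e4 : 0 ≤ b * f t ^ m := by positivity
        linarith)
    simp only [h0, Real.zero_rpow hmp.ne', h.flux_eq_zero hm0 h0] at this
    linarith
  have hq : 0 < 2 - m - p := by linarith
  -- Below this threshold κ f^(m+p-1) > C f, as the exponent is less than 1.
  obtain ⟨x₄, hx₄, hx₄'⟩ := hev ((κ / C) ^ (1 / (2 - m - p))) (by positivity)
  set y := (max x₄ y₃ + y₀) / 2 with hy
  have hmax : max x₄ y₃ < y₀ := max_lt hx₄ hy₃'
  have hyy : y < y₀ := by linarith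
  have hy3 : y₃ ≤ y := by linarith [le_max_right x₄ y₃]
  have hy4 : x₄ < y := by linarith [le_max_left x₄ y₃]
  have hfy := hI.1 y hyy
  have h1 := key y hy3 hyy
  have h2 : Φ y ≤ C * f y := by
    have := hS y hy3 hyy
    have := hfm y hy3 hyy
    nlinarith
  have h3 : f y ^ (2 - m - p) < κ / C := by
    have := hx₄' y hy4 hyy
    calc f y ^ (2 - m - p) < ((κ / C) ^ (1 / (2 - m - p))) ^ (2 - m - p) :=
          Real.rpow_lt_rpow hfy.le this hq
      _ = κ / C := by
        rw [← Real.rpow_mul (by positivity), one_div_mul_cancel hq.ne', Real.rpow_one]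
  rw [lt_div_iff₀ hC0] at h3
  have h4 : f y ^ (m + p - 1) * f y ^ (2 - m - p) = f y := by
    rw [← Real.rpow_add hfy]; ring_nf; exact Real.rpow_one _
  have h5 : 0 < f y ^ (m + p - 1) := by positivity
  nlinarith

end IsProfile

/-! ### The slope of `f^m` as a function of `f` -/

/-- Admissible exponents and coefficients: `-k` and `-l` are the characteristic roots of the
principal part. -/
structure Admissible (m p k l : ℝ) : Prop where
  one_lt : 1 < m
  p_pos : 0 < p
  p_lt : p < 1
  k_pos : 0 < k
  l_pos : 0 < l
  k_lt : k < m * l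

/-- Where a profile `f` decreases, `P = -(f^m)'` as a function of `s = f` satisfies
`dP/ds = slopeField m p k l c s P`. -/
def slopeField (m p k l c s P : ℝ) : ℝ :=
  c + (k + l) * m * s ^ (m - 1) - m * s ^ (m - 1) * (k * l * s ^ m + s ^ p) / P

/-- A positive solution of `dP/ds = slopeField m p k l c s P` on `(0, ∞)`. -/
structure IsOrbit (m p k l c : ℝ) (P : ℝ → ℝ) : Prop where
  pos : ∀ s, 0 < s → 0 < P s
  hasDerivAt : ∀ s, 0 < s → HasDerivAt P (slopeField m p k l c s (P s)) s

/-- `P s = k s^m + O(s)` as `s → ∞`. -/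
def IsGoodAtInfinity (m k : ℝ) (P : ℝ → ℝ) : Prop :=
  ∃ α S : ℝ, 0 < α ∧ 0 < S ∧ ∀ s, S ≤ s → |P s - k * s ^ m| ≤ α * s

/-! ### The slope field -/

section field

variable {m p k l c s : ℝ}

/-- Differences of orbits grow with s, so all comparisons run from right to left, from large s
towards the origin. -/
theorem slopeField_mono (H : Admissible m p k l) (hs : 0 < s) {P Q : ℝ} (hP : 0 < P)
    (hPQ : P ≤ Q) : slopeField m p k l c s P ≤ slopeField m p k l c s Q := by
  obtain ⟨hm, -, -, hk, hl, -⟩ := H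
  unfold slopeField
  gcongr

theorem slopeField_sub {P Q : ℝ} (hP : 0 < P) (hQ : 0 < Q) :
    slopeField m p k l c s P - slopeField m p k l c s Q
      = m * s ^ (m - 1) * (k * l * s ^ m + s ^ p) * (P - Q) / (P * Q) := by
  unfold slopeField
  field_simp
  ring

theorem rpow_sub_one_mul (hs : 0 < s) (m : ℝ) : s ^ (m - 1) * s = s ^ m := by
  rw [← Real.rpow_add_one hs.ne']; ring_nf

theorem continuousOn_slopeField {P : ℝ → ℝ} {t : Set ℝ} (ht : ∀ s ∈ t, 0 < s)
    (hP : ContinuousOn P t) (hpos : ∀ s ∈ t, 0 < P s) :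
    ContinuousOn (fun s => slopeField m p k l c s (P s)) t := by
  have h : ∀ q : ℝ, ContinuousOn (fun s : ℝ => s ^ q) t := fun q =>
    continuousOn_id.rpow_const fun s hs => Or.inl (ht s hs).ne'
  have h1 := h (m - 1)
  have h2 := h m
  have h3 := h p
  unfold slopeField
  refine ContinuousOn.sub (by fun_prop) (ContinuousOn.div (by fun_prop) hP fun s hs =>
    (hpos s hs).ne')

end field

/-! ### Comparison -/

/-- Where P > Q the gap cannot shrink to the right, so a gap at s₀ would survive until s₁. -/
theorem le_of_barrier {P P' Q Q' : ℝ → ℝ} {s₀ s₁ : ℝ} (h01 : s₀ ≤ s₁)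
    (hP : ∀ t ∈ Set.Icc s₀ s₁, HasDerivAt P (P' t) t)
    (hQ : ∀ t ∈ Set.Icc s₀ s₁, HasDerivAt Q (Q' t) t) (hle : P s₁ ≤ Q s₁)
    (h : ∀ t ∈ Set.Icc s₀ s₁, Q t < P t → Q' t ≤ P' t) : P s₀ ≤ Q s₀ := by
  by_contra hlt
  push Not at hlt
  have := le_of_hasDerivAt_nonneg_of_pos (u := fun t => P t - Q t) h01
    (fun t ht => (hP t ht).sub (hQ t ht)) (sub_pos.2 hlt)
    (fun t ht hpos => sub_nonneg.2 (h t (Set.Ico_subset_Icc_self ht) (sub_pos.1 hpos)))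
  linarith

/-- At ε = 0 this is k < ml. The margin is what makes differences of good orbits grow at least like
s^(1+ε). -/
theorem Admissible.exists_margin {m p k l : ℝ} (H : Admissible m p k l) :
    ∃ ε > 0, (k + ε) ^ 2 * (1 + ε) < m * k * l := by
  obtain ⟨hm, -, -, hk, hl, hkl⟩ := H
  have h1 : ContinuousAt (fun ε : ℝ => (k + ε) ^ 2 * (1 + ε)) 0 := by fun_prop
  have h2 : ∀ᶠ ε in 𝓝 (0 : ℝ), (k + ε) ^ 2 * (1 + ε) < m * k * l :=
    h1.eventually_lt continuousAt_const (by simp; nlinarith)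
  obtain ⟨ε, hε, hpos⟩ := ((h2.filter_mono nhdsWithin_le_nhds).and
    (self_mem_nhdsWithin : Set.Ioi (0 : ℝ) ∈ 𝓝[>] 0)).exists
  exact ⟨ε, hpos, hε⟩

theorem exists_forall_mul_le_rpow {m : ℝ} (hm : 1 < m) (α : ℝ) {ε : ℝ} (hε : 0 < ε) :
    ∃ S, 0 < S ∧ ∀ s, S ≤ s → α * s ≤ ε * s ^ m := by
  have h1 := tendsto_rpow_atTop (show 0 < m - 1 by linarith)
  obtain ⟨S, hS⟩ := eventually_atTop.1 ((h1.eventually_ge_atTop (α / ε)).and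
    (eventually_gt_atTop 0))
  refine ⟨max S 1, by positivity, fun s hs => ?_⟩
  obtain ⟨h2, h3⟩ := hS s ((le_max_left _ _).trans hs)
  rw [div_le_iff₀' hε] at h2
  rw [← rpow_sub_one_mul h3, ← mul_assoc]
  gcongr

/-- Comparison from infinity, for a supersolution P and a subsolution Q of the same equation. A
positive gap D = P - Q persists to the right and obeys D' ≥ m s^(m-1) (kl s^m + s^p) D/(PQ), which
is about (ml/k) D/s because both functions are close to k s^m. As ml/k > 1, D outgrows s, but
goodness at infinity makes D = O(s). -/
theorem le_of_good {m p k l c : ℝ} (H : Admissible m p k l) {P P' Q Q' : ℝ → ℝ}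
    (hP : ∀ s, 0 < s → 0 < P s) (hQ : ∀ s, 0 < s → 0 < Q s)
    (dP : ∀ s, 0 < s → HasDerivAt P (P' s) s) (dQ : ∀ s, 0 < s → HasDerivAt Q (Q' s) s)
    (hP' : ∀ s, 0 < s → slopeField m p k l c s (P s) ≤ P' s)
    (hQ' : ∀ s, 0 < s → Q' s ≤ slopeField m p k l c s (Q s))
    (gP : IsGoodAtInfinity m k P) (gQ : IsGoodAtInfinity m k Q) {s : ℝ} (hs : 0 < s) :
    P s ≤ Q s := by
  by_contra hlt
  push Not at hlt
  obtain ⟨ε, hε, hmargin⟩ := H.exists_margin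
  have H' := H
  obtain ⟨hm, -, -, hk, hl, hkl⟩ := H'
  obtain ⟨α₁, S₁, hα₁, hS₁, h₁⟩ := gP
  obtain ⟨α₂, S₂, hα₂, hS₂, h₂⟩ := gQ
  obtain ⟨S₃, hS₃, h₃⟩ := exists_forall_mul_le_rpow hm α₁ hε
  obtain ⟨S₄, hS₄, h₄⟩ := exists_forall_mul_le_rpow hm α₂ hε
  have hmono : ∀ t, s ≤ t → P s - Q s ≤ P t - Q t := fun t ht =>
    le_of_hasDerivAt_nonneg_of_pos (u := fun t => P t - Q t) ht
      (fun x hx => (dP x (hs.trans_le hx.1)).sub (dQ x (hs.trans_le hx.1))) (sub_pos.2 hlt)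
      (fun x hx hpos => by
        have hx0 := hs.trans_le hx.1
        have := slopeField_mono H hx0 (c := c) (hQ x hx0) (sub_pos.1 hpos).le
        have := hP' x hx0
        have := hQ' x hx0
        linarith)
  set T := max s (max (max S₁ S₂) (max S₃ S₄)) with hT
  have hTs : s ≤ T := le_max_left _ _
  have hT1 : S₁ ≤ T := (le_max_left _ _).trans ((le_max_left _ _).trans (le_max_right _ _))
  have hT2 : S₂ ≤ T := (le_max_right _ _).trans ((le_max_left _ _).trans (le_max_right _ _))
  have hT3 : S₃ ≤ T := (le_max_left _ _).trans ((le_max_right _ _).trans (le_max_right _ _))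
  have hT4 : S₄ ≤ T := (le_max_right _ _).trans ((le_max_right _ _).trans (le_max_right _ _))
  have hT0 : 0 < T := hs.trans_le hTs
  have hDpos : ∀ t, T ≤ t → 0 < P t - Q t := fun t ht =>
    (sub_pos.2 hlt).trans_le (hmono t (hTs.trans ht))
  have hgrow : ∀ t, T ≤ t →
      (P T - Q T) * T ^ (-(1 + ε)) ≤ (P t - Q t) * t ^ (-(1 + ε)) := fun t ht => by
    have hd : ∀ x, T ≤ x → HasDerivAt (fun x => (P x - Q x) * x ^ (-(1 + ε)))
        ((P' x - Q' x) * x ^ (-(1 + ε)) + (P x - Q x) * (-(1 + ε) * x ^ (-(1 + ε) - 1))) x :=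
      fun x hx => by
        have hx0 := hT0.trans_le hx
        exact ((dP x hx0).sub (dQ x hx0)).mul (Real.hasDerivAt_rpow_const (Or.inl hx0.ne'))
    refine le_of_hasDerivAt_nonneg (u := fun x => (P x - Q x) * x ^ (-(1 + ε))) ht
      (fun x hx => (hd x hx.1).continuousAt.continuousWithinAt) (fun x hx => hd x hx.1.le)
      (fun x hx => ?_)
    have hx0 := hT0.trans hx.1
    have hxT := hx.1.le
    have hD := hDpos x hxT
    have hPx := hP x hx0
    have hQx := hQ x hx0
    have hP1 : P x ≤ (k + ε) * x ^ m := by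
      have e1 := (abs_le.1 (h₁ x (hT1.trans hxT))).2
      have e2 := h₃ x (hT3.trans hxT)
      linarith
    have hQ1 : Q x ≤ (k + ε) * x ^ m := by
      have e1 := (abs_le.1 (h₂ x (hT2.trans hxT))).2
      have e2 := h₄ x (hT4.trans hxT)
      linarith
    -- The logarithmic derivative of the gap is at least (1 + ε)/x, by PQ ≤ (k+ε)² x^(2m) and the
    -- margin.
    have hq : (1 + ε) * (P x - Q x) / x ≤ P' x - Q' x := by
      have e1 := slopeField_sub (m := m) (p := p) (k := k) (l := l) (c := c) (s := x) hPx hQx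
      have e2 := hP' x hx0
      have e3 := hQ' x hx0
      refine le_trans ?_ (show _ ≤ _ by linarith :
        m * x ^ (m - 1) * (k * l * x ^ m + x ^ p) * (P x - Q x) / (P x * Q x) ≤ _)
      rw [div_le_div_iff₀ hx0 (by positivity)]
      have e4 : P x * Q x ≤ ((k + ε) * x ^ m) * ((k + ε) * x ^ m) := by gcongr
      have e5 : (1 + ε) * (P x * Q x) ≤ m * k * l * (x ^ m * x ^ m) := by
        calc (1 + ε) * (P x * Q x) ≤ (1 + ε) * (((k + ε) * x ^ m) * ((k + ε) * x ^ m)) := by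
              gcongr
          _ = ((k + ε) ^ 2 * (1 + ε)) * (x ^ m * x ^ m) := by ring
          _ ≤ m * k * l * (x ^ m * x ^ m) := by gcongr
      have e6 : m * k * l * (x ^ m * x ^ m) ≤ m * x ^ (m - 1) * (k * l * x ^ m + x ^ p) * x := by
        have e7 := rpow_sub_one_mul hx0 m
        have e8 : m * x ^ (m - 1) * (k * l * x ^ m + x ^ p) * x
            = m * k * l * (x ^ m * x ^ m) + m * x ^ m * x ^ p := by
          rw [← e7]; ring
        rw [e8]
        have : 0 ≤ m * x ^ m * x ^ p := by positivity
        linarith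
      calc (1 + ε) * (P x - Q x) * (P x * Q x) = (1 + ε) * (P x * Q x) * (P x - Q x) := by ring
        _ ≤ m * x ^ (m - 1) * (k * l * x ^ m + x ^ p) * x * (P x - Q x) := by
          exact mul_le_mul_of_nonneg_right (e5.trans e6) hD.le
        _ = _ := by ring
    have e9 : x ^ (-(1 + ε) - 1) = x ^ (-(1 + ε)) / x := by
      rw [Real.rpow_sub_one hx0.ne']
    rw [e9]
    have e10 : (P' x - Q' x) * x ^ (-(1 + ε)) + (P x - Q x) * (-(1 + ε) * (x ^ (-(1 + ε)) / x))
        = x ^ (-(1 + ε)) * (P' x - Q' x - (1 + ε) * (P x - Q x) / x) := by ring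
    rw [e10]
    exact mul_nonneg (by positivity) (by linarith)
  -- A gap of size O(t) divided by t^(1+ε) tends to zero, although the quotient is nondecreasing and
  -- positive at T.
  have hlim : Tendsto (fun t : ℝ => (α₁ + α₂) * t ^ (-ε)) atTop (𝓝 ((α₁ + α₂) * 0)) :=
    (tendsto_rpow_neg_atTop hε).const_mul _
  have hge : (P T - Q T) * T ^ (-(1 + ε)) ≤ (α₁ + α₂) * 0 := by
    refine ge_of_tendsto hlim ?_
    filter_upwards [eventually_ge_atTop T] with t ht
    refine (hgrow t ht).trans ?_
    have ht0 := hT0.trans_le ht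
    have e1 := (abs_le.1 (h₁ t (hT1.trans ht))).2
    have e2 := (abs_le.1 (h₂ t (hT2.trans ht))).1
    have e3 : t ^ (-ε) = t * t ^ (-(1 + ε)) := by
      rw [mul_comm, ← Real.rpow_add_one ht0.ne']; ring_nf
    rw [e3, ← mul_assoc]
    gcongr
    linarith
  rw [mul_zero] at hge
  have := hDpos T le_rfl
  have : 0 < (P T - Q T) * T ^ (-(1 + ε)) := by positivity
  linarith

namespace IsOrbit

variable {m p k l c : ℝ} {P Q : ℝ → ℝ}

/-- Raising c raises the field, so the faster orbit is a supersolution for the slower speed. -/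
theorem antitone_speed (H : Admissible m p k l) {c₁ c₂ : ℝ} (hc : c₁ ≤ c₂)
    (h₁ : IsOrbit m p k l c₁ P) (h₂ : IsOrbit m p k l c₂ Q) (g₁ : IsGoodAtInfinity m k P)
    (g₂ : IsGoodAtInfinity m k Q) {s : ℝ} (hs : 0 < s) : Q s ≤ P s :=
  le_of_good (c := c₁) H h₂.pos h₁.pos h₂.hasDerivAt h₁.hasDerivAt
    (fun s _ => by unfold slopeField; gcongr) (fun _ _ => le_rfl) g₂ g₁ hs

theorem unique (H : Admissible m p k l) (h₁ : IsOrbit m p k l c P) (h₂ : IsOrbit m p k l c Q)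
    (g₁ : IsGoodAtInfinity m k P) (g₂ : IsGoodAtInfinity m k Q) {s : ℝ} (hs : 0 < s) :
    P s = Q s :=
  le_antisymm (antitone_speed H le_rfl h₂ h₁ g₂ g₁ hs) (antitone_speed H le_rfl h₁ h₂ g₁ g₂ hs)

end IsOrbit

/-! ### Limits of orbits -/

/-- The common lower bound d keeps the singular denominator away from zero on compact sets. The
orbits are then equi-Lipschitz there, and dominated convergence passes to the limit in the integral
equation. -/
theorem hasDerivAt_of_tendsto_orbits {m p k l c : ℝ} {P : ℕ → ℝ → ℝ} {cn : ℕ → ℝ} {Q d : ℝ → ℝ}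
    (hc : Tendsto cn atTop (𝓝 c))
    (hd : ContinuousOn d (Set.Ioi 0)) (hdpos : ∀ s, 0 < s → 0 < d s)
    (hP : ∀ s₀ s₁ : ℝ, 0 < s₀ → ∀ᶠ n in atTop, ∀ s ∈ Set.Icc s₀ s₁,
      HasDerivAt (P n) (slopeField m p k l (cn n) s (P n s)) s ∧ d s ≤ P n s)
    (hlim : ∀ s, 0 < s → Tendsto (fun n => P n s) atTop (𝓝 (Q s))) {s : ℝ} (hs : 0 < s) :
    HasDerivAt Q (slopeField m p k l c s (Q s)) s := by
  set s₀ := s / 2 with hs₀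
  set s₁ := 2 * s with hs₁
  have h0 : 0 < s₀ := by positivity
  have h01 : s₀ ≤ s₁ := by linarith
  have hpos : ∀ t ∈ Set.Icc s₀ s₁, 0 < t := fun t ht => h0.trans_le ht.1
  have hsub : Set.Icc s₀ s₁ ⊆ Set.Ioi 0 := hpos
  have hrp : ∀ q : ℝ, ContinuousOn (fun s : ℝ => s ^ q) (Set.Icc s₀ s₁) := fun q =>
    continuousOn_id.rpow_const fun s hs => Or.inl (hpos s hs).ne'
  obtain ⟨A, hA⟩ := isCompact_Icc.exists_bound_of_continuousOn
    (f := fun s => (k + l) * m * s ^ (m - 1)) (s := Set.Icc s₀ s₁)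
    (by have := hrp (m - 1); fun_prop)
  obtain ⟨B, hB⟩ := isCompact_Icc.exists_bound_of_continuousOn
    (f := fun s => m * s ^ (m - 1) * (k * l * s ^ m + s ^ p) / d s) (s := Set.Icc s₀ s₁)
    (by
      have := hrp (m - 1)
      have := hrp m
      have := hrp p
      exact ContinuousOn.div (by fun_prop) (hd.mono hsub) fun s hs => (hdpos s (hpos s hs)).ne')
  set M := |c| + 1 + A + B with hM
  have hcn : ∀ᶠ n in atTop, |cn n| ≤ |c| + 1 :=
    (hc.abs.eventually_lt_const (lt_add_one |c|)).mono fun n hn => hn.le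
  have hev : ∀ᶠ n in atTop, ∀ t ∈ Set.Icc s₀ s₁,
      HasDerivAt (P n) (slopeField m p k l (cn n) t (P n t)) t ∧ d t ≤ P n t ∧
      ‖slopeField m p k l (cn n) t (P n t)‖ ≤ M := by
    filter_upwards [hP s₀ s₁ h0, hcn] with n hn hcn t ht
    refine ⟨(hn t ht).1, (hn t ht).2, ?_⟩
    have ht0 := hpos t ht
    have hdt := hdpos t ht0
    unfold slopeField
    refine (norm_sub_le _ _).trans ?_
    have e1 := norm_add_le (cn n) ((k + l) * m * t ^ (m - 1))
    have e2 := hA t ht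
    have e3 : ‖m * t ^ (m - 1) * (k * l * t ^ m + t ^ p) / P n t‖ ≤ B := by
      refine le_trans ?_ (hB t ht)
      rw [norm_div, norm_div]
      have e4 : ‖d t‖ ≤ ‖P n t‖ := by
        rw [Real.norm_of_nonneg hdt.le, Real.norm_of_nonneg (hdt.le.trans (hn t ht).2)]
        exact (hn t ht).2
      have : 0 < ‖d t‖ := norm_pos_iff.2 hdt.ne'
      gcongr
    rw [Real.norm_eq_abs (cn n)] at e1
    simp only [hM] at *
    linarith
  have hQd : ∀ t ∈ Set.Icc s₀ s₁, d t ≤ Q t := fun t ht =>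
    ge_of_tendsto (hlim t (hpos t ht)) (hev.mono fun n hn => (hn t ht).2.1)
  have hQpos : ∀ t ∈ Set.Icc s₀ s₁, 0 < Q t := fun t ht =>
    (hdpos t (hpos t ht)).trans_le (hQd t ht)
  have hQc : ContinuousOn Q (Set.Icc s₀ s₁) := by
    refine (LipschitzOnWith.of_dist_le_mul (K := ⟨|M|, abs_nonneg M⟩) fun x hx y hy => ?_).continuousOn
    have h1 : Tendsto (fun n => dist (P n x) (P n y)) atTop (𝓝 (dist (Q x) (Q y))) :=
      (hlim x (hpos x hx)).dist (hlim y (hpos y hy))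
    refine le_of_tendsto h1 (hev.mono fun n hn => ?_)
    have := (convex_Icc s₀ s₁).norm_image_sub_le_of_norm_hasDerivWithin_le
      (fun t ht => (hn t ht).1.hasDerivWithinAt) (fun t ht => (hn t ht).2.2) hy hx
    rw [Real.dist_eq, Real.dist_eq]
    refine this.trans ?_
    rw [Real.norm_eq_abs]
    exact mul_le_mul_of_nonneg_right (le_abs_self M) (abs_nonneg _)
  have hFc := continuousOn_slopeField (m := m) (p := p) (k := k) (l := l) (c := c) hpos hQc hQpos
  have hint : ∀ t ∈ Set.Icc s₀ s₁,
      Q t = Q s₀ + ∫ x in s₀..t, slopeField m p k l c x (Q x) := fun t ht => by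
    have hsubt : Set.Icc s₀ t ⊆ Set.Icc s₀ s₁ := Set.Icc_subset_Icc_right ht.2
    have h1 : Tendsto (fun n => P n t - P n s₀) atTop (𝓝 (Q t - Q s₀)) :=
      (hlim t (hpos t ht)).sub (hlim s₀ h0)
    have h2 : Tendsto (fun n => ∫ x in s₀..t, slopeField m p k l (cn n) x (P n x)) atTop
        (𝓝 (∫ x in s₀..t, slopeField m p k l c x (Q x))) := by
      refine intervalIntegral.tendsto_integral_filter_of_dominated_convergence (fun _ => M) ?_ ?_
        intervalIntegrable_const ?_
      · filter_upwards [hev] with n hn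
        rw [Set.uIoc_of_le ht.1]
        refine ContinuousOn.aestronglyMeasurable ?_ measurableSet_Ioc
        refine continuousOn_slopeField (fun x hx => hpos x (hsubt (Set.Ioc_subset_Icc_self hx)))
          (fun x hx => ((hn x (hsubt (Set.Ioc_subset_Icc_self hx))).1).continuousAt.continuousWithinAt)
          (fun x hx => (hdpos x (hpos x (hsubt (Set.Ioc_subset_Icc_self hx)))).trans_le
            (hn x (hsubt (Set.Ioc_subset_Icc_self hx))).2.1)
      · filter_upwards [hev] with n hn
        refine Eventually.of_forall fun x hx => ?_
        rw [Set.uIoc_of_le ht.1] at hx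
        exact (hn x (hsubt (Set.Ioc_subset_Icc_self hx))).2.2
      · refine Eventually.of_forall fun x hx => ?_
        rw [Set.uIoc_of_le ht.1] at hx
        have hx' := hsubt (Set.Ioc_subset_Icc_self hx)
        unfold slopeField
        exact (hc.add_const _).sub ((tendsto_const_nhds).div (hlim x (hpos x hx'))
          (hQpos x hx').ne')
    have h3 : (fun n => P n t - P n s₀) =ᶠ[atTop]
        fun n => ∫ x in s₀..t, slopeField m p k l (cn n) x (P n x) := by
      filter_upwards [hev] with n hn
      symm
      refine intervalIntegral.integral_eq_sub_of_hasDerivAt (fun x hx => ?_) ?_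
      · rw [Set.uIcc_of_le ht.1] at hx
        exact (hn x (hsubt hx)).1
      · refine ContinuousOn.intervalIntegrable ?_
        rw [Set.uIcc_of_le ht.1]
        exact continuousOn_slopeField (fun x hx => hpos x (hsubt hx))
          (fun x hx => ((hn x (hsubt hx)).1).continuousAt.continuousWithinAt)
          (fun x hx => (hdpos x (hpos x (hsubt hx))).trans_le (hn x (hsubt hx)).2.1)
    have := tendsto_nhds_unique (h1.congr' h3) h2
    linarith
  have hmem : s ∈ Set.Ioo s₀ s₁ := ⟨by linarith, by linarith⟩
  have hFat : ContinuousAt (fun x => slopeField m p k l c x (Q x)) s :=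
    hFc.continuousAt (Icc_mem_nhds hmem.1 hmem.2)
  have hder : HasDerivAt (fun t => Q s₀ + ∫ x in s₀..t, slopeField m p k l c x (Q x))
      (slopeField m p k l c s (Q s)) s := by
    refine HasDerivAt.const_add _ (intervalIntegral.integral_hasDerivAt_right ?_ ?_ hFat)
    · refine ContinuousOn.intervalIntegrable ?_
      rw [Set.uIcc_of_le hmem.1.le]
      exact hFc.mono (Set.Icc_subset_Icc_right hmem.2.le)
    · exact hFc.stronglyMeasurableAtFilter_nhdsWithin measurableSet_Icc s |>.filter_mono
        (by rw [nhdsWithin_eq_nhds.2 (Icc_mem_nhds hmem.1 hmem.2)])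
  refine hder.congr_of_eventuallyEq ?_
  filter_upwards [Icc_mem_nhds hmem.1 hmem.2] with t ht
  exact hint t ht

/-! ### Existence of good orbits -/

/-- With max(P, d) in the denominator the field is bounded and globally Lipschitz in P, so
Picard-Lindelöf covers the whole interval at once. The truncation is removed later by showing P ≥ d.
-/
theorem exists_hasDerivWithinAt_truncated {A B d : ℝ → ℝ} {s₀ s₁ t₀ : ℝ}
    (ht₀ : t₀ ∈ Set.Icc s₀ s₁) (hA : ContinuousOn A (Set.Icc s₀ s₁))
    (hB : ContinuousOn B (Set.Icc s₀ s₁)) (hd : ContinuousOn d (Set.Icc s₀ s₁))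
    (hpos : ∀ s ∈ Set.Icc s₀ s₁, 0 < d s) (x₀ : ℝ) :
    ∃ P : ℝ → ℝ, P t₀ = x₀ ∧ ∀ s ∈ Set.Icc s₀ s₁,
      HasDerivWithinAt P (A s - B s / max (P s) (d s)) (Set.Icc s₀ s₁) s := by
  obtain ⟨L₁, hL₁⟩ := isCompact_Icc.exists_bound_of_continuousOn hA
  obtain ⟨L₂, hL₂⟩ := isCompact_Icc.exists_bound_of_continuousOn
    (hB.div hd fun s hs => (hpos s hs).ne')
  obtain ⟨K, hK⟩ := isCompact_Icc.exists_bound_of_continuousOn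
    (hB.div (hd.pow 2) fun s hs => (pow_pos (hpos s hs) 2).ne')
  set L : NNReal := ⟨|L₁| + |L₂|, by positivity⟩ with hL
  -- A bound of the field times the length of the interval: the solution cannot leave this ball.
  set R : NNReal := L * ⟨s₁ - s₀, by linarith [ht₀.1.trans ht₀.2]⟩ with hR
  have hPL : IsPicardLindelof (fun s x => A s - B s / max x (d s)) (⟨t₀, ht₀⟩ : Set.Icc s₀ s₁)
      x₀ R 0 L ⟨|K|, abs_nonneg K⟩ := by
    refine ⟨fun s hs => LipschitzOnWith.of_dist_le_mul fun x _ y _ => ?_, fun x _ => ?_,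
      fun s hs x _ => ?_, ?_⟩
    · have hds := hpos s hs
      have hx : d s ≤ max x (d s) := le_max_right _ _
      have hy : d s ≤ max y (d s) := le_max_right _ _
      have hx0 := hds.trans_le hx
      have hy0 := hds.trans_le hy
      rw [Real.dist_eq, Real.dist_eq]
      have e1 : A s - B s / max x (d s) - (A s - B s / max y (d s))
          = B s * (max x (d s) - max y (d s)) / (max x (d s) * max y (d s)) := by
        field_simp; ring
      rw [e1, abs_div, abs_mul, abs_of_pos (mul_pos hx0 hy0)]
      have e2 : |max x (d s) - max y (d s)| ≤ |x - y| := abs_max_sub_max_le_abs x y (d s)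
      have e3 : d s ^ 2 ≤ max x (d s) * max y (d s) := by
        rw [sq]; gcongr
      have e4 := hK s hs
      simp only [Pi.div_apply, Pi.pow_apply, Real.norm_eq_abs, abs_div,
        abs_of_pos (pow_pos hds 2)] at e4
      calc |B s| * |max x (d s) - max y (d s)| / (max x (d s) * max y (d s))
          ≤ |B s| * |x - y| / d s ^ 2 := by gcongr
        _ = |B s| / d s ^ 2 * |x - y| := by ring
        _ ≤ |K| * |x - y| := by
          gcongr
          exact e4.trans (le_abs_self K)
    · exact hA.sub (hB.div (ContinuousOn.sup continuousOn_const hd) fun s hs =>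
        ((hpos s hs).trans_le (le_max_right _ _)).ne')
    · have hds := hpos s hs
      have e1 := hL₁ s hs
      have e2 := hL₂ s hs
      refine (norm_sub_le _ _).trans ?_
      have e3 : ‖B s / max x (d s)‖ ≤ ‖B s / d s‖ := by
        rw [norm_div, norm_div, Real.norm_of_nonneg hds.le,
          Real.norm_of_nonneg (hds.le.trans (le_max_right _ _))]
        gcongr
        exact le_max_right _ _
      have e4 := le_abs_self L₁
      have e5 := le_abs_self L₂
      simp only [Pi.div_apply] at e2
      change _ ≤ |L₁| + |L₂|
      linarith
    · simp only [hR, NNReal.coe_zero, sub_zero]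
      refine mul_le_mul_of_nonneg_left (max_le ?_ ?_) L.2
      · linarith [ht₀.1]
      · linarith [ht₀.2]
  exact hPL.exists_eq_forall_mem_Icc_hasDerivWithinAt₀

/-! ### Explicit barriers -/

section barriers

variable {m p k l c : ℝ}

theorem exists_rpow_le_linear (hp0 : 0 < p) (hp1 : p < 1) {q : ℝ} (hq : 0 < q) :
    ∃ K, 0 ≤ K ∧ ∀ s : ℝ, 0 < s → s ^ p ≤ q * s + K := by
  have hp : 0 < 1 - p := by linarith
  -- The point where s^p = q s.
  set s₀ := q ^ (-(1 / (1 - p))) with hs₀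
  have h0 : 0 < s₀ := by positivity
  refine ⟨s₀ ^ p, by positivity, fun s hs => ?_⟩
  rcases le_total s s₀ with h | h
  · have : s ^ p ≤ s₀ ^ p := by gcongr
    have : 0 ≤ q * s := by positivity
    linarith
  · have h1 : s ^ (p - 1) ≤ q := by
      have : s₀ ^ (p - 1) = q := by
        rw [hs₀, ← Real.rpow_mul hq.le]
        have : -(1 / (1 - p)) * (p - 1) = 1 := by field_simp; ring
        rw [this, Real.rpow_one]
      rw [← this]
      exact Real.rpow_le_rpow_of_nonpos h0 h (by linarith)
    have h2 := rpow_sub_one_mul hs p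
    have h3 : s ^ (p - 1) * s ≤ q * s := by gcongr
    have : 0 ≤ s₀ ^ p := by positivity
    linarith

theorem hasDerivAt_upperBarrier (hm : 1 < m) (k γ K : ℝ) (s : ℝ) :
    HasDerivAt (fun s => k * s ^ m + γ * s + K) (k * (m * s ^ (m - 1)) + γ) s := by
  simpa using (((Real.hasDerivAt_rpow_const (Or.inr hm.le)).const_mul k).add
    ((hasDerivAt_id s).const_mul γ)).add_const K

/-- The function k s^m solves the principal part exactly, because k is a root; the hypothesis is
what is left of the inequality after this cancellation. -/
theorem upperBarrier_le (H : Admissible m p k l) {γ K : ℝ} (hγ : 0 < γ) (hK : 0 ≤ K)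
    {s : ℝ} (hs : 0 < s)
    (h : γ - c ≤ m * s ^ (m - 1) * (l * (γ * s + K) - s ^ p) / (k * s ^ m + γ * s + K)) :
    k * (m * s ^ (m - 1)) + γ ≤ slopeField m p k l c s (k * s ^ m + γ * s + K) := by
  obtain ⟨hm, hp0, hp1, hk, hl, hkl⟩ := H
  have hQ : 0 < k * s ^ m + γ * s + K := by positivity
  have e : slopeField m p k l c s (k * s ^ m + γ * s + K) - (k * (m * s ^ (m - 1)) + γ)
      = c - γ + m * s ^ (m - 1) * (l * (γ * s + K) - s ^ p) / (k * s ^ m + γ * s + K) := by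
    unfold slopeField
    field_simp
    ring
  linarith

/-- The coefficient α = ck/(ml - k) solves c + α = (ml/k) α, the balance of order s^0 in the
equation for k s^m - α s. The remaining errors, from s^p and from the smaller denominator, have the
favourable sign. -/
theorem lowerBarrier_le (H : Admissible m p k l) (hc : 0 < c) {s : ℝ} (hs : 0 < s)
    (hQ : 0 < k * s ^ m - c * k / (m * l - k) * s) :
    slopeField m p k l c s (k * s ^ m - c * k / (m * l - k) * s)
      ≤ k * (m * s ^ (m - 1)) - c * k / (m * l - k) := by
  obtain ⟨hm, hp0, hp1, hk, hl, hkl⟩ := H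
  have hkl' : 0 < m * l - k := by linarith
  set α := c * k / (m * l - k) with hα
  have hα0 : 0 < α := by positivity
  have e1 : c + α = m * l / k * α := by
    rw [hα]; field_simp; ring
  have e2 : m * s ^ (m - 1) * (l * α * s) / (k * s ^ m)
      ≤ m * s ^ (m - 1) * (s ^ p + l * α * s) / (k * s ^ m - α * s) := by
    have h1 : 0 ≤ s ^ p := by positivity
    have h2 : 0 ≤ α * s := by positivity
    gcongr
    · linarith
    · linarith
  have e3 : m * s ^ (m - 1) * (l * α * s) / (k * s ^ m) = m * l / k * α := by
    rw [← rpow_sub_one_mul hs m]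
    field_simp
  have e : k * (m * s ^ (m - 1)) - α - slopeField m p k l c s (k * s ^ m - α * s)
      = -(c + α) + m * s ^ (m - 1) * (s ^ p + l * α * s) / (k * s ^ m - α * s) := by
    unfold slopeField
    have := hQ.ne'
    field_simp
    ring
  linarith

/-- For small δ the singular term dominates along δ s^(m+p-1). This keeps orbits positive and their
travel time to the origin finite. -/
theorem exists_powerBarrier (H : Admissible m p k l) (hc : 0 < c) :
    ∃ δ, 0 < δ ∧ δ ≤ k ∧ ∀ s : ℝ, 0 < s →
      slopeField m p k l c s (δ * s ^ (m + p - 1)) ≤ 0 := by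
  obtain ⟨hm, hp0, hp1, hk, hl, hkl⟩ := H
  have hm0 : 0 < m := by linarith
  -- By s^(m-1) ≤ 1 + s^(m-p) it suffices to compare constant terms (second bound) and coefficients
  -- of s^(m-p) (third bound). The bound δ ≤ k puts the barrier below the starting value at T ≥ 1.
  refine ⟨min k (min (m / (c + (k + l) * m)) (k * l / (k + l))), by positivity, min_le_left _ _,
    fun s hs => ?_⟩
  set δ := min k (min (m / (c + (k + l) * m)) (k * l / (k + l))) with hδ
  have hδ0 : 0 < δ := by positivity
  have h1 : δ * (c + (k + l) * m) ≤ m := by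
    rw [← le_div_iff₀ (by positivity)]
    exact (min_le_right _ _).trans (min_le_left _ _)
  have h2 : δ * (k + l) ≤ k * l := by
    rw [← le_div_iff₀ (by positivity)]
    exact (min_le_right _ _).trans (min_le_right _ _)
  have h3 : s ^ (m - 1) ≤ 1 + s ^ (m - p) := by
    rcases le_total s 1 with h | h
    · have e1 : s ^ (m - 1) ≤ 1 := Real.rpow_le_one hs.le h (by linarith)
      have : 0 ≤ s ^ (m - p) := by positivity
      linarith
    · have := Real.rpow_le_rpow_of_exponent_le h (show m - 1 ≤ m - p by linarith)
      linarith
  have h4 : m * s ^ (m - 1) * (k * l * s ^ m + s ^ p) / (δ * s ^ (m + p - 1))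
      = m * (k * l * s ^ (m - p) + 1) / δ := by
    have e1 : s ^ (m + p - 1) = s ^ (m - 1) * s ^ p := by
      rw [← Real.rpow_add hs]; ring_nf
    have e2 : s ^ m = s ^ (m - p) * s ^ p := by
      rw [← Real.rpow_add hs]; ring_nf
    rw [e1, e2]
    field_simp
  unfold slopeField
  rw [h4, sub_nonpos, le_div_iff₀ hδ0]
  have h5 : 0 ≤ s ^ (m - p) := by positivity
  calc (c + (k + l) * m * s ^ (m - 1)) * δ
      ≤ (c + (k + l) * m * (1 + s ^ (m - p))) * δ := by gcongr
    _ = δ * (c + (k + l) * m) + m * s ^ (m - p) * (δ * (k + l)) := by ring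
    _ ≤ m + m * s ^ (m - p) * (k * l) := by gcongr
    _ = _ := by ring

end barriers

/-- A solution on `[1/T, T]` starting from the upper barrier at `T` stays between the barriers. -/
theorem exists_orbit_on_Icc {m p k l c K δ : ℝ} (H : Admissible m p k l) (hc : 0 < c)
    (hK : 0 ≤ K) (hKs : ∀ s : ℝ, 0 < s → s ^ p ≤ l * c * s + l * K)
    (hδ : 0 < δ) (hδk : δ ≤ k)
    (hδs : ∀ s : ℝ, 0 < s → slopeField m p k l c s (δ * s ^ (m + p - 1)) ≤ 0)
    {T : ℝ} (hT : 1 ≤ T) :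
    ∃ P : ℝ → ℝ, P T = k * T ^ m + c * T + K ∧ ∀ s ∈ Set.Icc (1 / T) T,
      HasDerivAt P (slopeField m p k l c s (P s)) s ∧ δ * s ^ (m + p - 1) ≤ P s ∧
      k * s ^ m - c * k / (m * l - k) * s ≤ P s ∧ P s ≤ k * s ^ m + c * s + K := by
  have H' := H
  obtain ⟨hm, hp0, hp1, hk, hl, hkl⟩ := H'
  have hT0 : 0 < T := by linarith
  have hlow : 1 / (2 * T) < 1 / T := by
    apply one_div_lt_one_div_of_lt <;> linarith
  have hinv : 1 / T ≤ T := (div_le_one₀ hT0 |>.2 hT).trans hT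
  have hpos : ∀ s ∈ Set.Icc (1 / (2 * T)) (2 * T), 0 < s := fun s hs =>
    lt_of_lt_of_le (by positivity) hs.1
  have hrp : ∀ q : ℝ, ContinuousOn (fun s : ℝ => s ^ q) (Set.Icc (1 / (2 * T)) (2 * T)) :=
    fun q => continuousOn_id.rpow_const fun s hs => Or.inl (hpos s hs).ne'
  have c1 := hrp (m - 1)
  have c2 := hrp m
  have c3 := hrp p
  have c4 := hrp (m + p - 1)
  -- The larger interval [1/(2T), 2T] makes the derivatives two-sided on [1/T, T].
  obtain ⟨P, hPT, hP⟩ := exists_hasDerivWithinAt_truncated (t₀ := T)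
    (A := fun s => c + (k + l) * m * s ^ (m - 1))
    (B := fun s => m * s ^ (m - 1) * (k * l * s ^ m + s ^ p)) (d := fun s => δ * s ^ (m + p - 1))
    (s₀ := 1 / (2 * T)) (s₁ := 2 * T) ⟨hlow.le.trans hinv, by linarith⟩ (by fun_prop)
    (by fun_prop) (by fun_prop) (fun s hs => by have := hpos s hs; positivity)
    (k * T ^ m + c * T + K)
  have hP' : ∀ s ∈ Set.Icc (1 / T) T,
      HasDerivAt P (slopeField m p k l c s (max (P s) (δ * s ^ (m + p - 1)))) s := fun s hs =>
    (hP s ⟨hlow.le.trans hs.1, by linarith [hs.2]⟩).hasDerivAt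
      (Icc_mem_nhds (hlow.trans_le hs.1) (by linarith [hs.2]))
  have hs0 : ∀ s ∈ Set.Icc (1 / T) T, 0 < s := fun s hs => lt_of_lt_of_le (by positivity) hs.1
  have hsub : ∀ s ∈ Set.Icc (1 / T) T, ∀ t ∈ Set.Icc s T, t ∈ Set.Icc (1 / T) T :=
    fun s hs t ht => ⟨hs.1.trans ht.1, ht.2⟩
  have hδP : ∀ s ∈ Set.Icc (1 / T) T, δ * s ^ (m + p - 1) ≤ P s := fun s hs => by
    refine le_of_barrier (P := fun s => δ * s ^ (m + p - 1)) hs.2 (fun t ht =>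
      (Real.hasDerivAt_rpow_const (Or.inl (hs0 t (hsub s hs t ht)).ne')).const_mul δ)
      (fun t ht => hP' t (hsub s hs t ht)) ?_ fun t ht hlt => ?_
    · rw [hPT]
      have : T ^ (m + p - 1) ≤ T ^ m := Real.rpow_le_rpow_of_exponent_le hT (by linarith)
      have : δ * T ^ (m + p - 1) ≤ k * T ^ m := by gcongr
      have : 0 ≤ c * T + K := by positivity
      linarith
    · have ht0 := hs0 t (hsub s hs t ht)
      rw [max_eq_right hlt.le]
      refine (hδs t ht0).trans ?_
      have : 0 ≤ m + p - 1 := by linarith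
      positivity
  have hd : ∀ s ∈ Set.Icc (1 / T) T, HasDerivAt P (slopeField m p k l c s (P s)) s :=
    fun s hs => by
      have := hP' s hs
      rwa [max_eq_left (hδP s hs)] at this
  have hPpos : ∀ s ∈ Set.Icc (1 / T) T, 0 < P s := fun s hs =>
    lt_of_lt_of_le (by have := hs0 s hs; positivity) (hδP s hs)
  have hα : 0 ≤ c * k / (m * l - k) := div_nonneg (by positivity) (by linarith)
  refine ⟨P, hPT, fun s hs => ⟨hd s hs, hδP s hs, ?_, ?_⟩⟩
  · refine le_of_barrier (P := fun s => k * s ^ m - c * k / (m * l - k) * s)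
      (P' := fun s => k * (m * s ^ (m - 1)) - c * k / (m * l - k)) hs.2 (fun t _ => ?_)
      (fun t ht => hd t (hsub s hs t ht)) ?_ fun t ht hlt => ?_
    · simpa [sub_eq_add_neg] using hasDerivAt_upperBarrier hm k (-(c * k / (m * l - k))) 0 t
    · rw [hPT]
      have : 0 ≤ c * k / (m * l - k) * T := by positivity
      have : 0 ≤ c * T + K := by positivity
      linarith
    · have ht' := hsub s hs t ht
      have hPt := hPpos t ht'
      exact (slopeField_mono H (hs0 t ht') hPt hlt.le).trans
        (lowerBarrier_le H hc (hs0 t ht') (hPt.trans hlt))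
  · refine le_of_barrier hs.2 (fun t ht => hd t (hsub s hs t ht))
      (fun t _ => hasDerivAt_upperBarrier hm k c K t) hPT.le fun t ht hlt => ?_
    have ht0 := hs0 t (hsub s hs t ht)
    refine (upperBarrier_le H (c := c) hc hK ht0 ?_).trans
      (slopeField_mono H ht0 (by positivity) hlt.le)
    rw [sub_self]
    have := hKs t ht0
    have : 0 ≤ l * (c * t + K) - t ^ p := by linarith
    positivity

/-- The solutions launched from the upper barrier at T = n + 1 decrease with n, since the next one
is already below that barrier at n + 1. They converge, and the limit inherits all three barriers;
the outer two give k s^m + O(s). -/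
theorem exists_good_orbit {m p k l c : ℝ} (H : Admissible m p k l) (hc : 0 < c) :
    ∃ P : ℝ → ℝ, IsOrbit m p k l c P ∧ IsGoodAtInfinity m k P ∧
      ∃ δ, 0 < δ ∧ ∀ s, 0 < s → δ * s ^ (m + p - 1) ≤ P s := by
  have H' := H
  obtain ⟨hm, hp0, hp1, hk, hl, hkl⟩ := H'
  obtain ⟨K', hK', hKs'⟩ := exists_rpow_le_linear hp0 hp1 (show 0 < l * c by positivity)
  obtain ⟨K, hK, hKs⟩ : ∃ K, 0 ≤ K ∧ ∀ s : ℝ, 0 < s → s ^ p ≤ l * c * s + l * K :=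
    ⟨K' / l, by positivity, fun s hs => by
      rw [mul_div_cancel₀ _ hl.ne']; exact hKs' s hs⟩
  obtain ⟨δ, hδ, hδk, hδs⟩ := exists_powerBarrier H hc
  choose P hPT hP using fun n : ℕ => exists_orbit_on_Icc H hc hK hKs hδ hδk hδs
    (T := (n : ℝ) + 1) (by simp)
  have hmem : ∀ s₀ s₁ : ℝ, 0 < s₀ → ∃ n₀ : ℕ, ∀ n ≥ n₀, ∀ s ∈ Set.Icc s₀ s₁,
      s ∈ Set.Icc (1 / ((n : ℝ) + 1)) ((n : ℝ) + 1) := fun s₀ s₁ h0 => by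
    obtain ⟨n₀, hn₀⟩ := exists_nat_ge (max (1 / s₀) s₁)
    refine ⟨n₀, fun n hn s hs => ?_⟩
    have hn' : (n₀ : ℝ) ≤ n := by exact_mod_cast hn
    have h1 := (le_max_left _ _).trans (hn₀.trans hn')
    have h2 := (le_max_right _ _).trans (hn₀.trans hn')
    constructor
    · refine le_trans ?_ hs.1
      rw [div_le_iff₀ h0] at h1
      rw [div_le_iff₀ (by positivity)]
      nlinarith
    · linarith [hs.2]
  have hanti : ∀ n : ℕ, ∀ s ∈ Set.Icc (1 / ((n : ℝ) + 1)) ((n : ℝ) + 1),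
      P (n + 1) s ≤ P n s := fun n s hs => by
    have hsub : ∀ t ∈ Set.Icc s ((n : ℝ) + 1), t ∈ Set.Icc (1 / ((n : ℝ) + 1)) ((n : ℝ) + 1) :=
      fun t ht => ⟨hs.1.trans ht.1, ht.2⟩
    have hsub' : ∀ t ∈ Set.Icc s ((n : ℝ) + 1),
        t ∈ Set.Icc (1 / (((n + 1 : ℕ) : ℝ) + 1)) (((n + 1 : ℕ) : ℝ) + 1) := fun t ht => by
      have h1 := (hsub t ht).1
      have h2 := (hsub t ht).2
      push_cast
      refine ⟨le_trans (one_div_le_one_div_of_le (by positivity) (by linarith)) h1, by linarith⟩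
    have hn1 : (n : ℝ) + 1 ∈ Set.Icc s ((n : ℝ) + 1) := ⟨hs.2, le_rfl⟩
    refine le_of_barrier hs.2 (fun t ht => (hP (n + 1) t (hsub' t ht)).1)
      (fun t ht => (hP n t (hsub t ht)).1) ?_ fun t ht hlt => ?_
    · rw [hPT n]
      exact (hP (n + 1) _ (hsub' _ hn1)).2.2.2
    · have ht0 : 0 < t := lt_of_lt_of_le (by positivity) (hsub t ht).1
      exact slopeField_mono H ht0
        (lt_of_lt_of_le (by positivity) (hP n t (hsub t ht)).2.1) hlt.le
  have hconv : ∀ s, 0 < s → ∃ L, Tendsto (fun n => P n s) atTop (𝓝 L) := fun s hs => by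
    obtain ⟨n₀, hn₀⟩ := hmem s s hs
    have hs' : s ∈ Set.Icc s s := ⟨le_rfl, le_rfl⟩
    have h1 : Antitone fun n => P (n + n₀) s := antitone_nat_of_succ_le fun n => by
      have := hanti (n + n₀) s (hn₀ _ (by omega) s hs')
      rwa [show n + 1 + n₀ = n + n₀ + 1 by omega]
    have h2 : BddBelow (Set.range fun n => P (n + n₀) s) :=
      ⟨δ * s ^ (m + p - 1), by
        rintro _ ⟨n, rfl⟩
        exact (hP (n + n₀) s (hn₀ _ (by omega) s hs')).2.1⟩
    exact ⟨_, (tendsto_add_atTop_iff_nat n₀).1 (tendsto_atTop_ciInf h1 h2)⟩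
  choose! Q hQ using hconv
  have hbd : ∀ s, 0 < s → δ * s ^ (m + p - 1) ≤ Q s ∧
      k * s ^ m - c * k / (m * l - k) * s ≤ Q s ∧ Q s ≤ k * s ^ m + c * s + K := fun s hs => by
    obtain ⟨n₀, hn₀⟩ := hmem s s hs
    have hev : ∀ᶠ n : ℕ in atTop, s ∈ Set.Icc (1 / ((n : ℝ) + 1)) ((n : ℝ) + 1) :=
      eventually_atTop.2 ⟨n₀, fun n hn => hn₀ n hn s ⟨le_rfl, le_rfl⟩⟩
    exact ⟨ge_of_tendsto (hQ s hs) (hev.mono fun n hn => (hP n s hn).2.1),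
      ge_of_tendsto (hQ s hs) (hev.mono fun n hn => (hP n s hn).2.2.1),
      le_of_tendsto (hQ s hs) (hev.mono fun n hn => (hP n s hn).2.2.2)⟩
  have hα : 0 < c * k / (m * l - k) := div_pos (by positivity) (by linarith)
  refine ⟨Q, ⟨fun s hs => lt_of_lt_of_le (by positivity) (hbd s hs).1, fun s hs => ?_⟩,
    ⟨c * k / (m * l - k) + c + K, 1, by positivity, one_pos, fun s hs => ?_⟩,
    δ, hδ, fun s hs => (hbd s hs).1⟩
  · refine hasDerivAt_of_tendsto_orbits (P := P) (cn := fun _ => c)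
      (d := fun s => δ * s ^ (m + p - 1)) tendsto_const_nhds ?_ (fun s hs => by positivity)
      (fun s₀ s₁ h0 => ?_) hQ hs
    · exact continuousOn_const.mul (continuousOn_id.rpow_const fun s hs => Or.inl (ne_of_gt hs))
    · obtain ⟨n₀, hn₀⟩ := hmem s₀ s₁ h0
      refine eventually_atTop.2 ⟨n₀, fun n hn s hs => ?_⟩
      have := hP n s (hn₀ n hn s hs)
      exact ⟨this.1, this.2.1⟩
  · have hs0 : 0 < s := by linarith
    obtain ⟨-, h1, h2⟩ := hbd s hs0
    have h3 : K ≤ K * s := by nlinarith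
    have h4 : 0 ≤ c * s := by positivity
    have h5 : 0 ≤ c * k / (m * l - k) * s := by positivity
    have h6 : 0 ≤ K * s := by positivity
    rw [abs_le]
    constructor <;> linarith

/-! ### Orbits near the origin -/

theorem tendsto_rpow_nhdsGT_zero {q : ℝ} (hq : 0 < q) :
    Tendsto (fun s : ℝ => s ^ q) (𝓝[>] 0) (𝓝 0) := by
  have := (Real.continuousAt_rpow_const 0 q (Or.inr hq.le)).tendsto
  rw [Real.zero_rpow hq.ne'] at this
  exact this.mono_left nhdsWithin_le_nhds

theorem tendsto_id_nhdsGT_zero : Tendsto (fun s : ℝ => s) (𝓝[>] 0) (𝓝 0) :=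
  tendsto_id.mono_left nhdsWithin_le_nhds

theorem exists_forall_Ioc_of_eventually {p : ℝ → Prop} (h : ∀ᶠ s in 𝓝[>] (0 : ℝ), p s) :
    ∃ s₀, 0 < s₀ ∧ ∀ s, 0 < s → s ≤ s₀ → p s := by
  obtain ⟨u, hu, hsub⟩ := mem_nhdsGT_iff_exists_Ioc_subset.1 h
  exact ⟨u, hu, fun s h0 h1 => hsub ⟨h0, h1⟩⟩

theorem eventually_of_forall_Ioc {p : ℝ → Prop} {s₀ : ℝ} (h0 : 0 < s₀)
    (h : ∀ s, 0 < s → s ≤ s₀ → p s) : ∀ᶠ s in 𝓝[>] (0 : ℝ), p s := by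
  filter_upwards [Ioc_mem_nhdsGT h0] with s hs using h s hs.1 hs.2

theorem mul_le_of_le_hasDerivAt {u u' : ℝ → ℝ} {q s₀ : ℝ}
    (hd : ∀ s, 0 < s → HasDerivAt u (u' s) s) (h : ∀ s, 0 < s → s ≤ s₀ → q ≤ u' s)
    (hu : Tendsto u (𝓝[>] 0) (𝓝 0)) {s : ℝ} (hs : 0 < s) (hs₀ : s ≤ s₀) : q * s ≤ u s := by
  have h1 : Tendsto (fun t => u t + q * (s - t)) (𝓝[>] 0) (𝓝 (0 + q * (s - 0))) :=
    hu.add ((tendsto_id_nhdsGT_zero.const_sub s).const_mul q)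
  rw [zero_add, sub_zero] at h1
  refine le_of_tendsto h1 (eventually_of_forall_Ioc hs fun t ht hts => ?_)
  have := le_of_hasDerivAt_nonneg (u := fun t => u t - q * t) (u' := fun t => u' t - q) hts
    (fun x hx => (((hd x (ht.trans_le hx.1)).continuousAt).sub
      (by fun_prop)).continuousWithinAt)
    (fun x hx => by simpa using! (hd x (ht.trans hx.1)).sub ((hasDerivAt_id x).const_mul q))
    (fun x hx => sub_nonneg.2 (h x (ht.trans hx.1) (hx.2.le.trans hs₀)))
  linarith

section nearZero

variable {m p k l c : ℝ}

theorem slopeField_eq_add (c s P : ℝ) :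
    slopeField m p k l c s P = c + slopeField m p k l 0 s P := by
  unfold slopeField; ring

/-- Along a line the singular term is of order s^(m+p-2) + s^(2m-2), which vanishes since m + p > 2.
-/
theorem tendsto_slopeField_line (hm : 1 < m) (hmp : 2 < m + p) {η : ℝ} (hη : 0 < η) :
    Tendsto (fun s => slopeField m p k l 0 s (η * s)) (𝓝[>] 0) (𝓝 0) := by
  have h1 := tendsto_rpow_nhdsGT_zero (show 0 < m - 1 by linarith)
  have h2 := tendsto_rpow_nhdsGT_zero (show 0 < 2 * m - 2 by linarith)
  have h3 := tendsto_rpow_nhdsGT_zero (show 0 < m + p - 2 by linarith)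
  have h4 := (h1.const_mul ((k + l) * m)).sub (((h2.const_mul (k * l)).add h3).const_mul (m / η))
  simp only [mul_zero, add_zero, sub_zero] at h4
  refine h4.congr' (eventually_of_forall_Ioc one_pos fun s hs _ => ?_)
  unfold slopeField
  have e1 : s ^ (2 * m - 2) * s = s ^ (m - 1) * s ^ m := by
    rw [← Real.rpow_add_one hs.ne', ← Real.rpow_add hs]; ring_nf
  have e2 : s ^ (m + p - 2) * s = s ^ (m - 1) * s ^ p := by
    rw [← Real.rpow_add_one hs.ne', ← Real.rpow_add hs]; ring_nf
  have e3 : m * s ^ (m - 1) * (k * l * s ^ m + s ^ p) / (η * s)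
      = m / η * (k * l * s ^ (2 * m - 2) + s ^ (m + p - 2)) := by
    rw [div_eq_iff (by positivity),
      show m * s ^ (m - 1) * (k * l * s ^ m + s ^ p)
        = m * (k * l * (s ^ (m - 1) * s ^ m) + s ^ (m - 1) * s ^ p) by ring, ← e1, ← e2]
    field_simp
  simp only [e3]; ring

/-- The limit changes sign at z = m/c, which singles out the coefficient of the Type II branch. -/
theorem tendsto_slopeField_power (hm : 1 < m) (hp : p < 1) {z : ℝ} (hz : 0 < z) :
    Tendsto (fun s => slopeField m p k l c s (z * s ^ (m + p - 1))) (𝓝[>] 0)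
      (𝓝 (c - m / z)) := by
  have h1 := tendsto_rpow_nhdsGT_zero (show 0 < m - 1 by linarith)
  have h2 := tendsto_rpow_nhdsGT_zero (show 0 < m - p by linarith)
  have h4 := ((h1.const_mul ((k + l) * m)).const_add c).sub
    (((h2.const_mul (k * l)).add_const 1).const_mul (m / z))
  simp only [mul_zero, add_zero, zero_add, mul_one] at h4
  refine h4.congr' (eventually_of_forall_Ioc one_pos fun s hs _ => ?_)
  unfold slopeField
  have e1 : s ^ (m + p - 1) = s ^ (m - 1) * s ^ p := by
    rw [← Real.rpow_add hs]; ring_nf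
  have e2 : s ^ m = s ^ (m - p) * s ^ p := by
    rw [← Real.rpow_add hs]; ring_nf
  have e3 : m * s ^ (m - 1) * (k * l * s ^ m + s ^ p) / (z * s ^ (m + p - 1))
      = m / z * (k * l * s ^ (m - p) + 1) := by
    rw [e1, e2]
    field_simp
  simp only [e3]

namespace IsOrbit

variable {P Q : ℝ → ℝ}

theorem hasDerivAt_flux (h : IsOrbit m p k l c P) {s : ℝ} (hs : 0 < s) :
    HasDerivAt (fun s => (k + l) * s ^ m + c * s - P s)
      (m * s ^ (m - 1) * (k * l * s ^ m + s ^ p) / P s) s := by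
  have h1 := (((Real.hasDerivAt_rpow_const (p := m) (Or.inl hs.ne')).const_mul (k + l)).add
    ((hasDerivAt_id s).const_mul c)).sub (h.hasDerivAt s hs)
  refine h1.congr_deriv ?_
  unfold slopeField
  ring

/-- The flux (k+l) s^m + c s - P vanishes at the origin and increases with s. -/
theorem flux_nonneg (H : Admissible m p k l) (h : IsOrbit m p k l c P)
    (h0 : Tendsto P (𝓝[>] 0) (𝓝 0)) {s : ℝ} (hs : 0 < s) : P s ≤ (k + l) * s ^ m + c * s := by
  obtain ⟨hm, -, -, hk, hl, -⟩ := H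
  have h1 : Tendsto (fun s => (k + l) * s ^ m + c * s - P s) (𝓝[>] 0)
      (𝓝 ((k + l) * 0 + c * 0 - 0)) :=
    (((tendsto_rpow_nhdsGT_zero (by linarith)).const_mul _).add
      (tendsto_id_nhdsGT_zero.const_mul c)).sub h0
  simp only [mul_zero, add_zero, sub_zero] at h1
  have := mul_le_of_le_hasDerivAt (q := 0) (s₀ := s) (fun s hs => h.hasDerivAt_flux hs)
    (fun t ht _ => by have := h.pos t ht; positivity) h1 hs le_rfl
  linarith

theorem tendsto_zero_of_le {C D : ℝ} (hm : 0 < m) (h : IsOrbit m p k l c P) {s₀ : ℝ}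
    (hs₀ : 0 < s₀) (hle : ∀ s, 0 < s → s ≤ s₀ → P s ≤ C * s ^ m + D * s) :
    Tendsto P (𝓝[>] 0) (𝓝 0) := by
  have h1 : Tendsto (fun s : ℝ => C * s ^ m + D * s) (𝓝[>] 0) (𝓝 (C * 0 + D * 0)) :=
    ((tendsto_rpow_nhdsGT_zero hm).const_mul _).add (tendsto_id_nhdsGT_zero.const_mul D)
  simp only [mul_zero, add_zero] at h1
  exact tendsto_of_tendsto_of_tendsto_of_le_of_le' tendsto_const_nhds h1
    (eventually_of_forall_Ioc hs₀ fun s hs _ => (h.pos s hs).le)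
    (eventually_of_forall_Ioc hs₀ hle)

/-- A barrier `Q` that lies below the field keeps orbits below it towards the origin. -/
theorem le_of_le_right (H : Admissible m p k l) (h : IsOrbit m p k l c P) {Q' : ℝ → ℝ} {s₁ : ℝ}
    (hQ : ∀ s, 0 < s → 0 < Q s) (dQ : ∀ s, 0 < s → HasDerivAt Q (Q' s) s)
    (hQ' : ∀ s, 0 < s → s ≤ s₁ → Q' s ≤ slopeField m p k l c s (Q s)) (h1 : P s₁ ≤ Q s₁)
    {s : ℝ} (hs : 0 < s) (hs₁ : s ≤ s₁) : P s ≤ Q s :=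
  le_of_barrier hs₁ (fun t ht => h.hasDerivAt t (hs.trans_le ht.1))
    (fun t ht => dQ t (hs.trans_le ht.1)) h1 fun t ht hlt =>
      (hQ' t (hs.trans_le ht.1) ht.2).trans
        (slopeField_mono H (hs.trans_le ht.1) (hQ t (hs.trans_le ht.1)) hlt.le)

/-- A barrier `Q` that lies above the field keeps orbits above it towards the origin. -/
theorem ge_of_ge_right (H : Admissible m p k l) (h : IsOrbit m p k l c P) {Q' : ℝ → ℝ} {s₁ : ℝ}
    (dQ : ∀ s, 0 < s → HasDerivAt Q (Q' s) s)
    (hQ' : ∀ s, 0 < s → s ≤ s₁ → slopeField m p k l c s (Q s) ≤ Q' s) (h1 : Q s₁ ≤ P s₁)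
    {s : ℝ} (hs : 0 < s) (hs₁ : s ≤ s₁) : Q s ≤ P s :=
  le_of_barrier hs₁ (fun t ht => dQ t (hs.trans_le ht.1))
    (fun t ht => h.hasDerivAt t (hs.trans_le ht.1)) h1 fun t ht hlt =>
      (slopeField_mono H (hs.trans_le ht.1) (h.pos t (hs.trans_le ht.1)) hlt.le).trans
        (hQ' t (hs.trans_le ht.1) ht.2)

/-- Above a line the singular term is negligible, so the slope of P is at least c - o(1).
Nonnegativity of the flux gives the matching upper bound. -/
theorem tendsto_div_of_linear_le (H : Admissible m p k l) (hmp : 2 < m + p)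
    (h : IsOrbit m p k l c P) (h0 : Tendsto P (𝓝[>] 0) (𝓝 0)) {η s₂ : ℝ} (hη : 0 < η)
    (hs₂ : 0 < s₂) (hle : ∀ s, 0 < s → s ≤ s₂ → η * s ≤ P s) :
    Tendsto (fun s => P s / s) (𝓝[>] 0) (𝓝 c) := by
  have hm := H.one_lt
  rw [tendsto_order]
  constructor
  · intro q hq
    obtain ⟨s₃, hs₃, h₃⟩ := exists_forall_Ioc_of_eventually
      ((tendsto_slopeField_line (k := k) (l := l) hm hmp hη).eventually_const_lt
        (show (q - c) / 2 < 0 by linarith))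
    refine eventually_of_forall_Ioc (lt_min hs₂ hs₃) fun s hs hs' => ?_
    rw [lt_div_iff₀ hs]
    have := mul_le_of_le_hasDerivAt (q := (q + c) / 2) (s₀ := min s₂ s₃) h.hasDerivAt
      (fun t ht hts => by
        have e1 := slopeField_mono (c := c) H ht (show 0 < η * t by positivity)
          (hle t ht (hts.trans (min_le_left _ _)))
        have e2 := h₃ t ht (hts.trans (min_le_right _ _))
        rw [slopeField_eq_add] at e1
        linarith) h0 hs hs'
    nlinarith
  · intro q hq
    have h1 : Tendsto (fun s : ℝ => (k + l) * s ^ (m - 1) + c) (𝓝[>] 0) (𝓝 ((k + l) * 0 + c)) :=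
      ((tendsto_rpow_nhdsGT_zero (by linarith)).const_mul _).add_const c
    have h2 := h1.eventually_lt_const (show (k + l) * 0 + c < q by linarith)
    filter_upwards [h2, self_mem_nhdsWithin] with s hs2 hs
    have hs : 0 < s := hs
    refine lt_of_le_of_lt ?_ hs2
    rw [div_le_iff₀ hs]
    have := h.flux_nonneg H h0 hs
    rw [add_mul, mul_assoc, rpow_sub_one_mul hs]
    exact this

/-- The curves z s^(m+p-1) with z on either side of m/c trap the orbit towards the origin: for z >
m/c the field there tends to c - m/z > 0 while the curve flattens, and for z < m/c the field is
negative. -/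
theorem tendsto_div_rpow_of_exists_lt (H : Admissible m p k l) (hmp : 2 < m + p) (hc : 0 < c)
    (h : IsOrbit m p k l c P) (h0 : Tendsto P (𝓝[>] 0) (𝓝 0))
    (hlt : ∀ η, 0 < η → ∀ s₂, 0 < s₂ → ∃ s, 0 < s ∧ s ≤ s₂ ∧ P s < η * s) :
    Tendsto (fun s => P s / s ^ (m + p - 1)) (𝓝[>] 0) (𝓝 (m / c)) := by
  have hm := H.one_lt
  have hm0 : 0 < m := by linarith
  have hmc : 0 < m / c := by positivity
  have dQ : ∀ z s : ℝ, 0 < s → HasDerivAt (fun s => z * s ^ (m + p - 1))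
      (z * ((m + p - 1) * s ^ (m + p - 1 - 1))) s := fun z s hs =>
    (Real.hasDerivAt_rpow_const (Or.inl hs.ne')).const_mul z
  have upper : ∀ z, m / c < z → ∃ s₁, 0 < s₁ ∧ ∀ s, 0 < s → s ≤ s₁ →
      P s ≤ z * s ^ (m + p - 1) := fun z hz => by
    have hz0 : 0 < z := hmc.trans hz
    have hzc : 0 < c - m / z := by
      rw [div_lt_iff₀ hc] at hz
      rw [sub_pos, div_lt_iff₀ hz0]; linarith
    set ε := (c - m / z) / 2 with hε
    have hε0 : 0 < ε := by positivity
    obtain ⟨s₂, hs₂, h₂⟩ := exists_forall_Ioc_of_eventually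
      ((tendsto_slopeField_power (k := k) (l := l) (c := c) hm H.p_lt hz0).eventually_const_lt
        (show ε < c - m / z by linarith))
    have hlim := ((tendsto_rpow_nhdsGT_zero (show 0 < m + p - 1 - 1 by linarith)).const_mul
      (m + p - 1)).const_mul z
    rw [mul_zero, mul_zero] at hlim
    obtain ⟨s₃, hs₃, h₃⟩ := exists_forall_Ioc_of_eventually (hlim.eventually_lt_const hε0)
    -- An orbit staying above the curve would have slope at least ε, hence P ≥ ε s, against the
    -- hypothesis.
    obtain ⟨s₁, hs₁, hs₁', hP⟩ : ∃ s, 0 < s ∧ s ≤ min s₂ s₃ ∧ P s ≤ z * s ^ (m + p - 1) := by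
      by_contra hcon
      push Not at hcon
      obtain ⟨t, ht, hts, hPt⟩ := hlt ε hε0 (min s₂ s₃) (lt_min hs₂ hs₃)
      have := mul_le_of_le_hasDerivAt (q := ε) h.hasDerivAt
        (fun x hx hxs => (h₂ x hx (hxs.trans (min_le_left _ _))).le.trans
          (slopeField_mono H hx (by positivity) (hcon x hx hxs).le)) h0 ht hts
      linarith
    refine ⟨s₁, hs₁, fun s hs hss => ?_⟩
    refine h.le_of_le_right H (fun s hs => by positivity) (dQ z) (fun t ht hts => ?_) hP hs hss
    have e1 := h₂ t ht ((hts.trans hs₁').trans (min_le_left _ _))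
    have e2 := h₃ t ht ((hts.trans hs₁').trans (min_le_right _ _))
    linarith
  have lower : ∀ z, 0 < z → z < m / c → ∃ s₁, 0 < s₁ ∧ ∀ s, 0 < s → s ≤ s₁ →
      z * s ^ (m + p - 1) ≤ P s := fun z hz0 hz => by
    have hzc : c - m / z < 0 := by
      rw [lt_div_iff₀ hc] at hz
      rw [sub_neg, lt_div_iff₀ hz0]; linarith
    obtain ⟨s₂, hs₂, h₂⟩ := exists_forall_Ioc_of_eventually
      ((tendsto_slopeField_power (k := k) (l := l) (c := c) hm H.p_lt hz0).eventually_lt_const hzc)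
    -- An orbit staying below the curve would be nonincreasing in s, which is absurd for a positive
    -- function with limit 0 at the origin.
    obtain ⟨s₁, hs₁, hs₁', hP⟩ : ∃ s, 0 < s ∧ s ≤ s₂ ∧ z * s ^ (m + p - 1) ≤ P s := by
      by_contra hcon
      push Not at hcon
      have := mul_le_of_le_hasDerivAt (u := fun s => - P s) (q := 0)
        (fun s hs => (h.hasDerivAt s hs).neg)
        (fun x hx hxs => neg_nonneg.2 ((slopeField_mono H hx (h.pos x hx) (hcon x hx hxs).le).trans
          (h₂ x hx hxs).le)) (by simpa using! h0.neg) hs₂ le_rfl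
      have := h.pos s₂ hs₂
      linarith
    refine ⟨s₁, hs₁, fun s hs hss => ?_⟩
    refine h.ge_of_ge_right H (dQ z) (fun t ht hts => ?_) hP hs hss
    have e1 := h₂ t ht (hts.trans hs₁')
    have : 0 ≤ m + p - 1 := by linarith
    have : 0 ≤ z * ((m + p - 1) * t ^ (m + p - 1 - 1)) := by positivity
    linarith
  rw [tendsto_order]
  constructor
  · intro q hq
    obtain ⟨s₁, hs₁, h₁⟩ := lower (max ((q + m / c) / 2) (m / c / 2)) (by positivity)
      (max_lt (by linarith) (by linarith))
    refine eventually_of_forall_Ioc hs₁ fun s hs hss => ?_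
    rw [lt_div_iff₀ (by positivity)]
    refine lt_of_lt_of_le ?_ (h₁ s hs hss)
    have : q < max ((q + m / c) / 2) (m / c / 2) := lt_max_of_lt_left (by linarith)
    gcongr
  · intro q hq
    obtain ⟨s₁, hs₁, h₁⟩ := upper ((q + m / c) / 2) (by linarith)
    refine eventually_of_forall_Ioc hs₁ fun s hs hss => ?_
    rw [div_lt_iff₀ (by positivity)]
    refine lt_of_le_of_lt (h₁ s hs hss) ?_
    have : (q + m / c) / 2 < q := by linarith
    gcongr

theorem linear_le_or_exists_lt (P : ℝ → ℝ) :
    (∃ η s₂ : ℝ, 0 < η ∧ 0 < s₂ ∧ ∀ s, 0 < s → s ≤ s₂ → η * s ≤ P s) ∨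
    (∀ η, 0 < η → ∀ s₂, 0 < s₂ → ∃ s, 0 < s ∧ s ≤ s₂ ∧ P s < η * s) := by
  by_cases h : ∃ η s₂ : ℝ, 0 < η ∧ 0 < s₂ ∧ ∀ s, 0 < s → s ≤ s₂ → η * s ≤ P s
  · exact Or.inl h
  · right
    push Not at h
    exact fun η hη s₂ hs₂ => h η s₂ hη hs₂

/-! ### The critical speed -/

/-- Orbits reaching the origin have speed bounded away from zero. -/
theorem exists_speed_lower_bound (H : Admissible m p k l) :
    ∃ c₀, 0 < c₀ ∧ ∀ (c : ℝ) (P : ℝ → ℝ), 0 < c → IsOrbit m p k l c P →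
      Tendsto P (𝓝[>] 0) (𝓝 0) → c₀ ≤ c := by
  have H' := H
  obtain ⟨hm, hp0, hp1, hk, hl, hkl⟩ := H'
  have hm0 : 0 < m := by linarith
  have hmp : 0 < m - p := by linarith
  set B := m * (1 / 2) ^ (m + p) / (k + l + 1) ^ 2 with hB
  have hB0 : 0 < B := by positivity
  refine ⟨(B ^ (1 / (m - p))) ^ (m - 1), by positivity, fun c P hc h h0 => ?_⟩
  -- At this scale c s = s^m. On [s/2, s] the flux gains at least a multiple of s^p, while P > 0
  -- bounds it by (k+l+1) s^m; so s, and with it c, is bounded below.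
  set s := c ^ (1 / (m - 1)) with hs
  have hs0 : 0 < s := by positivity
  have hsc : s ^ (m - 1) = c := by
    rw [hs, ← Real.rpow_mul hc.le, one_div_mul_cancel (by linarith), Real.rpow_one]
  have hcs : c * s = s ^ m := by rw [← hsc, rpow_sub_one_mul hs0]
  have hflux : ∀ t, 0 < t → P t ≤ (k + l) * t ^ m + c * t := fun t ht => h.flux_nonneg H h0 ht
  have hslope : ∀ t ∈ Set.Ioo (s / 2) s,
      m * (s / 2) ^ (m + p - 1) / ((k + l + 1) * s ^ m)
        ≤ m * t ^ (m - 1) * (k * l * t ^ m + t ^ p) / P t := fun t ht => by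
    have ht0 : 0 < t := lt_trans (by positivity) ht.1
    have e1 : P t ≤ (k + l + 1) * s ^ m := by
      have : t ^ m ≤ s ^ m := by
        have := ht.2.le
        gcongr
      have : c * t ≤ c * s := by
        have := ht.2.le
        gcongr
      have := hflux t ht0
      nlinarith
    have e2 : m * (s / 2) ^ (m + p - 1) ≤ m * t ^ (m - 1) * (k * l * t ^ m + t ^ p) := by
      have e3 : (s / 2) ^ (m + p - 1) ≤ t ^ (m + p - 1) := by
        have := ht.1.le
        have : 0 ≤ m + p - 1 := by linarith
        gcongr
      have e4 : t ^ (m + p - 1) = t ^ (m - 1) * t ^ p := by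
        rw [← Real.rpow_add ht0]; ring_nf
      rw [e4] at e3
      have e5 : 0 ≤ t ^ (m - 1) * (k * l * t ^ m) := by positivity
      nlinarith
    have := h.pos t ht0
    gcongr
  have hmvt := sub_le_mul_of_hasDerivAt_le
    (u := fun t => -((k + l) * t ^ m + c * t - P t)) (x := s / 2) (y := s) (by linarith)
    (fun t ht => (h.hasDerivAt_flux (lt_of_lt_of_le (by positivity) ht.1)).neg.continuousAt.continuousWithinAt)
    (fun t ht => (h.hasDerivAt_flux (lt_trans (by positivity) ht.1)).neg)
    (fun t ht => neg_le_neg (hslope t ht))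
  have h1 := hflux (s / 2) (by positivity)
  have h2 := h.pos s hs0
  have h3 : m * (s / 2) ^ (m + p - 1) / ((k + l + 1) * s ^ m) * (s - s / 2)
      ≤ (k + l + 1) * s ^ m := by
    rw [hcs] at hmvt
    linarith
  have h4 : (s / 2) ^ (m + p - 1) * (s - s / 2) = s ^ p * s ^ m * (1 / 2) ^ (m + p) := by
    rw [show s - s / 2 = s / 2 by ring, ← Real.rpow_add_one (by positivity),
      ← Real.rpow_add hs0, show m + p - 1 + 1 = m + p by ring, div_eq_mul_one_div,
      Real.mul_rpow hs0.le (by norm_num), add_comm p m]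
  have h5 : B * s ^ p ≤ s ^ m := by
    rw [div_mul_eq_mul_div, div_le_iff₀ (by positivity)] at h3
    rw [mul_assoc, h4] at h3
    rw [hB, div_mul_eq_mul_div, div_le_iff₀ (by positivity)]
    have e : 0 < s ^ m := by positivity
    refine le_of_mul_le_mul_left ?_ e
    nlinarith
  have h6 : B ≤ s ^ (m - p) := by
    rw [Real.rpow_sub hs0, le_div_iff₀ (by positivity)]
    exact h5
  have h7 : B ^ (1 / (m - p)) ≤ s := by
    calc B ^ (1 / (m - p)) ≤ (s ^ (m - p)) ^ (1 / (m - p)) := by gcongr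
      _ = s := by rw [← Real.rpow_mul hs0.le, mul_one_div_cancel hmp.ne', Real.rpow_one]
  calc (B ^ (1 / (m - p))) ^ (m - 1) ≤ s ^ (m - 1) := by
        have : 0 ≤ m - 1 := by linarith
        gcongr
    _ = c := hsc

/-- Good orbits of large speed reach the origin. -/
theorem exists_speed_upper_bound (H : Admissible m p k l) (hmp : 2 ≤ m + p) :
    ∃ c₁, 0 < c₁ ∧ ∀ (P : ℝ → ℝ), IsOrbit m p k l c₁ P → IsGoodAtInfinity m k P →
      Tendsto P (𝓝[>] 0) (𝓝 0) := by
  have H' := H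
  obtain ⟨hm, hp0, hp1, hk, hl, hkl⟩ := H'
  have hm0 : 0 < m := by linarith
  -- At this speed k s^m + s is a barrier: (m + m/k)(k s^m + s) ≥ m (s + s^m) ≥ m s^(m+p-1). The
  -- last inequality for s ≤ 1 is where 2 ≤ m + p enters.
  refine ⟨1 + m + m / k, by positivity, fun P h hg => ?_⟩
  refine h.tendsto_zero_of_le (C := k) (D := 1) hm0 one_pos fun s hs _ => ?_
  have key := le_of_good (c := 1 + m + m / k) H (P := P) (Q := fun s => k * s ^ m + 1 * s + 0)
    h.pos (fun s hs => by positivity) h.hasDerivAt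
    (fun s _ => hasDerivAt_upperBarrier hm k 1 0 s) (fun _ _ => le_rfl)
    (fun s hs => ?_) hg ⟨1, 1, one_pos, one_pos, fun s hs => ?_⟩ hs
  · simpa using key
  · refine upperBarrier_le H one_pos le_rfl hs ?_
    have hQ : 0 < k * s ^ m + 1 * s + 0 := by positivity
    rw [le_div_iff₀ hQ]
    have e1 : s ^ (m - 1) * s = s ^ m := rpow_sub_one_mul hs m
    have e2 : s ^ (m - 1) * s ^ p ≤ s + s ^ m := by
      rw [← Real.rpow_add hs]
      rcases le_total s 1 with h1 | h1
      · have : s ^ (m - 1 + p) ≤ s ^ (1 : ℝ) :=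
          Real.rpow_le_rpow_of_exponent_ge hs h1 (by linarith)
        rw [Real.rpow_one] at this
        have : 0 ≤ s ^ m := by positivity
        linarith
      · have : s ^ (m - 1 + p) ≤ s ^ m := Real.rpow_le_rpow_of_exponent_le h1 (by linarith)
        linarith
    have e3 : m * (s ^ (m - 1) * s ^ p) ≤ m * (s + s ^ m) := by gcongr
    have e4 : (m + m / k) * (k * s ^ m + s) = m * k * s ^ m + m * s + m * s ^ m + m / k * s := by
      field_simp
      ring
    have e5 : 0 ≤ m * s ^ (m - 1) * (l * s) := by positivity
    have e6 : 0 ≤ m * k * s ^ m + m / k * s := by positivity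
    have e7 : (1 - (1 + m + m / k)) * (k * s ^ m + 1 * s + 0)
        = - ((m + m / k) * (k * s ^ m + s)) := by ring
    rw [e7, e4]
    have e8 : m * s ^ (m - 1) * (l * (1 * s + 0) - s ^ p)
        = m * s ^ (m - 1) * (l * s) - m * (s ^ (m - 1) * s ^ p) := by ring
    rw [e8]
    linarith
  · have hs0 : 0 < s := by linarith
    simp [abs_of_pos hs0]

/-- Good orbits depend continuously on the speed, along monotone sequences of speeds. -/
theorem tendsto_speed (H : Admissible m p k l) {P : ℕ → ℝ → ℝ} {cn : ℕ → ℝ} {Plo Phi : ℝ → ℝ}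
    {chi clo : ℝ} (hc : Tendsto cn atTop (𝓝 c)) (hP : ∀ n, IsOrbit m p k l (cn n) (P n))
    (gP : ∀ n, IsGoodAtInfinity m k (P n)) (hlo : IsOrbit m p k l chi Plo)
    (glo : IsGoodAtInfinity m k Plo) (hhi : IsOrbit m p k l clo Phi)
    (ghi : IsGoodAtInfinity m k Phi) (hcn : ∀ n, clo ≤ cn n ∧ cn n ≤ chi)
    (hmono : Monotone cn ∨ Antitone cn) (hQ : IsOrbit m p k l c Q)
    (gQ : IsGoodAtInfinity m k Q) {s : ℝ} (hs : 0 < s) :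
    Tendsto (fun n => P n s) atTop (𝓝 (Q s)) := by
  -- `Plo` belongs to the largest speed `chi` and `Phi` to the smallest, `clo`; they enclose all the
  -- orbits and the limit.
  have hge : ∀ n s, 0 < s → Plo s ≤ P n s := fun n s hs =>
    antitone_speed H (hcn n).2 (hP n) hlo (gP n) glo hs
  have hle : ∀ n s, 0 < s → P n s ≤ Phi s := fun n s hs =>
    antitone_speed H (hcn n).1 hhi (hP n) ghi (gP n) hs
  have hconv : ∀ s, 0 < s → ∃ L, Tendsto (fun n => P n s) atTop (𝓝 L) := fun s hs => by
    rcases hmono with hmono | hmono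
    · exact ⟨_, tendsto_atTop_ciInf
        (fun i j hij => antitone_speed H (hmono hij) (hP i) (hP j) (gP i) (gP j) hs)
        ⟨Plo s, by rintro _ ⟨n, rfl⟩; exact hge n s hs⟩⟩
    · exact ⟨_, tendsto_atTop_ciSup
        (fun i j hij => antitone_speed H (hmono hij) (hP j) (hP i) (gP j) (gP i) hs)
        ⟨Phi s, by rintro _ ⟨n, rfl⟩; exact hle n s hs⟩⟩
  choose! R hR using hconv
  have hRlo : ∀ s, 0 < s → Plo s ≤ R s := fun s hs =>
    ge_of_tendsto (hR s hs) (Eventually.of_forall fun n => hge n s hs)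
  have hRhi : ∀ s, 0 < s → R s ≤ Phi s := fun s hs =>
    le_of_tendsto (hR s hs) (Eventually.of_forall fun n => hle n s hs)
  have oR : IsOrbit m p k l c R := ⟨fun s hs => (hlo.pos s hs).trans_le (hRlo s hs), fun s hs =>
    hasDerivAt_of_tendsto_orbits hc
      (fun s hs => (hlo.hasDerivAt s hs).continuousAt.continuousWithinAt) hlo.pos
      (fun s₀ s₁ h0 => Eventually.of_forall fun n s hs =>
        ⟨(hP n).hasDerivAt s (h0.trans_le hs.1), hge n s (h0.trans_le hs.1)⟩) hR hs⟩
  have gR : IsGoodAtInfinity m k R := by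
    obtain ⟨α₁, S₁, hα₁, hS₁, h₁⟩ := glo
    obtain ⟨α₂, S₂, hα₂, hS₂, h₂⟩ := ghi
    refine ⟨α₁ + α₂, max S₁ S₂, by positivity, by positivity, fun s hs => ?_⟩
    have hs0 : 0 < s := lt_of_lt_of_le (by positivity) hs
    have e1 := (abs_le.1 (h₁ s ((le_max_left _ _).trans hs))).1
    have e2 := (abs_le.1 (h₂ s ((le_max_right _ _).trans hs))).2
    have e3 := hRlo s hs0
    have e4 := hRhi s hs0
    have e5 : 0 ≤ α₁ * s := by positivity
    have e6 : 0 ≤ α₂ * s := by positivity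
    rw [abs_le]
    constructor <;> linarith
  -- The limit is a good orbit of speed c, and there is only one.
  rw [unique H hQ oR gQ gR hs]
  exact hR s hs

end IsOrbit

end nearZero

/-- The critical speed is the infimum of the speeds whose good orbit reaches the origin. That set is
upward closed because orbits decrease with the speed. -/
theorem exists_critical_speed {m p k l : ℝ} (H : Admissible m p k l) (hmp : 2 ≤ m + p) :
    ∃ cs, 0 < cs ∧
      (∀ (c : ℝ) (P : ℝ → ℝ), 0 < c → IsOrbit m p k l c P → IsGoodAtInfinity m k P →
        (Tendsto P (𝓝[>] 0) (𝓝 0) ↔ cs ≤ c)) ∧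
      (2 < m + p →
        (∀ P : ℝ → ℝ, IsOrbit m p k l cs P → IsGoodAtInfinity m k P →
          Tendsto (fun s => P s / s) (𝓝[>] 0) (𝓝 cs)) ∧
        (∀ (c : ℝ) (P : ℝ → ℝ), cs < c → IsOrbit m p k l c P → IsGoodAtInfinity m k P →
          Tendsto (fun s => P s / s ^ (m + p - 1)) (𝓝[>] 0) (𝓝 (m / c)))) := by
  have hm0 : 0 < m := by linarith [H.one_lt]
  choose! F hF gF _ using fun (c : ℝ) (hc : 0 < c) => exists_good_orbit (c := c) H hc
  obtain ⟨c₀, hc₀, hlow⟩ := IsOrbit.exists_speed_lower_bound H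
  obtain ⟨c₁, hc₁, hup⟩ := IsOrbit.exists_speed_upper_bound H hmp
  set C : Set ℝ := {c | 0 < c ∧ Tendsto (F c) (𝓝[>] 0) (𝓝 0)} with hC
  have hne : C.Nonempty := ⟨c₁, hc₁, hup _ (hF c₁ hc₁) (gF c₁ hc₁)⟩
  have hlb : ∀ c ∈ C, c₀ ≤ c := fun c hc => hlow c _ hc.1 (hF c hc.1) hc.2
  have hbdd : BddBelow C := ⟨c₀, hlb⟩
  have hupper : ∀ c ∈ C, ∀ c', c ≤ c' → c' ∈ C := fun c hc c' hcc => by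
    have hc' : 0 < c' := hc.1.trans_le hcc
    refine ⟨hc', (hF c' hc').tendsto_zero_of_le (C := k + l) (D := c) hm0 one_pos
      fun s hs _ => ?_⟩
    exact (IsOrbit.antitone_speed H hcc (hF c hc.1) (hF c' hc') (gF c hc.1) (gF c' hc') hs).trans
      ((hF c hc.1).flux_nonneg H hc.2 hs)
  set cs := sInf C with hcs
  have hcs0 : 0 < cs := hc₀.trans_le (le_csInf hne hlb)
  have habove : ∀ c, cs < c → c ∈ C := fun c hc => by
    obtain ⟨c', hc', hlt⟩ := exists_lt_of_csInf_lt hne hc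
    exact hupper c' hc' c hlt.le
  -- The bound holds for all speeds above `cs` and passes to the limit; it forces the orbit of speed
  -- `cs` into the origin, so the infimum is attained.
  have hflux : ∀ s, 0 < s → F cs s ≤ (k + l) * s ^ m + cs * s := fun s hs => by
    let cn : ℕ → ℝ := fun n => cs + 1 / ((n : ℝ) + 1)
    have hcn : Tendsto cn atTop (𝓝 cs) := by
      simpa [cn] using tendsto_one_div_add_atTop_nhds_zero_nat.const_add cs
    have hcnlt : ∀ n, cs < cn n := fun n => lt_add_of_pos_right _ (by positivity)
    have hcnle : ∀ n, cn n ≤ cs + 1 := fun n => by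
      have : 1 / ((n : ℝ) + 1) ≤ 1 := by
        rw [div_le_one₀ (by positivity)]; linarith [(Nat.cast_nonneg n : (0 : ℝ) ≤ n)]
      simp only [cn]; linarith
    have hcnC : ∀ n, cn n ∈ C := fun n => habove _ (hcnlt n)
    have hanti : Antitone cn := fun i j hij => by
      have : (i : ℝ) ≤ j := by exact_mod_cast hij
      simp only [cn]
      gcongr
    have hlim := IsOrbit.tendsto_speed H (P := fun n => F (cn n)) hcn
      (fun n => hF _ (hcnC n).1) (fun n => gF _ (hcnC n).1)
      (hF (cs + 1) (by positivity)) (gF (cs + 1) (by positivity)) (hF cs hcs0) (gF cs hcs0)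
      (fun n => ⟨(hcnlt n).le, hcnle n⟩) (Or.inr hanti) (hF cs hcs0) (gF cs hcs0) hs
    refine le_of_tendsto_of_tendsto' hlim ((hcn.mul_const s).const_add ((k + l) * s ^ m))
      fun n => (hF _ (hcnC n).1).flux_nonneg H (hcnC n).2 hs
  have hcsC : cs ∈ C := ⟨hcs0, (hF cs hcs0).tendsto_zero_of_le hm0 one_pos
    fun s hs _ => hflux s hs⟩
  have hmem : ∀ (c : ℝ) (P : ℝ → ℝ), 0 < c → IsOrbit m p k l c P → IsGoodAtInfinity m k P →
      (Tendsto P (𝓝[>] 0) (𝓝 0) ↔ cs ≤ c) := fun c P hc hP gP => by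
    have heq : P =ᶠ[𝓝[>] 0] F c := eventually_of_forall_Ioc one_pos fun s hs _ =>
      IsOrbit.unique H hP (hF c hc) gP (gF c hc) hs
    rw [tendsto_congr' heq]
    exact ⟨fun h => csInf_le hbdd ⟨hc, h⟩, fun h => (hupper cs hcsC c h).2⟩
  refine ⟨cs, hcs0, hmem, fun hmp' => ⟨fun P hP gP => ?_, fun c P hc hP gP => ?_⟩⟩
  · have hP0 := (hmem cs P hcs0 hP gP).2 le_rfl
    rcases IsOrbit.linear_le_or_exists_lt P with ⟨η, s₂, hη, hs₂, hle⟩ | hlt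
    · exact hP.tendsto_div_of_linear_le H hmp' hP0 hη hs₂ hle
    · exfalso
      -- For speeds at least cs/2 the field on the line ηs exceeds η = cs/3 near the origin, so an
      -- orbit below the line at s₁ stays below it down to the origin. By continuity this holds for
      -- some speed less than `cs`, a contradiction.
      set η := cs / 3 with hη
      have hη0 : 0 < η := by positivity
      obtain ⟨s₀, hs₀, h₀⟩ := exists_forall_Ioc_of_eventually
        ((tendsto_slopeField_line (k := k) (l := l) H.one_lt hmp' hη0).eventually_const_lt
          (show η - cs / 2 < 0 by linarith))
      obtain ⟨s₁, hs₁, hs₁', hPs⟩ := hlt η hη0 s₀ hs₀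
      let cn : ℕ → ℝ := fun n => cs - cs / 2 * (1 / ((n : ℝ) + 1))
      have hcn : Tendsto cn atTop (𝓝 cs) := by
        simpa [cn] using (tendsto_one_div_add_atTop_nhds_zero_nat.const_mul (cs / 2)).const_sub cs
      have hpos : ∀ n : ℕ, 0 < 1 / ((n : ℝ) + 1) := fun n => by positivity
      have hle1 : ∀ n : ℕ, 1 / ((n : ℝ) + 1) ≤ 1 := fun n => by
        rw [div_le_one₀ (by positivity)]; linarith [(Nat.cast_nonneg n : (0 : ℝ) ≤ n)]
      have hcnlt : ∀ n, cn n < cs := fun n => by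
        have := mul_pos (half_pos hcs0) (hpos n)
        simp only [cn]; linarith
      have hcnge : ∀ n, cs / 2 ≤ cn n := fun n => by
        have := mul_le_mul_of_nonneg_left (hle1 n) (half_pos hcs0).le
        simp only [cn]; linarith
      have hcn0 : ∀ n, 0 < cn n := fun n => (half_pos hcs0).trans_le (hcnge n)
      have hmono : Monotone cn := fun i j hij => by
        have : (i : ℝ) ≤ j := by exact_mod_cast hij
        simp only [cn]
        gcongr
      have hlim := IsOrbit.tendsto_speed H (P := fun n => F (cn n)) hcn
        (fun n => hF _ (hcn0 n)) (fun n => gF _ (hcn0 n)) (hF cs hcs0) (gF cs hcs0)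
        (hF (cs / 2) (half_pos hcs0)) (gF (cs / 2) (half_pos hcs0))
        (fun n => ⟨hcnge n, (hcnlt n).le⟩) (Or.inl hmono) hP gP hs₁
      obtain ⟨n, hn⟩ := (hlim.eventually_lt_const hPs).exists
      have hC' : cn n ∈ C := by
        refine ⟨hcn0 n, (hF _ (hcn0 n)).tendsto_zero_of_le (C := 0) (D := η) hm0 hs₁
          fun s hs hss => ?_⟩
        rw [zero_mul, zero_add]
        refine (hF _ (hcn0 n)).le_of_le_right H (Q := fun s => η * s) (Q' := fun _ => η)
          (fun s hs => by positivity)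
          (fun s _ => by simpa using (hasDerivAt_id s).const_mul η) (fun t ht hts => ?_) hn.le
          hs hss
        have e1 := h₀ t ht (hts.trans hs₁')
        have e2 := hcnge n
        rw [slopeField_eq_add]
        linarith
      exact absurd (csInf_le hbdd hC') (not_le.2 (hcnlt n))
  · have hc0 : 0 < c := hcs0.trans hc
    have hP0 := (hmem c P hc0 hP gP).2 hc.le
    rcases IsOrbit.linear_le_or_exists_lt P with ⟨η, s₂, hη, hs₂, hle⟩ | hlt
    -- A linear orbit would have slope c at the origin, but it lies below the critical orbit, whose
    -- flux bound only allows the slope cs < c.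
    · exfalso
      have h1 := hP.tendsto_div_of_linear_le H hmp' hP0 hη hs₂ hle
      have h2 : Tendsto (fun s : ℝ => (k + l) * s ^ (m - 1) + cs) (𝓝[>] 0)
          (𝓝 ((k + l) * 0 + cs)) :=
        ((tendsto_rpow_nhdsGT_zero (by linarith [H.one_lt])).const_mul _).add_const cs
      have h3 : c ≤ (k + l) * 0 + cs := by
        refine le_of_tendsto_of_tendsto h1 h2
          (eventually_of_forall_Ioc one_pos fun s hs _ => ?_)
        rw [div_le_iff₀ hs, add_mul, mul_assoc, rpow_sub_one_mul hs]
        exact (IsOrbit.antitone_speed H hc.le (hF cs hcs0) hP (gF cs hcs0) gP hs).trans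
          (hflux s hs)
      linarith
    · exact hP.tendsto_div_rpow_of_exists_lt H hmp' hc0 hP0 hlt

/-! ### From good waves to orbits -/

/-- The larger decay rate `2m/(m-1)`: `-rootK m` is the characteristic root selected by regularity
at the origin. -/
def rootK (m : ℝ) : ℝ := 2 * m / (m - 1)

/-- The other characteristic root is `-rootL m N`. -/
def rootL (m N : ℝ) : ℝ := N + 2 / (m - 1)

theorem convCoeff_eq {m : ℝ} (hm : 1 < m) (N : ℝ) : convCoeff m N = rootK m + rootL m N := by
  have : m - 1 ≠ 0 := by linarith
  unfold convCoeff rootK rootL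
  field_simp
  ring

theorem reactCoeff_eq {m : ℝ} (hm : 1 < m) (N : ℝ) : reactCoeff m N = rootK m * rootL m N := by
  have : m - 1 ≠ 0 := by linarith
  unfold reactCoeff rootK rootL
  field_simp

/-- The gap ml - k equals mN, so k < ml is the positivity of N. -/
theorem admissible_roots {m p N : ℝ} (hm : 1 < m) (hp0 : 0 < p) (hp1 : p < 1) (hN : 0 < N) :
    Admissible m p (rootK m) (rootL m N) := by
  have h1 : 0 < m - 1 := by linarith
  refine ⟨hm, hp0, hp1, by unfold rootK; positivity, by unfold rootL; positivity, ?_⟩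
  have : m * rootL m N - rootK m = m * N := by
    unfold rootK rootL
    field_simp
    ring
  have : 0 < m * N := by positivity
  linarith

theorem tendsto_nhdsGT_zero_iff_comp_exp {G : ℝ → ℝ} {L : Filter ℝ} :
    Tendsto G (𝓝[>] 0) L ↔ Tendsto (fun y => G (Real.exp y)) atBot L := by
  rw [← Real.map_exp_atBot, tendsto_map'_iff]
  rfl

theorem radialProfile_exp (m : ℝ) (f : ℝ → ℝ) (y : ℝ) :
    radialProfile m f (Real.exp y) = Real.exp (2 / (m - 1) * y) * f y := by
  rw [radialProfile, Real.log_exp, ← Real.exp_mul, mul_comm y]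

theorem hasDerivAt_radialProfile {m f' y : ℝ} {f : ℝ → ℝ} (h : HasDerivAt f f' y) :
    HasDerivAt (radialProfile m f)
      (Real.exp ((2 / (m - 1) - 1) * y) * (2 / (m - 1) * f y + f')) (Real.exp y) := by
  have h1 : HasDerivAt (fun ξ : ℝ => ξ ^ (2 / (m - 1)))
      (2 / (m - 1) * Real.exp y ^ (2 / (m - 1) - 1)) (Real.exp y) :=
    Real.hasDerivAt_rpow_const (Or.inl (Real.exp_pos y).ne')
  have h2 : HasDerivAt (fun ξ => f (Real.log ξ)) (f' * (Real.exp y)⁻¹) (Real.exp y) :=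
    HasDerivAt.comp (Real.exp y) (by rwa [Real.log_exp])
      (Real.hasDerivAt_log (Real.exp_pos y).ne')
  refine (h1.mul h2).congr_deriv ?_
  rw [Real.log_exp, ← Real.exp_mul, ← Real.exp_mul, ← Real.exp_neg, mul_comm y, mul_comm y,
    show 2 / (m - 1) * y = (2 / (m - 1) - 1) * y + y by ring, Real.exp_add]
  have : Real.exp y * Real.exp (-y) = 1 := by rw [← Real.exp_add]; simp
  linear_combination (Real.exp ((2 / (m - 1) - 1) * y) * f') * this

/-- The flux of the radial profile through small spheres, in logarithmic variables. -/
theorem radial_flux_eq {m N y f' : ℝ} (hm : 1 < m) {f : ℝ → ℝ} (hf : 0 < f y)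
    (h : HasDerivAt f f' y) :
    m * (Real.exp (2 / (m - 1) * y) * f y) ^ (m - 1) *
      (Real.exp y ^ (N - 1) * deriv (radialProfile m f) (Real.exp y))
      = Real.exp (rootL m N * y) * (rootK m * f y ^ m + m * f y ^ (m - 1) * f') := by
  have hm1 : m - 1 ≠ 0 := by linarith
  rw [(hasDerivAt_radialProfile h).deriv, Real.mul_rpow (Real.exp_pos _).le hf.le,
    ← Real.exp_mul, ← Real.exp_mul, ← rpow_sub_one_mul hf m]
  have e : Real.exp (rootL m N * y) = Real.exp (2 / (m - 1) * y * (m - 1))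
      * Real.exp (y * (N - 1)) * Real.exp ((2 / (m - 1) - 1) * y) := by
    rw [← Real.exp_add, ← Real.exp_add]
    congr 1
    unfold rootL
    field_simp
    ring
  have e2 : rootK m = m * (2 / (m - 1)) := by unfold rootK; ring
  rw [e, e2]
  ring

theorem nonneg_of_hasDerivAt_nonneg_of_tendsto_atBot {u u' : ℝ → ℝ} {Y : ℝ}
    (hd : ∀ y, y ≤ Y → HasDerivAt u (u' y) y) (h : ∀ y, y ≤ Y → 0 ≤ u' y)
    (h0 : Tendsto u atBot (𝓝 0)) {y : ℝ} (hy : y ≤ Y) : 0 ≤ u y := by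
  refine le_of_tendsto h0 ?_
  filter_upwards [eventually_le_atBot y] with x hx
  exact le_of_hasDerivAt_nonneg hx
    (fun t ht => (hd t (ht.2.trans hy)).continuousAt.continuousWithinAt)
    (fun t ht => hd t (ht.2.le.trans hy)) (fun t ht => h t (ht.2.le.trans hy))

theorem tendsto_exp_mul_atBot {r : ℝ} (hr : 0 < r) :
    Tendsto (fun y : ℝ => Real.exp (r * y)) atBot (𝓝 0) :=
  Real.tendsto_exp_atBot.comp ((tendsto_const_mul_atBot_of_pos hr).2 tendsto_id)

namespace IsProfile

variable {m p N c A : ℝ} {f Φ : ℝ → ℝ} {y₀ : ℝ}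

/-- A nonnegative slope at y forces positive slopes to the left, so f would be bounded near -∞,
whereas goodness requires growth like e^(-2y/(m-1)). -/
theorem slope_neg (h : IsProfile m p (rootK m + rootL m N) (rootK m * rootL m N) c f Φ)
    (H : Admissible m p (rootK m) (rootL m N)) (hI : HasInterfaceAt f y₀) (hA : 0 < A)
    (hlim : Tendsto (fun y => Real.exp (2 / (m - 1) * y) * f y) atBot (𝓝 A)) {y : ℝ}
    (hy : y < y₀) : Φ y - (rootK m + rootL m N) * f y ^ m - c * f y < 0 := by
  have hm := H.one_lt
  have hm0 : 0 < m := by linarith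
  have hb : 0 < rootK m * rootL m N := mul_pos H.k_pos H.l_pos
  by_contra hcon
  have hpos : ∀ z, z < y → 0 < Φ z - (rootK m + rootL m N) * f z ^ m - c * f z := fun z hz => by
    by_contra hle
    exact hcon (h.slope_neg_of_lt hm0 hb hz (fun t ht => hI.1 t (ht.2.trans_lt hy))
      (not_lt.1 hle))
  have hle : ∀ z, z < y → f z ≤ f y := fun z hz => by
    have := le_of_hasDerivAt_nonneg (u := fun y => f y ^ m) hz.le h.continuous_pow.continuousOn
      (fun t _ => h.hasDerivAt_pow t) (fun t ht => (hpos t ht.2).le)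
    exact (Real.rpow_le_rpow_iff (h.nonneg _) (h.nonneg _) hm0).1 this
  have hq : 0 < 2 / (m - 1) := div_pos two_pos (by linarith)
  have h0 : Tendsto (fun z : ℝ => Real.exp (2 / (m - 1) * z) * f y) atBot (𝓝 (0 * f y)) :=
    (tendsto_exp_mul_atBot hq).mul_const _
  have : A ≤ 0 * f y := by
    refine le_of_tendsto_of_tendsto hlim h0 ?_
    filter_upwards [eventually_lt_atBot y] with z hz
    have := hle z hz
    gcongr
  linarith

/-- Near `-∞` a good profile satisfies `(f^m)' = -rootK m * f^m + O(f)`. -/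
theorem exists_slope_bound
    (h : IsProfile m p (rootK m + rootL m N) (rootK m * rootL m N) c f Φ)
    (H : Admissible m p (rootK m) (rootL m N)) (hN : 0 < N) (hc : 0 < c)
    (hI : HasInterfaceAt f y₀) (hA : 0 < A)
    (hlim : Tendsto (fun y => Real.exp (2 / (m - 1) * y) * f y) atBot (𝓝 A))
    (hflux : Tendsto (fun ξ => ξ ^ (N - 1) * deriv (radialProfile m f) ξ) (𝓝[>] 0) (𝓝 0)) :
    ∃ α y₁, 0 < α ∧ y₁ < y₀ ∧ ∀ y, y ≤ y₁ →
      |rootK m * f y ^ m + (Φ y - (rootK m + rootL m N) * f y ^ m - c * f y)| ≤ α * f y := by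
  have hm := H.one_lt
  have hm0 : 0 < m := by linarith
  have hl := H.l_pos
  set q := 2 / (m - 1) with hq
  have hq0 : 0 < q := div_pos two_pos (by linarith)
  set l := rootL m N with hldef
  set k := rootK m with hkdef
  have hlq : l = N + q := rfl
  have hefl : ∀ y, Real.exp (l * y) * f y = Real.exp (N * y) * (Real.exp (q * y) * f y) :=
    fun y => by rw [hlq, add_mul, Real.exp_add]; ring
  have h1 : Tendsto (fun y => Real.exp (l * y) * f y) atBot (𝓝 (0 * A)) := by
    simp only [hefl]
    exact (tendsto_exp_mul_atBot hN).mul hlim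
  have h2 : Tendsto (fun y => Real.exp (l * y) * (k * f y ^ m
      + (Φ y - (k + l) * f y ^ m - c * f y))) atBot (𝓝 (m * A ^ (m - 1) * 0)) := by
    have e1 := ((hlim.rpow_const (p := m - 1) (Or.inl hA.ne')).const_mul m).mul
      (tendsto_nhdsGT_zero_iff_comp_exp.1 hflux)
    refine e1.congr' ?_
    filter_upwards [eventually_lt_atBot y₀] with y hy
    have hfy := hI.1 y hy
    rw [radial_flux_eq hm hfy (h.hasDerivAt hm0 hfy)]
    congr 2
    field_simp
  -- e^(ly) (Φ - l f^m) vanishes at -∞ precisely by the condition of no flux through the origin. The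
  -- factor e^(ly) cancels the terms in f^m in its derivative, leaving l c f - f^p.
  have hE0 : Tendsto (fun y => Real.exp (l * y) * (Φ y - l * f y ^ m)) atBot (𝓝 0) := by
    have := h2.add (h1.const_mul c)
    simp only [zero_mul, mul_zero, add_zero] at this
    refine this.congr fun y => ?_
    ring
  have hE : ∀ y, HasDerivAt (fun y => Real.exp (l * y) * (Φ y - l * f y ^ m))
      (Real.exp (l * y) * (l * c * f y - f y ^ p)) y := fun y => by
    have e1 : HasDerivAt (fun y => Real.exp (l * y)) (Real.exp (l * y) * l) y := by
      simpa using ((hasDerivAt_id y).const_mul l).exp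
    refine (e1.mul ((h.hasDerivAt_flux y).sub ((h.hasDerivAt_pow y).const_mul l))).congr_deriv ?_
    simp only [Pi.sub_apply]
    ring
  have hev : ∀ᶠ y in atBot, Real.exp (q * y) * f y < A + 1 ∧ A / 2 < Real.exp (q * y) * f y ∧
      Real.exp (q * y) < A / 2 ∧ y < y₀ := by
    filter_upwards [hlim.eventually_lt_const (show A < A + 1 by linarith),
      hlim.eventually_const_lt (show A / 2 < A by linarith),
      (tendsto_exp_mul_atBot hq0).eventually_lt_const (half_pos hA),
      eventually_lt_atBot y₀] with y e1 e2 e3 e4 using ⟨e1, e2, e3, e4⟩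
  obtain ⟨y₁, hy₁⟩ := eventually_atBot.1 hev
  set C := (l * c + 1) * (A + 1) with hC
  have hC0 : 0 < C := by positivity
  -- As e^(ly) f = e^(Ny) · e^(qy) f with the last factor bounded, the derivative is O(e^(Ny)). This
  -- is integrable at -∞, and e^(Ny) is in turn O(e^(ly) f).
  have hE' : ∀ y, y ≤ y₁ → |Real.exp (l * y) * (l * c * f y - f y ^ p)| ≤ C * Real.exp (N * y) :=
    fun y hy => by
      obtain ⟨e1, e2, e3, e4⟩ := hy₁ y hy
      have hfy := hI.1 y e4
      have hf1 : 1 ≤ f y := by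
        by_contra hlt
        push Not at hlt
        have : Real.exp (q * y) * f y < Real.exp (q * y) * 1 := by gcongr
        linarith
      have hfp : f y ^ p ≤ f y := by
        have := Real.rpow_le_rpow_of_exponent_le hf1 H.p_lt.le
        simpa using this
      have hfp0 : 0 ≤ f y ^ p := by positivity
      have e5 : |l * c * f y - f y ^ p| ≤ (l * c + 1) * f y := by
        have : 0 ≤ l * c * f y := by positivity
        rw [abs_le]
        constructor <;> linarith
      rw [abs_mul, abs_of_pos (Real.exp_pos _)]
      calc Real.exp (l * y) * |l * c * f y - f y ^ p|
          ≤ Real.exp (l * y) * ((l * c + 1) * f y) := by gcongr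
        _ = (l * c + 1) * (Real.exp (N * y) * (Real.exp (q * y) * f y)) := by
          rw [← hefl]; ring
        _ ≤ (l * c + 1) * (Real.exp (N * y) * (A + 1)) := by gcongr
        _ = C * Real.exp (N * y) := by rw [hC]; ring
  have hexp : ∀ y, HasDerivAt (fun y => C / N * Real.exp (N * y)) (C * Real.exp (N * y)) y :=
    fun y => by
      have e1 : HasDerivAt (fun y => Real.exp (N * y)) (Real.exp (N * y) * N) y := by
        simpa using ((hasDerivAt_id y).const_mul N).exp
      refine (e1.const_mul (C / N)).congr_deriv ?_
      field_simp
  have hexp0 : Tendsto (fun y : ℝ => C / N * Real.exp (N * y)) atBot (𝓝 0) := by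
    simpa using (tendsto_exp_mul_atBot hN).const_mul (C / N)
  have hEb : ∀ y, y ≤ y₁ →
      |Real.exp (l * y) * (Φ y - l * f y ^ m)| ≤ C / N * Real.exp (N * y) := fun y hy => by
    have e1 := nonneg_of_hasDerivAt_nonneg_of_tendsto_atBot (Y := y₁)
      (fun y _ => (hexp y).sub (hE y))
      (fun y hy => by have := (abs_le.1 (hE' y hy)).2; linarith)
      (by simpa using! hexp0.sub hE0) hy
    have e2 := nonneg_of_hasDerivAt_nonneg_of_tendsto_atBot (Y := y₁)
      (fun y _ => (hexp y).add (hE y))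
      (fun y hy => by have := (abs_le.1 (hE' y hy)).1; linarith)
      (by simpa using! hexp0.add hE0) hy
    simp only [Pi.sub_apply, Pi.add_apply] at e1 e2
    rw [abs_le]
    constructor <;> linarith
  refine ⟨C / N * (2 / A) + c, y₁, by positivity, (hy₁ y₁ le_rfl).2.2.2, fun y hy => ?_⟩
  obtain ⟨-, e2, -, e4⟩ := hy₁ y hy
  have hfy := hI.1 y e4
  have e5 : Real.exp (N * y) ≤ 2 / A * (Real.exp (l * y) * f y) := by
    rw [hefl]
    have : 1 ≤ 2 / A * (Real.exp (q * y) * f y) := by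
      rw [div_mul_eq_mul_div, le_div_iff₀ hA]; linarith
    have := mul_le_mul_of_nonneg_left this (Real.exp_pos (N * y)).le
    linarith
  have e6 : |Φ y - l * f y ^ m| ≤ C / N * (2 / A) * f y := by
    have e7 := hEb y hy
    rw [abs_mul, abs_of_pos (Real.exp_pos _)] at e7
    refine le_of_mul_le_mul_left (e7.trans ?_) (Real.exp_pos (l * y))
    calc C / N * Real.exp (N * y) ≤ C / N * (2 / A * (Real.exp (l * y) * f y)) := by gcongr
      _ = _ := by ring
  have e8 : k * f y ^ m + (Φ y - (k + l) * f y ^ m - c * f y)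
      = (Φ y - l * f y ^ m) - c * f y := by ring
  rw [e8, add_mul]
  refine (abs_sub _ _).trans ?_
  rw [abs_of_pos (show 0 < c * f y by positivity)]
  linarith

/-- A good profile is an orbit in the variables `f`, `-(f^m)'`. -/
theorem exists_orbit
    (h : IsProfile m p (rootK m + rootL m N) (rootK m * rootL m N) c f Φ)
    (H : Admissible m p (rootK m) (rootL m N)) (hN : 0 < N) (hc : 0 < c)
    (hI : HasInterfaceAt f y₀) (hR : RegularAtOrigin m N f) :
    ∃ P : ℝ → ℝ, IsOrbit m p (rootK m) (rootL m N) c P ∧ IsGoodAtInfinity m (rootK m) P ∧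
      Tendsto P (𝓝[>] 0) (𝓝 0) ∧
      ∀ y, y < y₀ → HasDerivAt f (-P (f y) / (m * f y ^ (m - 1))) y := by
  have hm := H.one_lt
  have hm0 : 0 < m := by linarith
  have hb : 0 < rootK m * rootL m N := mul_pos H.k_pos H.l_pos
  obtain ⟨⟨A, hA, hFA⟩, -, hflux⟩ := hR
  have hlim : Tendsto (fun y => Real.exp (2 / (m - 1) * y) * f y) atBot (𝓝 A) := by
    have := tendsto_nhdsGT_zero_iff_comp_exp.1 hFA
    simpa only [radialProfile_exp] using this
  have hS := fun y hy => h.slope_neg H hI hA hlim (y := y) hy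
  obtain ⟨α, y₁, hα, hy₁, hbd⟩ := h.exists_slope_bound H hN hc hI hA hlim hflux
  have hlt : ∀ y z, y < z → z < y₀ → f z < f y := fun y z hyz hz => by
    have := lt_of_hasDerivAt_neg hyz h.continuous_pow.continuousOn
      (fun t _ => h.hasDerivAt_pow t) (fun t ht => hS t (ht.2.trans hz))
    exact (Real.rpow_lt_rpow_iff (h.nonneg _) (h.nonneg _) hm0).1 this
  have hq : 0 < 2 / (m - 1) := div_pos two_pos (by linarith)
  have hinf : ∀ s : ℝ, 0 < s → ∃ y, y < y₀ ∧ s < f y := fun s hs => by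
    by_contra hcon
    push Not at hcon
    have h0 : Tendsto (fun z : ℝ => Real.exp (2 / (m - 1) * z) * s) atBot (𝓝 (0 * s)) :=
      (tendsto_exp_mul_atBot hq).mul_const _
    have : A ≤ 0 * s := by
      refine le_of_tendsto_of_tendsto hlim h0 ?_
      filter_upwards [eventually_lt_atBot y₀] with z hz
      have := hcon z hz
      gcongr
    linarith
  have hsurj : ∀ s : ℝ, 0 < s → ∃ y, y < y₀ ∧ f y = s := fun s hs => by
    obtain ⟨y, hy, hys⟩ := hinf s hs
    obtain ⟨z, hz, hzs⟩ := intermediate_value_Icc' hy.le h.cont.continuousOn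
      (show s ∈ Set.Icc (f y₀) (f y) by rw [hI.2 y₀ le_rfl]; exact ⟨hs.le, hys.le⟩)
    refine ⟨z, lt_of_le_of_ne hz.2 fun he => ?_, hzs⟩
    rw [he, hI.2 y₀ le_rfl] at hzs
    linarith
  choose! Z hZ hfZ using hsurj
  have hZanti : ∀ s t, 0 < s → s < t → Z t < Z s := fun s t hs hst => by
    by_contra hle
    rcases (not_lt.1 hle).eq_or_lt with he | hl
    · have h1 := hfZ s hs
      rw [he, hfZ t (hs.trans hst)] at h1
      linarith
    · have := hlt _ _ hl (hZ t (hs.trans hst))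
      rw [hfZ s hs, hfZ t (hs.trans hst)] at this
      linarith
  have hZf : ∀ y, y < y₀ → Z (f y) = y := fun y hy => by
    have hfy := hI.1 y hy
    rcases lt_trichotomy (Z (f y)) y with hl | he | hl
    · have := hlt _ _ hl hy
      rw [hfZ _ hfy] at this
      exact absurd this (lt_irrefl _)
    · exact he
    · have := hlt _ _ hl (hZ _ hfy)
      rw [hfZ _ hfy] at this
      exact absurd this (lt_irrefl _)
  -- A monotone function whose image contains a neighbourhood of its value is continuous; this feeds
  -- the inverse function rule.
  have hZc : ∀ s, 0 < s → ContinuousAt Z s := fun s hs => by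
    have hmono : StrictMonoOn (fun s => - Z s) (Set.Ioi 0) := fun a ha b _ hab =>
      neg_lt_neg (hZanti a b ha hab)
    have himg : (fun s => - Z s) '' Set.Ioi 0 ∈ 𝓝 (- Z s) := by
      refine mem_of_superset (Ioi_mem_nhds (neg_lt_neg (hZ s hs))) fun x hx => ?_
      have hx' : -x < y₀ := by
        have : -y₀ < x := hx
        linarith
      exact ⟨f (-x), hI.1 _ hx', by simp [hZf _ hx']⟩
    have := (hmono.continuousAt_of_image_mem_nhds (Ioi_mem_nhds hs) himg).neg
    refine this.congr (Eventually.of_forall fun t => ?_)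
    simp
  set S : ℝ → ℝ := fun y => Φ y - (rootK m + rootL m N) * f y ^ m - c * f y with hSdef
  have hPpos : ∀ s, 0 < s → 0 < - S (Z s) := fun s hs => neg_pos.2 (hS _ (hZ s hs))
  have oP : IsOrbit m p (rootK m) (rootL m N) c (fun s => - S (Z s)) := by
    refine ⟨hPpos, fun s hs => ?_⟩
    have hfs : 0 < f (Z s) := by rw [hfZ s hs]; exact hs
    have hne : S (Z s) ≠ 0 := by have := hPpos s hs; linarith
    have d1 := h.hasDerivAt hm0 hfs
    have hsm : 0 < s ^ (m - 1) := by positivity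
    have d2 : HasDerivAt Z ((S (Z s) / (m * f (Z s) ^ (m - 1)))⁻¹) s := by
      refine HasDerivAt.of_local_left_inverse (hZc s hs) d1 ?_ ?_
      · exact div_ne_zero hne (by positivity)
      · filter_upwards [Ioi_mem_nhds hs] with t ht using hfZ t ht
    have d3 := (HasDerivAt.comp s (h.hasDerivAt_slope hm0 hfs) d2).neg
    refine d3.congr_deriv ?_
    change -((-(_ : ℝ) - _ * S (Z s) - c * (S (Z s) / _)) * _) = _
    unfold slopeField
    rw [hfZ s hs]
    field_simp
    ring
  refine ⟨fun s => - S (Z s), oP, ⟨α, f y₁, hα, hI.1 y₁ hy₁, fun s hs => ?_⟩, ?_,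
    fun y hy => ?_⟩
  · have hs0 := (hI.1 y₁ hy₁).trans_le hs
    have hle : Z s ≤ y₁ := by
      by_contra hcon
      have := hlt _ _ (not_le.1 hcon) (hZ s hs0)
      rw [hfZ s hs0] at this
      linarith
    have := hbd (Z s) hle
    rw [hfZ s hs0] at this
    rw [← abs_neg]
    refine le_trans (le_of_eq ?_) this
    congr 1
    simp only [hSdef, hfZ s hs0]
    ring
  · refine oP.tendsto_zero_of_le (C := rootK m + rootL m N) (D := c) hm0 one_pos fun s hs _ => ?_
    have := h.flux_pos hm0 hb hI (hZ s hs)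
    simp only [hSdef, hfZ s hs]
    linarith
  · refine (h.hasDerivAt hm0 (hI.1 y hy)).congr_deriv ?_
    simp only [hZf y hy, hSdef, neg_neg]

end IsProfile

/-! ### From orbits to waves -/

/-- `Y s` is the distance to the interface of the point where a wave with orbit `P` takes the
value `s`; `W` is the inverse function. Both are extended to negative arguments. -/
structure IsTravelTime (m : ℝ) (P Y W : ℝ → ℝ) : Prop where
  continuous : Continuous Y
  continuous_inv : Continuous W
  strictMono : StrictMono Y
  zero : Y 0 = 0
  inv_apply : ∀ s, W (Y s) = s
  apply_inv : ∀ y, Y (W y) = y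
  hasDerivAt : ∀ s, 0 < s → HasDerivAt Y (m * s ^ (m - 1) / P s) s

/-- Y integrates dy = m s^(m-1)/P ds. The lower bound on P makes the integrand O(s^(-p)), integrable
at 0, so the interface is at finite distance; P = O(s^m) at infinity makes Y diverge
logarithmically. -/
theorem exists_isTravelTime {m p k l c δ : ℝ} (H : Admissible m p k l) {P : ℝ → ℝ}
    (h : IsOrbit m p k l c P) (hg : IsGoodAtInfinity m k P) (hδ : 0 < δ)
    (hP : ∀ s, 0 < s → δ * s ^ (m + p - 1) ≤ P s) : ∃ Y W, IsTravelTime m P Y W := by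
  have hm := H.one_lt
  have hm0 : 0 < m := by linarith
  -- The value 1 for t ≤ 0 makes Y the identity there, hence a bijection of ℝ with a global inverse.
  set J : ℝ → ℝ := fun t => if t ≤ 0 then 1 else m * t ^ (m - 1) / P t with hJ
  have hJle : ∀ t, t ≤ 0 → J t = 1 := fun t ht => by simp [hJ, ht]
  have hJgt : ∀ t, 0 < t → J t = m * t ^ (m - 1) / P t := fun t ht => by
    simp [hJ, not_le.2 ht]
  have hJpos : ∀ t, 0 < J t := fun t => by
    rcases le_or_gt t 0 with ht | ht
    · rw [hJle t ht]; exact one_pos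
    · rw [hJgt t ht]
      have := h.pos t ht
      positivity
  have hJc : ∀ t, t ≠ 0 → ContinuousAt J t := fun t ht => by
    rcases ht.lt_or_gt with ht | ht
    · refine (continuousAt_const (y := (1 : ℝ))).congr ?_
      filter_upwards [Iio_mem_nhds ht] with x hx using (hJle x (le_of_lt hx)).symm
    · have : ContinuousAt (fun t => m * t ^ (m - 1) / P t) t :=
        (continuousAt_const.mul (Real.continuousAt_rpow_const _ _ (Or.inl ht.ne'))).div
          (h.hasDerivAt t ht).continuousAt (h.pos t ht).ne'
      refine this.congr ?_
      filter_upwards [Ioi_mem_nhds ht] with x hx using (hJgt x hx).symm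
  have hJm : Measurable J := measurable_of_continuousOn_compl_singleton 0
    fun t ht => (hJc t ht).continuousWithinAt
  have hJb : ∀ t, J t ≤ 1 + m / δ * |t ^ (-p)| := fun t => by
    rcases le_or_gt t 0 with ht | ht
    · rw [hJle t ht]
      have : 0 ≤ m / δ * |t ^ (-p)| := by positivity
      linarith
    · rw [hJgt t ht, abs_of_pos (by positivity)]
      have e1 := h.pos t ht
      have e2 : t ^ (m - 1) = t ^ (m + p - 1) * t ^ (-p) := by
        rw [← Real.rpow_add ht]; congr 1; ring
      have e3 : m * t ^ (m - 1) / P t ≤ m / δ * t ^ (-p) := by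
        rw [div_le_iff₀ e1, e2]
        calc m * (t ^ (m + p - 1) * t ^ (-p))
            = m / δ * t ^ (-p) * (δ * t ^ (m + p - 1)) := by field_simp
          _ ≤ m / δ * t ^ (-p) * P t := by
            have := hP t ht
            gcongr
      linarith
  have hJi : ∀ a b, IntervalIntegrable J volume a b := fun a b => by
    have e1 : IntervalIntegrable (fun t : ℝ => 1 + m / δ * |t ^ (-p)|) volume a b :=
      intervalIntegrable_const.add
        ((intervalIntegral.intervalIntegrable_rpow' (by linarith [H.p_lt])).abs.const_mul _)
    refine e1.mono_fun' hJm.aestronglyMeasurable (Eventually.of_forall fun t => ?_)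
    simpa [abs_of_pos (hJpos t)] using hJb t
  set Y : ℝ → ℝ := fun s => ∫ t in (0 : ℝ)..s, J t with hY
  have hYc : Continuous Y := intervalIntegral.continuous_primitive hJi 0
  have hYm : StrictMono Y := fun a b hab => by
    have e1 := intervalIntegral.intervalIntegral_pos_of_pos (hJi a b) hJpos hab
    have e2 := intervalIntegral.integral_interval_sub_left (hJi 0 b) (hJi 0 a)
    simp only [hY]
    linarith
  have hYd : ∀ s, 0 < s → HasDerivAt Y (m * s ^ (m - 1) / P s) s := fun s hs => by
    have := intervalIntegral.integral_hasDerivAt_right (hJi 0 s)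
      hJm.stronglyMeasurable.stronglyMeasurableAtFilter (hJc s hs.ne')
    rwa [hJgt s hs] at this
  have hYbot : Tendsto Y atBot atBot := by
    refine tendsto_id.congr' ?_
    filter_upwards [eventually_le_atBot (0 : ℝ)] with s hs
    have : Y s = ∫ t in (0 : ℝ)..s, (1 : ℝ) := by
      refine intervalIntegral.integral_congr fun t ht => ?_
      rw [Set.uIcc_of_ge hs] at ht
      exact hJle t ht.2
    rw [this]
    simp
  have hYtop : Tendsto Y atTop atTop := by
    obtain ⟨α, S, hα, hS, hgood⟩ := hg
    have hk := H.k_pos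
    set S₁ := max S 1 with hS₁
    have hS₁1 : 1 ≤ S₁ := le_max_right _ _
    set C := m / (k + α) with hC
    have hC0 : 0 < C := by positivity
    have hlow : ∀ s, S₁ ≤ s → Y S₁ - C * Real.log S₁ ≤ Y s - C * Real.log s := fun s hs => by
      have hd : ∀ t, S₁ ≤ t → HasDerivAt (fun s => Y s - C * Real.log s)
          (m * t ^ (m - 1) / P t - C * t⁻¹) t := fun t ht => by
        have ht0 : 0 < t := by linarith
        exact (hYd t ht0).sub ((Real.hasDerivAt_log ht0.ne').const_mul C)
      refine le_of_hasDerivAt_nonneg hs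
        (fun t ht => (hd t ht.1).continuousAt.continuousWithinAt)
        (fun t ht => hd t ht.1.le) fun t ht => ?_
      have ht1 : 1 ≤ t := hS₁1.trans ht.1.le
      have ht0 : 0 < t := by linarith
      have e1 := (abs_le.1 (hgood t ((le_max_left _ _).trans ht.1.le))).2
      have e2 : t ≤ t ^ m := by
        simpa using Real.rpow_le_rpow_of_exponent_le ht1 hm.le
      have e3 : P t ≤ (k + α) * t ^ m := by
        have := mul_le_mul_of_nonneg_left e2 hα.le
        linarith
      have e4 := h.pos t ht0
      rw [sub_nonneg, le_div_iff₀ e4]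
      calc C * t⁻¹ * P t ≤ C * t⁻¹ * ((k + α) * t ^ m) := by gcongr
        _ = m * t ^ (m - 1) := by
          rw [hC, ← rpow_sub_one_mul ht0 m]; field_simp
    have hlog : Tendsto (fun s => Y S₁ - C * Real.log S₁ + C * Real.log s) atTop atTop :=
      tendsto_atTop_add_const_left _ _ (Real.tendsto_log_atTop.const_mul_atTop hC0)
    refine tendsto_atTop_mono' _ ?_ hlog
    filter_upwards [eventually_ge_atTop S₁] with s hs
    have := hlow s hs
    linarith
  set e := hYm.orderIsoOfSurjective Y (hYc.surjective hYtop hYbot) with he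
  refine ⟨Y, e.symm, hYc, e.symm.continuous, hYm, by simp [hY], fun s => e.symm_apply_apply s,
    fun y => e.apply_symm_apply y, hYd⟩

namespace IsTravelTime

variable {m p k l c : ℝ} {P Y W : ℝ → ℝ}

theorem inv_nonpos (hT : IsTravelTime m P Y W) {y : ℝ} (hy : y ≤ 0) : W y ≤ 0 :=
  hT.strictMono.le_iff_le.1 (by rw [hT.apply_inv, hT.zero]; exact hy)

theorem inv_pos (hT : IsTravelTime m P Y W) {y : ℝ} (hy : 0 < y) : 0 < W y :=
  hT.strictMono.lt_iff_lt.1 (by rw [hT.apply_inv, hT.zero]; exact hy)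

/-- A wave with orbit `P` is determined by the position of its interface. -/
theorem eq_max_inv (hT : IsTravelTime m P Y W) (hm : 0 < m) (hP : ∀ s, 0 < s → 0 < P s)
    {f : ℝ → ℝ} {y₀ : ℝ} (hf : Continuous f) (hI : HasInterfaceAt f y₀)
    (hd : ∀ y, y < y₀ → HasDerivAt f (-P (f y) / (m * f y ^ (m - 1))) y) (y : ℝ) :
    f y = max 0 (W (y₀ - y)) := by
  rcases lt_or_ge y y₀ with hy | hy
  · have hder : ∀ z, z < y₀ → HasDerivAt (fun z => Y (f z) + z) 0 z := fun z hz => by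
      have hfz := hI.1 z hz
      have hPz := hP _ hfz
      refine ((HasDerivAt.comp z (hT.hasDerivAt _ hfz) (hd z hz)).add
        (hasDerivAt_id z)).congr_deriv ?_
      have : 0 < f z ^ (m - 1) := by positivity
      field_simp
      ring
    have hcont : Continuous fun z => Y (f z) + z := (hT.continuous.comp hf).add continuous_id
    have e1 := le_of_hasDerivAt_nonneg hy.le hcont.continuousOn
      (fun z hz => hder z hz.2) (fun _ _ => le_rfl)
    have e2 := le_of_hasDerivAt_nonneg hy.le hcont.neg.continuousOn
      (fun z hz => (hder z hz.2).neg) (fun _ _ => by simp)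
    simp only [Pi.neg_apply, hI.2 y₀ le_rfl, hT.zero] at e1 e2
    have e3 : Y (f y) = y₀ - y := by linarith
    rw [← e3, hT.inv_apply, max_eq_right (hI.1 y hy).le]
  · rw [hI.2 y hy, max_eq_left (hT.inv_nonpos (by linarith))]

theorem hasInterfaceAt (hT : IsTravelTime m P Y W) :
    HasInterfaceAt (fun y => max 0 (W (-y))) 0 :=
  ⟨fun _ hy => lt_max_of_lt_right (hT.inv_pos (by linarith)),
    fun _ hy => max_eq_left (hT.inv_nonpos (by linarith))⟩

theorem max_inv_of_neg (hT : IsTravelTime m P Y W) {y : ℝ} (hy : y < 0) :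
    max 0 (W (-y)) = W (-y) := max_eq_right (hT.inv_pos (by linarith)).le

theorem hasDerivAt_profile (hT : IsTravelTime m P Y W) (hm : 0 < m)
    (hP : ∀ s, 0 < s → 0 < P s) {y : ℝ} (hy : y < 0) :
    HasDerivAt (fun y => max 0 (W (-y)))
      (-P (max 0 (W (-y))) / (m * max 0 (W (-y)) ^ (m - 1))) y := by
  have hW := hT.inv_pos (y := -y) (by linarith)
  have hPW := hP _ hW
  have e1 : HasDerivAt W (m * W (-y) ^ (m - 1) / P (W (-y)))⁻¹ (-y) :=
    HasDerivAt.of_local_left_inverse hT.continuous_inv.continuousAt (hT.hasDerivAt _ hW)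
      (by positivity) (Eventually.of_forall hT.apply_inv)
  have e2 := HasDerivAt.comp y e1 (hasDerivAt_neg y)
  rw [hT.max_inv_of_neg hy]
  refine (e2.congr_deriv ?_).congr_of_eventuallyEq ?_
  · rw [inv_div]; ring
  · filter_upwards [Iio_mem_nhds hy] with x hx using hT.max_inv_of_neg hx

/-- The wave constructed from an orbit that reaches the origin. -/
theorem exists_isProfile (hT : IsTravelTime m P Y W) (H : Admissible m p k l)
    (h : IsOrbit m p k l c P) (h0 : Tendsto P (𝓝[>] 0) (𝓝 0)) :
    ∃ Φ, IsProfile m p (k + l) (k * l) c (fun y => max 0 (W (-y))) Φ := by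
  have hm0 : 0 < m := by linarith [H.one_lt]
  have hp0 := H.p_pos
  set f : ℝ → ℝ := fun y => max 0 (W (-y)) with hfdef
  -- Extending P by 0 is continuous because the orbit reaches the origin. This makes the flux
  -- continuous across the interface.
  set Q : ℝ → ℝ := fun s => if s ≤ 0 then 0 else P s with hQ
  have hQle : ∀ t, t ≤ 0 → Q t = 0 := fun t ht => by simp [hQ, ht]
  have hQgt : ∀ t, 0 < t → Q t = P t := fun t ht => by simp [hQ, not_le.2 ht]
  have hQc : Continuous Q := by
    refine continuous_iff_continuousAt.2 fun t => ?_
    rcases lt_trichotomy t 0 with ht | rfl | ht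
    · refine (continuousAt_const (y := (0 : ℝ))).congr ?_
      filter_upwards [Iio_mem_nhds ht] with x hx using (hQle x (le_of_lt hx)).symm
    · rw [continuousAt_iff_punctured_nhds, ← nhdsLT_sup_nhdsGT, hQle 0 le_rfl]
      refine Tendsto.sup (tendsto_const_nhds.congr' ?_) (h0.congr' ?_)
      · filter_upwards [self_mem_nhdsWithin] with x hx using (hQle x (le_of_lt hx)).symm
      · filter_upwards [self_mem_nhdsWithin] with x hx using (hQgt x hx).symm
    · refine (h.hasDerivAt t ht).continuousAt.congr ?_
      filter_upwards [Ioi_mem_nhds ht] with x hx using (hQgt x hx).symm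
  have hfc : Continuous f := continuous_const.max (hT.continuous_inv.comp continuous_neg)
  have hI : HasInterfaceAt f 0 := hT.hasInterfaceAt
  have hfd : ∀ y, y < 0 → HasDerivAt f (-P (f y) / (m * f y ^ (m - 1))) y :=
    fun y hy => hT.hasDerivAt_profile hm0 h.pos hy
  have hfm : Continuous fun y => f y ^ m := hfc.rpow_const fun _ => Or.inr hm0.le
  have hfp : Continuous fun y => f y ^ p := hfc.rpow_const fun _ => Or.inr hp0.le
  have hQf : Continuous fun y => Q (f y) := hQc.comp hfc
  set Φ : ℝ → ℝ := fun y => (k + l) * f y ^ m + c * f y - Q (f y) with hΦ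
  have hΦc : Continuous Φ := ((hfm.const_mul _).add (hfc.const_mul _)).sub hQf
  have hzero : ∀ y, 0 < y → ∀ᶠ x in 𝓝 y, f x = 0 := fun y hy => by
    filter_upwards [Ioi_mem_nhds hy] with x hx using hI.2 x (le_of_lt hx)
  refine ⟨Φ, hfc, fun y => le_max_left _ _, fun y => ?_, fun y => ?_⟩
  -- At the interface the derivative is the common limit of the derivatives on both sides.
  · refine hasDerivAt_of_hasDerivAt_of_ne' (x := 0)
      (g := fun y => Φ y - (k + l) * f y ^ m - c * f y) (fun y hy => ?_) hfm.continuousAt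
      ((hΦc.sub (hfm.const_mul _)).sub (hfc.const_mul _)).continuousAt y
    rcases hy.lt_or_gt with hy | hy
    · have hfy := hI.1 y hy
      have : 0 < f y ^ (m - 1) := by positivity
      refine ((hfd y hy).rpow_const (Or.inl hfy.ne')).congr_deriv ?_
      simp only [hΦ, hQgt _ hfy]
      field_simp
      ring
    · have e1 := hI.2 y hy.le
      refine ((hasDerivAt_const y (0 : ℝ)).congr_of_eventuallyEq ?_).congr_deriv ?_
      · filter_upwards [hzero y hy] with x hx
        rw [hx, Real.zero_rpow hm0.ne']
      · simp [hΦ, e1, hQle, Real.zero_rpow hm0.ne']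
  · refine hasDerivAt_of_hasDerivAt_of_ne' (x := 0)
      (g := fun y => -(k * l * f y ^ m + f y ^ p)) (fun y hy => ?_) hΦc.continuousAt
      ((hfm.const_mul _).add hfp).neg.continuousAt y
    rcases hy.lt_or_gt with hy | hy
    · have hfy := hI.1 y hy
      have hPy := h.pos _ hfy
      have : 0 < f y ^ (m - 1) := by positivity
      refine ((HasDerivAt.comp y (h.hasDerivAt_flux hfy) (hfd y hy)).congr_deriv
        ?_).congr_of_eventuallyEq ?_
      · field_simp
      · filter_upwards [Iio_mem_nhds hy] with x hx
        simp only [hΦ, hQgt _ (hI.1 x hx), Function.comp]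
    · have e1 := hI.2 y hy.le
      refine ((hasDerivAt_const y (0 : ℝ)).congr_of_eventuallyEq ?_).congr_deriv ?_
      · filter_upwards [hzero y hy] with x hx
        simp [hΦ, hx, hQle, Real.zero_rpow hm0.ne']
      · simp [e1, Real.zero_rpow hm0.ne', Real.zero_rpow hp0.ne']

/-- `log s - 2/(m-1) * Y s` converges as `s → ∞`. -/
theorem exists_tendsto_log_sub (hT : IsTravelTime m P Y W)
    (H : Admissible m p (rootK m) l) (h : IsOrbit m p (rootK m) l c P)
    (hg : IsGoodAtInfinity m (rootK m) P) :
    ∃ L, Tendsto (fun s => Real.log s - 2 / (m - 1) * Y s) atTop (𝓝 L) := by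
  obtain ⟨α, S, hα, hS, hgood⟩ := hg
  have hm := H.one_lt
  have hm0 : 0 < m := by linarith
  have hk := H.k_pos
  obtain ⟨S', hS', hlin⟩ := exists_forall_mul_le_rpow hm α (half_pos hk)
  set S₁ := max S S' with hS₁
  have hS₁0 : 0 < S₁ := hS.trans_le (le_max_left _ _)
  set D : ℝ → ℝ := fun s => s⁻¹ - 2 / (m - 1) * (m * s ^ (m - 1) / P s) with hD
  have hd : ∀ s, S₁ ≤ s → HasDerivAt (fun s => Real.log s - 2 / (m - 1) * Y s) (D s) s :=
    fun s hs => by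
      have hs0 : 0 < s := hS₁0.trans_le hs
      exact (Real.hasDerivAt_log hs0.ne').sub ((hT.hasDerivAt s hs0).const_mul _)
  have hk2 : rootK m = m * (2 / (m - 1)) := by unfold rootK; ring
  -- Since rootK m = 2m/(m-1), the terms of order 1/s cancel and the error O(s) in P leaves
  -- O(s^(-m)), integrable as m > 1.
  have hDb : ∀ s, S₁ ≤ s → |D s| ≤ 2 * α / rootK m * s ^ (-m) := fun s hs => by
    have hs0 : 0 < s := hS₁0.trans_le hs
    have hPs := h.pos s hs0
    have e1 := hgood s ((le_max_left _ _).trans hs)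
    have e2 := hlin s ((le_max_right _ _).trans hs)
    have e3 : rootK m / 2 * s ^ m ≤ P s := by
      have := (abs_le.1 e1).1
      linarith
    have e4 : D s = (P s - rootK m * s ^ m) / (s * P s) := by
      rw [hk2, ← rpow_sub_one_mul hs0 m, hD]
      field_simp
    have hsm : 0 < s ^ m := by positivity
    rw [e4, abs_div, abs_of_pos (show 0 < s * P s by positivity), div_le_iff₀ (by positivity),
      Real.rpow_neg hs0.le]
    calc |P s - rootK m * s ^ m| ≤ α * s := e1
      _ = 2 * α / rootK m * (s ^ m)⁻¹ * (s * (rootK m / 2 * s ^ m)) := by field_simp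
      _ ≤ 2 * α / rootK m * (s ^ m)⁻¹ * (s * P s) := by gcongr
  have hDc : ContinuousOn D (Set.Ioi S₁) := fun s hs => by
    have hs0 : 0 < s := hS₁0.trans hs
    refine ContinuousAt.continuousWithinAt ?_
    exact (continuousAt_inv₀ hs0.ne').sub (((Real.continuousAt_rpow_const s (m - 1)
      (Or.inl hs0.ne')).const_mul m).div (h.hasDerivAt s hs0).continuousAt
      (h.pos s hs0).ne' |>.const_mul _)
  have hDi : IntegrableOn D (Set.Ioi S₁) := by
    refine Integrable.mono' ((integrableOn_Ioi_rpow_of_lt (show -m < -1 by linarith) hS₁0).const_mul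
      (2 * α / rootK m)) (hDc.aestronglyMeasurable measurableSet_Ioi) ?_
    refine (ae_restrict_iff' measurableSet_Ioi).2 (Eventually.of_forall fun s hs => ?_)
    exact hDb s (le_of_lt hs)
  exact ⟨_, tendsto_limUnder_of_hasDerivAt_of_integrableOn_Ioi
    (fun s hs => hd s (le_of_lt hs)) hDi⟩

/-- Waves with an orbit that is good at infinity are regular at the origin. -/
theorem regularAtOrigin {N : ℝ} (hN : 0 < N) (hT : IsTravelTime m P Y W)
    (H : Admissible m p (rootK m) l) (h : IsOrbit m p (rootK m) l c P)
    (hg : IsGoodAtInfinity m (rootK m) P) : RegularAtOrigin m N fun y => max 0 (W (-y)) := by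
  have hm := H.one_lt
  have hm0 : 0 < m := by linarith
  obtain ⟨L, hL⟩ := hT.exists_tendsto_log_sub H h hg
  obtain ⟨α, S, hα, hS, hgood⟩ := hg
  have hfd := fun y hy => hT.hasDerivAt_profile hm0 h.pos (y := y) hy
  have hI := hT.hasInterfaceAt
  have hYf : ∀ y, y < 0 → Y (max 0 (W (-y))) = -y := fun y hy => by
    rw [hT.max_inv_of_neg hy, hT.apply_inv]
  set f : ℝ → ℝ := fun y => max 0 (W (-y)) with hf
  set q := 2 / (m - 1) with hq
  have hqm : q * (m - 1) = 2 := div_mul_cancel₀ _ (by linarith)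
  have hftop : Tendsto f atBot atTop := by
    refine tendsto_atTop.2 fun b => ?_
    filter_upwards [eventually_lt_atBot (0 : ℝ), eventually_le_atBot (-Y b)] with y hy hb
    refine hT.strictMono.le_iff_le.1 ?_
    rw [hYf y hy]
    linarith
  have hG : Tendsto (fun y => Real.exp (q * y) * f y) atBot (𝓝 (Real.exp L)) := by
    refine ((Real.continuous_exp.tendsto L).comp (hL.comp hftop)).congr' ?_
    filter_upwards [eventually_lt_atBot (0 : ℝ)] with y hy
    have hfy := hI.1 y hy
    simp only [Function.comp]
    rw [show Real.log (f y) - q * Y (f y) = q * y + Real.log (f y) by rw [hYf y hy]; ring,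
      Real.exp_add, Real.exp_log hfy]
  have hk2 : rootK m = m * q := by unfold rootK; ring
  -- ξ^(r-1) F' = O(ξ^r) in the radial variable; r = 1 gives F' → 0 and r = N gives the flux
  -- condition.
  have key : ∀ r : ℝ, 0 < r → Tendsto (fun y => Real.exp ((r - 1) * y)
      * deriv (radialProfile m f) (Real.exp y)) atBot (𝓝 0) := fun r hr => by
    have e1 : Tendsto (fun y => α / m * (Real.exp (r * y)
        * (Real.exp (q * y) * f y) ^ (2 - m))) atBot
        (𝓝 (α / m * (0 * Real.exp L ^ (2 - m)))) :=
      ((tendsto_exp_mul_atBot hr).mul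
        (hG.rpow_const (Or.inl (Real.exp_pos L).ne'))).const_mul _
    rw [zero_mul, mul_zero] at e1
    refine squeeze_zero_norm' ?_ e1
    filter_upwards [eventually_lt_atBot (0 : ℝ), hftop.eventually_ge_atTop S] with y hy hSy
    have hfy := hI.1 y hy
    have e2 := hgood (f y) hSy
    rw [(hasDerivAt_radialProfile (hfd y hy)).deriv]
    have hfm : 0 < f y ^ (m - 1) := by positivity
    have e3 : q * f y + -P (f y) / (m * f y ^ (m - 1))
        = -(P (f y) - rootK m * f y ^ m) / (m * f y ^ (m - 1)) := by
      rw [hk2, ← rpow_sub_one_mul hfy m]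
      field_simp
      ring
    have e4 : f y ^ (2 - m) * f y ^ (m - 1) = f y := by
      rw [← Real.rpow_add hfy]; norm_num
    have e5 : Real.exp (r * y) * Real.exp (q * y) ^ (2 - m)
        = Real.exp ((r - 1) * y) * Real.exp ((q - 1) * y) := by
      rw [← Real.exp_mul, ← Real.exp_add, ← Real.exp_add]
      congr 1
      linear_combination -y * hqm
    rw [e3, Real.norm_eq_abs, abs_mul, abs_mul, abs_of_pos (Real.exp_pos _),
      abs_of_pos (Real.exp_pos _), abs_div, abs_neg, abs_of_pos (show 0 < m * f y ^ (m - 1) by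
      positivity), Real.mul_rpow (Real.exp_pos _).le hfy.le, ← mul_assoc (Real.exp (r * y)), e5,
      ← mul_assoc]
    have e6 : |P (f y) - rootK m * f y ^ m| / (m * f y ^ (m - 1)) ≤ α / m * f y ^ (2 - m) := by
      rw [div_le_iff₀ (by positivity)]
      calc _ ≤ α * f y := e2
        _ = α / m * (m * (f y ^ (2 - m) * f y ^ (m - 1))) := by rw [e4]; field_simp
        _ = _ := by ring
    calc _ ≤ Real.exp ((r - 1) * y) * Real.exp ((q - 1) * y) * (α / m * f y ^ (2 - m)) := by
          gcongr
      _ = _ := by ring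
  refine ⟨⟨Real.exp L, Real.exp_pos L, ?_⟩, ?_, ?_⟩
  · rw [tendsto_nhdsGT_zero_iff_comp_exp]
    simpa only [radialProfile_exp] using hG
  · rw [tendsto_nhdsGT_zero_iff_comp_exp]
    simpa using key 1 one_pos
  · rw [tendsto_nhdsGT_zero_iff_comp_exp]
    refine (key N hN).congr fun y => ?_
    rw [← Real.exp_mul, mul_comm y]

end IsTravelTime

/-! ### Interface behavior and the classification -/

/-- If `P s ~ B s^(m-q)` at the origin then waves with orbit `P` behave like `(y₀ - y)^(1/q)`
at the interface. -/
theorem interfaceBehavior_of_tendsto {m q B y₀ : ℝ} (hm : 0 < m) (hq : 0 < q) (hB : 0 < B)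
    {f P : ℝ → ℝ} (hf : Continuous f) (hI : HasInterfaceAt f y₀)
    (hd : ∀ y, y < y₀ → HasDerivAt f (-P (f y) / (m * f y ^ (m - 1))) y)
    (hP : Tendsto (fun s => P s * s ^ (q - m)) (𝓝[>] 0) (𝓝 B)) :
    InterfaceBehavior f y₀ (1 / q) := by
  have hf0 : Tendsto f (𝓝[<] y₀) (𝓝[>] 0) := by
    refine tendsto_nhdsWithin_iff.2 ⟨?_, ?_⟩
    · have := hf.continuousAt (x := y₀)
      rw [ContinuousAt, hI.2 y₀ le_rfl] at this
      exact this.mono_left nhdsWithin_le_nhds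
    · filter_upwards [self_mem_nhdsWithin] with y hy using hI.1 y hy
  have hdq : ∀ y, y < y₀ → HasDerivAt (fun y => f y ^ q)
      (-(q / m * (P (f y) * f y ^ (q - m)))) y := fun y hy => by
    have hfy := hI.1 y hy
    refine ((hd y hy).rpow_const (Or.inl hfy.ne')).congr_deriv ?_
    have : f y ^ (q - 1) = f y ^ (q - m) * f y ^ (m - 1) := by
      rw [← Real.rpow_add hfy]; congr 1; ring
    have h2 : 0 < f y ^ (m - 1) := by positivity
    rw [this]
    field_simp
  have hlin : ∀ y, HasDerivAt (fun y => y₀ - y) (-1) y := fun y => by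
    simpa using (hasDerivAt_id y).const_sub y₀
  -- L'Hôpital's rule: the derivative of f^q is -(q/m) P(f) f^(q-m), which converges.
  have hlim : Tendsto (fun y => f y ^ q / (y₀ - y)) (𝓝[<] y₀) (𝓝 (q / m * B)) := by
    refine HasDerivAt.lhopital_zero_left_on_Ioo (a := y₀ - 1) (by linarith)
      (fun y hy => hdq y hy.2) (fun y _ => hlin y) (fun _ _ => by norm_num)
      ((tendsto_rpow_nhdsGT_zero hq).comp hf0) ?_ ?_
    · have : ContinuousAt (fun y => y₀ - y) y₀ := (hlin y₀).continuousAt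
      rw [ContinuousAt, sub_self] at this
      exact this.mono_left nhdsWithin_le_nhds
    · refine ((hP.comp hf0).const_mul (q / m)).congr fun y => ?_
      simp
  have hC : 0 < q / m * B := by positivity
  refine ⟨(q / m * B) ^ (1 / q), by positivity,
    (hlim.rpow_const (p := 1 / q) (Or.inl hC.ne')).congr' ?_⟩
  filter_upwards [self_mem_nhdsWithin] with y hy
  have hfy := (hI.1 y hy).le
  have hy' : 0 ≤ y₀ - y := sub_nonneg.2 (le_of_lt hy)
  rw [Real.div_rpow (by positivity) hy', ← Real.rpow_mul hfy, mul_one_div_cancel hq.ne',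
    Real.rpow_one]

theorem IsTravelingWave.exists_isProfile {m p N c : ℝ} {f : ℝ → ℝ} (hm : 1 < m) (hp : 0 < p)
    (h : IsTravelingWave m p N c f) :
    f ≠ 0 ∧ ∃ Φ, IsProfile m p (rootK m + rootL m N) (rootK m * rootL m N) c f Φ := by
  rw [← convCoeff_eq hm, ← reactCoeff_eq hm]
  exact (isTravelingWave_iff (by linarith) hp).1 h

/-- A good wave has positive speed, an interface, and an orbit. -/
theorem IsGoodTravelingWave.exists_orbit {m p N c : ℝ} {f : ℝ → ℝ} (hm : 1 < m) (hp0 : 0 < p)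
    (hp1 : p < 1) (hN : 0 < N) (h : IsGoodTravelingWave m p N c f) :
    0 < c ∧ Continuous f ∧ ∃ y₀ P, HasInterfaceAt f y₀ ∧
      IsOrbit m p (rootK m) (rootL m N) c P ∧ IsGoodAtInfinity m (rootK m) P ∧
      Tendsto P (𝓝[>] 0) (𝓝 0) ∧
      ∀ y, y < y₀ → HasDerivAt f (-P (f y) / (m * f y ^ (m - 1))) y := by
  have H := admissible_roots hm hp0 hp1 hN
  obtain ⟨hf, Φ, hΦ⟩ := h.1.exists_isProfile hm hp0
  obtain ⟨hc, y₀, hI⟩ := hΦ.exists_hasInterfaceAt hm hp0 hp1 (add_pos H.k_pos H.l_pos)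
    (mul_pos H.k_pos H.l_pos) hf
  obtain ⟨P, hP⟩ := hΦ.exists_orbit H hN hc hI h.2
  exact ⟨hc, hΦ.cont, y₀, P, hI, hP⟩

theorem exists_isGoodTravelingWave {m p N c : ℝ} (hm : 1 < m) (hp0 : 0 < p)
    (hp1 : p < 1) (hN : 0 < N) {P Y W : ℝ → ℝ}
    (hP : IsOrbit m p (rootK m) (rootL m N) c P) (hg : IsGoodAtInfinity m (rootK m) P)
    (h0 : Tendsto P (𝓝[>] 0) (𝓝 0)) (hT : IsTravelTime m P Y W) :
    ∃ f, IsGoodTravelingWave m p N c f := by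
  have H := admissible_roots hm hp0 hp1 hN
  refine ⟨_, (isTravelingWave_iff (by linarith) hp0).2 ⟨fun he => ?_, ?_⟩,
    hT.regularAtOrigin hN H hP hg⟩
  · have := hT.hasInterfaceAt.1 (-1) (by norm_num)
    exact this.ne' (congrFun he (-1))
  · rw [convCoeff_eq hm, reactCoeff_eq hm]
    exact hT.exists_isProfile H hP h0

/-- Both waves have the same good orbit. The constructed copy R of it carries the power lower bound
needed for the travel time, which then determines each wave from its interface. -/
theorem IsGoodTravelingWave.eq_translate {m p N c : ℝ} {f g : ℝ → ℝ} (hm : 1 < m) (hp0 : 0 < p)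
    (hp1 : p < 1) (hN : 0 < N) (hf : IsGoodTravelingWave m p N c f)
    (hg : IsGoodTravelingWave m p N c g) : ∃ h : ℝ, ∀ y : ℝ, g y = f (y + h) := by
  have H := admissible_roots hm hp0 hp1 hN
  obtain ⟨hc, hfc, y₁, P, hI₁, hP, gP, -, hd₁⟩ := hf.exists_orbit hm hp0 hp1 hN
  obtain ⟨-, hgc, y₂, Q, hI₂, hQ, gQ, -, hd₂⟩ := hg.exists_orbit hm hp0 hp1 hN
  obtain ⟨R, hR, gR, δ, hδ, hRδ⟩ := exists_good_orbit H hc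
  obtain ⟨Y, W, hT⟩ := exists_isTravelTime H hR gR hδ hRδ
  have hm0 : 0 < m := by linarith
  have e₁ := hT.eq_max_inv hm0 hR.pos hfc hI₁ fun y hy => by
    rw [← hP.unique H hR gP gR (hI₁.1 y hy)]; exact hd₁ y hy
  have e₂ := hT.eq_max_inv hm0 hR.pos hgc hI₂ fun y hy => by
    rw [← hQ.unique H hR gQ gR (hI₂.1 y hy)]; exact hd₂ y hy
  refine ⟨y₁ - y₂, fun y => ?_⟩
  rw [e₁, e₂]
  congr 2
  ring

theorem theorem6p1 (m p N : ℝ) (hm : 1 < m) (hp0 : 0 < p) (hp1 : p < 1) (hN : 0 < N) :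
    (2 ≤ m + p →
      ∃! cs : ℝ, 0 < cs ∧
        (∀ c : ℝ, (∃ f : ℝ → ℝ, IsGoodTravelingWave m p N c f) ↔ cs ≤ c) ∧
        (∀ (c : ℝ) (f g : ℝ → ℝ), IsGoodTravelingWave m p N c f →
          IsGoodTravelingWave m p N c g → ∃ h : ℝ, ∀ y : ℝ, g y = f (y + h)) ∧
        (∀ (c : ℝ) (f : ℝ → ℝ), IsGoodTravelingWave m p N c f →
          ∃ y₀ : ℝ, HasInterfaceAt f y₀) ∧
        (2 < m + p →
          (∀ f : ℝ → ℝ, IsGoodTravelingWave m p N cs f → HasTypeI m f) ∧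
          (∀ (c : ℝ) (f : ℝ → ℝ), cs < c → IsGoodTravelingWave m p N c f →
            HasTypeII p f))) ∧
    (m + p < 2 → ¬ ∃ (c : ℝ) (f : ℝ → ℝ), IsTravelingWave m p N c f) := by
  have H := admissible_roots hm hp0 hp1 hN
  have hm0 : 0 < m := by linarith
  refine ⟨fun hmp => ?_, ?_⟩
  · obtain ⟨cs, hcs, hiff, htype⟩ := exists_critical_speed H hmp
    have hex : ∀ c : ℝ, (∃ f : ℝ → ℝ, IsGoodTravelingWave m p N c f) ↔ cs ≤ c := fun c => by
      constructor
      · rintro ⟨f, hf⟩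
        obtain ⟨hc, -, y₀, P, -, hP, gP, h0, -⟩ := hf.exists_orbit hm hp0 hp1 hN
        exact (hiff c P hc hP gP).1 h0
      · intro hle
        have hc := hcs.trans_le hle
        obtain ⟨P, hP, gP, δ, hδ, hPδ⟩ := exists_good_orbit H hc
        obtain ⟨Y, W, hT⟩ := exists_isTravelTime H hP gP hδ hPδ
        exact exists_isGoodTravelingWave hm hp0 hp1 hN hP gP ((hiff c P hc hP gP).2 hle) hT
    refine ⟨cs, ⟨hcs, hex, fun c f g hf hg => hf.eq_translate hm hp0 hp1 hN hg,
      fun c f hf => ?_, fun hlt => ⟨fun f hf => ?_, fun c f hc hf => ?_⟩⟩, ?_⟩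
    · obtain ⟨-, -, y₀, P, hI, -⟩ := hf.exists_orbit hm hp0 hp1 hN
      exact ⟨y₀, hI⟩
    · obtain ⟨-, hfc, y₀, P, hI, hP, gP, -, hd⟩ := hf.exists_orbit hm hp0 hp1 hN
      -- Here q = m - 1, so s^(m-q) = s.
      refine ⟨y₀, hI, interfaceBehavior_of_tendsto hm0 (by linarith) hcs hfc hI hd
        (((htype hlt).1 P hP gP).congr' ?_)⟩
      filter_upwards [self_mem_nhdsWithin] with s hs
      rw [show m - 1 - m = -1 by ring, Real.rpow_neg_one, div_eq_mul_inv]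
    · obtain ⟨hc0, hfc, y₀, P, hI, hP, gP, -, hd⟩ := hf.exists_orbit hm hp0 hp1 hN
      -- Here q = 1 - p, so s^(m-q) = s^(m+p-1).
      refine ⟨y₀, hI, interfaceBehavior_of_tendsto hm0 (by linarith) (div_pos hm0 hc0) hfc hI hd
        (((htype hlt).2 c P hc hP gP).congr' ?_)⟩
      filter_upwards [self_mem_nhdsWithin] with s hs
      rw [show 1 - p - m = -(m + p - 1) by ring, Real.rpow_neg (le_of_lt hs), div_eq_mul_inv]
    · rintro c ⟨-, hc, -⟩
      exact le_antisymm ((hc cs).1 ((hex cs).2 le_rfl)) ((hex c).1 ((hc c).2 le_rfl))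
  · rintro hlt ⟨c, f, hf⟩
    obtain ⟨hne, Φ, hΦ⟩ := hf.exists_isProfile hm hp0
    have := hΦ.two_le_add hm hp0 hp1 (add_pos H.k_pos H.l_pos) (mul_pos H.k_pos H.l_pos) hne
    linarith

end
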